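/- **Setting.** Consider the following four-dimensional metrics of signature $(-,+,+,+)$, with real parameters, at points where the line element is defined and Lorentzian and off the zeros of $Q$ (resp. $f$). 1. Kerr–NUT–(anti-)de Sitter, coordinates $(t,r,p,q)$, at points with $p^2+q^2\neq0$, $P(p)>0$, $Q(q)\ne0$: $$ds^2=\frac{-Q(dt-p^2dr)^2+P(dt+q^2dr)^2}{p^2+q^2}+\frac{p^2+q^2}{P}dp^2+\frac{p^2+q^2}{Q}dq^2,$$ $P=(a^2-(p-l)^2)\bigl(1+\tfrac13(p-l)(p+3l)\Lambda\bigr)$, $\;Q=a^2-l^2-2mq+q^2-\tfrac13[3l^2(a^2-l^2)+(a^2+6l^2)q^2+q^4]\Lambda$. 2. Kerr–Newman in Boyer–Lindquist coordinates $(t,r,\theta,\phi)$ (Kerr if $q=0$), at points with $R\ne0$, $\sin\theta\neq0$, $Q\ne0$: $$ds^2=-\frac{Q}{R^2}(dt-a\sin^2\!\theta\, d\phi)^2+\frac{R^2}{Q}dr^2+R^2d\theta^2+\frac{\sin^2\theta}{R^2}\bigl((r^2+a^2)d\phi-a\,dt\bigr)^2,$$ $Q=r^2-2Mr+q^2+a^2$,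 $R^2=r^2+a^2\cos^2\theta$. 3. Reissner–Nordström–(anti-)de Sitter, at points with $r\ne0$, $\sin\theta\ne0$, $f\ne0$: $ds^2=-f\,dt^2+f^{-1}dr^2+r^2(d\theta^2+\sin^2\theta\, d\phi^2)$, $f=1-\frac{2M}{r}+\frac{q^2}{r^2}-\frac{\Lambda r^2}{3}$. Fix an orientation, with volume form $\varepsilon_{abcd}$, let $C_{abcd}$ be the Weyl tensor and $C^*_{abcd}=\frac12\varepsilon_{abef}C^{ef}{}_{cd}$. Put $I_1=C^{abcd}C_{abcd}$, $I_2=C^{*abcd}C_{abcd}$, $I_3=C^{abcd;e}C_{abcd;e}$, $I_4=C^{*abcd;e}C_{abcd;e}$, $I_5=(I_1)_{;a}(I_1)^{;a}$, $I_6=(I_2)_{;a}(I_2)^{;a}$, $I_7=(I_1)_{;a}(I_2)^{;a}$, and $$Q_1=\frac{(I_1^2-I_2^2)(I_5-I_6)+4I_1I_2I_7}{3\sqrt3(I_1^2+I_2^2)^{9/4}},\quad Q_2=\frac{I_5I_6-I_7^2}{27(I_1^2+I_2^2)^{5/2}},\quad Q_3=\frac{I_5+I_6}{6\sqrt3(I_1^2+I_2^2)^{5/4}}.$$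 A null tetrad is $(l,n,m,\bar m)$, $l,n$ real, with $l\cdot n=-1$, $m\cdot\bar m=1$, all other products zero, oriented by $\varepsilon_{abcd}l^an^bm^c\bar m^d=-i$. Put $\Psi_2=C_{abcd}l^am^b\bar m^cn^d$, $\Phi_{11}=\frac14R_{ab}(l^an^b+m^a\bar m^b)$, $\rho=-l_{a;b}m^a\bar m^b$, $\tau=-l_{a;b}m^an^b$, $\mu=n_{a;b}\bar m^am^b$, $\pi=n_{a;b}\bar m^al^b$. A *type D frame* is a smooth null tetrad on an open set in which $\Psi_2\neq0$ and $\Psi_0=\Psi_1=\Psi_3=\Psi_4=0$; it is *canonical* if also $\rho=\mu$ and $\tau=\pi$. Write $\nabla A.\nabla B=g^{ab}A_{,a}B_{,b}$ (complex bilinear), $\|dA\wedge dB\|^2=\frac12[(\nabla A.\nabla A)(\nabla B.\nabla B)-(\nabla A.\nabla B)^2]$, $\mathcal R$ for the real part, and $cc$ for the complex conjugate of the preceding expression. **Existence.** Each metric has a type D frame where its Weyl tensor is nonzero, and this frame can be chosen so that it is canonical where moreover $Q>0$ (resp. $f>0$). **All three families, any type D frame.** $$I_1+iI_2=48\Psi_2^2,\qquad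 I_3+iI_4=48\,\nabla\Psi_2.\nabla\Psi_2+576\,\Psi_2^2(\rho\mu-\tau\pi).$$ In the uncharged cases (Kerr–NUT–(A)dS, and $q=0$ in the other two families), $(96\Psi_2)^2(\nabla\Psi_2.\nabla\Psi_2)=12\cdot48\,\Psi_2^2(I_3+iI_4)/5$, so $I_3$ and $I_4$ are the real and imaginary parts of $80\,\nabla\Psi_2.\nabla\Psi_2$. Always $$I_5=\tfrac{96^2}{4}[\Psi_2^2(\nabla\Psi_2.\nabla\Psi_2)+cc+2\Psi_2\bar\Psi_2(\nabla\Psi_2.\nabla\bar\Psi_2)],\quad I_6=\tfrac{96^2}{4}[-\Psi_2^2(\nabla\Psi_2.\nabla\Psi_2)-cc+2\Psi_2\bar\Psi_2(\nabla\Psi_2.\nabla\bar\Psi_2)],$$ $$I_7=\tfrac{96^2}{4i}[\Psi_2^2(\nabla\Psi_2.\nabla\Psi_2)-cc],$$ $$Q_1=\frac{\mathcal R[\bar\Psi_2^2(\nabla\Psi_2.\nabla\Psi_2)]}{9|\Psi_2|^5},\quad Q_2=\frac{-2\|d\Psi_2\wedge d\bar\Psi_2\|^2}{18^2|\Psi_2|^6},\quad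 Q_3=\frac{\nabla\Psi_2.\nabla\bar\Psi_2}{18|\Psi_2|^3},$$ and $Q_2$ is dimensionless: it is unchanged under $g\mapsto c^2g$ for constant $c>0$. **Kerr–NUT–(A)dS, canonical frame.** $\nabla\Psi_2.\nabla\Psi_2=18\Psi_2^2(\rho^2-\tau^2)$, $\nabla\Psi_2.\nabla\bar\Psi_2=18|\Psi_2|^2(|\rho|^2+|\tau|^2)$, and $$Q_1=\frac{(\rho^2-\tau^2)+cc}{|\Psi_2|},\quad Q_2=\frac{(\rho\bar\tau+\bar\rho\tau)^2}{|\Psi_2|^2},\quad Q_3=\frac{|\rho|^2+|\tau|^2}{|\Psi_2|}.$$ **Kerr–Newman, canonical frame.** $$\nabla\Psi_2.\nabla\Psi_2=8(\rho^2-\tau^2)\Phi_{11}^2+24(\rho^2+\tau^2)\Psi_2\Phi_{11}+18\Psi_2^2(\rho^2-\tau^2),$$ $$\nabla\Psi_2.\nabla\bar\Psi_2=8(|\rho|^2+|\tau|^2)\Phi_{11}^2+(12(|\rho|^2-|\tau|^2)\bar\Psi_2+cc)\Phi_{11}+18|\Psi_2|^2(|\rho|^2+|\tau|^2),$$ $$Q_1=\frac89\frac{\mathcal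 R[\bar\Psi_2^2(\rho^2-\tau^2)]\Phi_{11}^2}{|\Psi_2|^5}+\frac83\frac{\mathcal R[(\rho^2+\tau^2)\bar\Psi_2]\Phi_{11}}{|\Psi_2|^3}+\frac{2\mathcal R[\rho^2-\tau^2]}{|\Psi_2|};$$ with $S=\rho\bar\tau+\bar\rho\tau$, $T=\rho\bar\tau-\bar\rho\tau$, $$Q_2=\frac{16}{81}\frac{S^2\Phi_{11}^4}{|\Psi_2|^6}+\frac{32}{27}\frac{\mathcal R[\Psi_2T]\,S\,\Phi_{11}^3}{|\Psi_2|^6}+\frac89\frac{(\mathcal R[\Psi_2^2T^2]-4|\Psi_2|^2\mathcal R[(\rho\bar\tau)^2])\Phi_{11}^2}{|\Psi_2|^6}-\frac83\frac{S\,\mathcal R[\Psi_2T]\,\Phi_{11}}{|\Psi_2|^4}+\frac{S^2}{|\Psi_2|^2},$$ $$Q_3=\frac49\frac{(|\rho|^2+|\tau|^2)\Phi_{11}^2}{|\Psi_2|^3}+\frac43\frac{\mathcal R[\Psi_2(|\rho|^2-|\tau|^2)]\Phi_{11}}{|\Psi_2|^3}+\frac{|\rho|^2+|\tau|^2}{|\Psi_2|}.$$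 **Reissner–Nordström–(A)dS, canonical frame.** $\tau=\pi=0$, $\rho$ and $\Psi_2$ are real, $Q_2=0$, and $$Q_1=2Q_3=\frac{8\rho^2\Phi_{11}^2}{9|\Psi_2|^3}+\frac{8\rho^2\Phi_{11}\Psi_2}{3|\Psi_2|^3}+\frac{2\rho^2}{|\Psi_2|}=\frac{\nabla\Psi_2.\nabla\Psi_2}{9|\Psi_2|^3}.$$ -/

import Mathlib

open scoped ComplexConjugate ContDiff

noncomputable section

namespace BlackHoleInvariants

/-! ### Lorentzian geometry in a coordinate chart of dimension four -/

/-- Coordinate values `(x⁰, x¹, x², x³)`. -/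
abbrev Pt := Fin 4 → ℝ

/-- A field of symmetric matrices `g_{ij}(x)`. -/
abbrev MetricField := Pt → Matrix (Fin 4) (Fin 4) ℝ

/-- A covariant tensor field of rank four, `T_{abcd}(x)`. -/
abbrev Tensor4 := Pt → Fin 4 → Fin 4 → Fin 4 → Fin 4 → ℝ

/-- Partial derivative `∂ f / ∂ xⁱ`. -/
def pd {E : Type*} [NormedAddCommGroup E] [NormedSpace ℝ E] (i : Fin 4) (f : Pt → E) (x : Pt) : E :=
  deriv (fun s => f (Function.update x i s)) (x i)

/-- Christoffel symbols `Γ^i_{jk}` of the Levi-Civita connection. -/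
def christoffel (g : MetricField) (i j k : Fin 4) (x : Pt) : ℝ :=
  (1 / 2) * ∑ l, (g x)⁻¹ i l *
    (pd j (fun y => g y l k) x + pd k (fun y => g y l j) x - pd l (fun y => g y j k) x)

/-- Curvature tensor `R^i_{jkl}`. -/
def riemannUp (g : MetricField) (i j k l : Fin 4) (x : Pt) : ℝ :=
  pd k (christoffel g i l j) x - pd l (christoffel g i k j) x +
    ∑ m, (christoffel g i k m x * christoffel g m l j x -
      christoffel g i l m x * christoffel g m k j x)

/-- Curvature tensor `R_{abcd}`. -/
def riemann (g : MetricField) : Tensor4 := fun x a b c d =>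
  ∑ e, g x a e * riemannUp g e b c d x

/-- Ricci tensor `R_{ab} = R^c_{acb}`. -/
def ricci (g : MetricField) (x : Pt) (a b : Fin 4) : ℝ := ∑ c, riemannUp g c a c b x

/-- Scalar curvature. -/
def scalarCurv (g : MetricField) (x : Pt) : ℝ := ∑ a, ∑ b, (g x)⁻¹ a b * ricci g x a b

/-- Weyl tensor `C_{abcd}` in dimension four. -/
def weyl (g : MetricField) : Tensor4 := fun x a b c d =>
  riemann g x a b c d
    - (1 / 2) * (g x a c * ricci g x b d - g x a d * ricci g x b c
        - g x b c * ricci g x a d + g x b d * ricci g x a c)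
    + (1 / 6) * scalarCurv g x * (g x a c * g x b d - g x a d * g x b c)

/-- The permutation symbol: the sign of `(a, b, c, d)` as a permutation of `(0, 1, 2, 3)`, and zero
if two of the indices agree. -/
def permSymbol (a b c d : Fin 4) : ℝ :=
  Matrix.det (Matrix.of fun i j : Fin 4 => if ![a, b, c, d] i = j then (1 : ℝ) else 0)

/-- The volume form `ε_{abcd}`; the sign `o` selects one of the two orientations of the chart. -/
def volForm (g : MetricField) (o : ℤˣ) (x : Pt) (a b c d : Fin 4) : ℝ :=
  ((o : ℤ) : ℝ) * Real.sqrt |(g x).det| * permSymbol a b c d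

/-- Dual Weyl tensor `C*_{abcd} = ½ ε_{abef} C^{ef}_{cd}`. -/
def weylDual (g : MetricField) (o : ℤˣ) : Tensor4 := fun x a b c d =>
  (1 / 2) * ∑ e, ∑ f, volForm g o x a b e f *
    ∑ p, ∑ q, (g x)⁻¹ e p * (g x)⁻¹ f q * weyl g x p q c d

/-- Covariant derivative `T_{abcd;e}`. -/
def covD (g : MetricField) (T : Tensor4) (x : Pt) (a b c d e : Fin 4) : ℝ :=
  pd e (fun y => T y a b c d) x - ∑ f,
    (christoffel g f e a x * T x f b c d + christoffel g f e b x * T x a f c d +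
      christoffel g f e c x * T x a b f d + christoffel g f e d x * T x a b c f)

/-- The full contraction `S^{abcd} T_{abcd}`. -/
def contract4 (g : MetricField) (S T : Tensor4) (x : Pt) : ℝ :=
  ∑ a, ∑ b, ∑ c, ∑ d, (∑ a', ∑ b', ∑ c', ∑ d',
    (g x)⁻¹ a a' * (g x)⁻¹ b b' * (g x)⁻¹ c c' * (g x)⁻¹ d d' * S x a' b' c' d') * T x a b c d

/-- The full contraction `S^{abcd;e} T_{abcd;e}`. -/
def contractCovD (g : MetricField) (S T : Tensor4) (x : Pt) : ℝ :=
  ∑ e, ∑ e', (g x)⁻¹ e e' *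
    ∑ a, ∑ b, ∑ c, ∑ d, (∑ a', ∑ b', ∑ c', ∑ d',
      (g x)⁻¹ a a' * (g x)⁻¹ b b' * (g x)⁻¹ c c' * (g x)⁻¹ d d' * covD g S x a' b' c' d' e') *
      covD g T x a b c d e

/-- `∇A · ∇B = g^{ij} A_{,i} B_{,j}`, bilinear in `A` and `B` (no complex conjugation). -/
def gradDot {A : Type*} [NormedRing A] [NormedAlgebra ℝ A] (g : MetricField) (f h : Pt → A)
    (x : Pt) : A :=
  ∑ i, ∑ j, (g x)⁻¹ i j • (pd i f x * pd j h x)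

/-- The permutation tensor `δ^{ab}_{cd}`. -/
def kroneckerDelta2 (a b c d : Fin 4) : ℂ :=
  (if a = c ∧ b = d then 1 else 0) - (if a = d ∧ b = c then 1 else 0)

/-- `‖df ∧ dh‖² = (1/2!) δ^{ab}_{cd} g^{cp} g^{dq} f_{;a} h_{;b} f_{;p} h_{;q}`. -/
def wedgeNormSq (g : MetricField) (f h : Pt → ℂ) (x : Pt) : ℂ :=
  (1 / 2) * ∑ a, ∑ b, ∑ c, ∑ d, ∑ p, ∑ q,
    kroneckerDelta2 a b c d * ((g x)⁻¹ c p : ℂ) * ((g x)⁻¹ d q : ℂ) *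
      pd a f x * pd b h x * pd p f x * pd q h x

/-! ### Scalar polynomial invariants -/

def I1 (g : MetricField) (x : Pt) : ℝ := contract4 g (weyl g) (weyl g) x

def I2 (g : MetricField) (o : ℤˣ) (x : Pt) : ℝ := contract4 g (weylDual g o) (weyl g) x

def I3 (g : MetricField) (x : Pt) : ℝ := contractCovD g (weyl g) (weyl g) x

def I4 (g : MetricField) (o : ℤˣ) (x : Pt) : ℝ := contractCovD g (weylDual g o) (weyl g) x

def I5 (g : MetricField) (x : Pt) : ℝ := gradDot g (I1 g) (I1 g) x

def I6 (g : MetricField) (o : ℤˣ) (x : Pt) : ℝ := gradDot g (I2 g o) (I2 g o) x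

def I7 (g : MetricField) (o : ℤˣ) (x : Pt) : ℝ := gradDot g (I1 g) (I2 g o) x

def Q1 (g : MetricField) (o : ℤˣ) (x : Pt) : ℝ :=
  ((I1 g x ^ 2 - I2 g o x ^ 2) * (I5 g x - I6 g o x) + 4 * I1 g x * I2 g o x * I7 g o x) /
    (3 * Real.sqrt 3 * (I1 g x ^ 2 + I2 g o x ^ 2) ^ (9 / 4 : ℝ))

def Q2 (g : MetricField) (o : ℤˣ) (x : Pt) : ℝ :=
  (I5 g x * I6 g o x - I7 g o x ^ 2) / (27 * (I1 g x ^ 2 + I2 g o x ^ 2) ^ (5 / 2 : ℝ))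

def Q3 (g : MetricField) (o : ℤˣ) (x : Pt) : ℝ :=
  (I5 g x + I6 g o x) / (6 * Real.sqrt 3 * (I1 g x ^ 2 + I2 g o x ^ 2) ^ (5 / 4 : ℝ))

/-! ### Null tetrads and Newman–Penrose quantities -/

/-- Contravariant components of vector fields `l, n` (real) and `m` (complex). -/
structure Tetrad where
  l : Pt → Fin 4 → ℝ
  n : Pt → Fin 4 → ℝ
  m : Pt → Fin 4 → ℂ

/-- The real vector `l` at a point, with complex entries. -/
def Tetrad.lC (e : Tetrad) (x : Pt) (i : Fin 4) : ℂ := (e.l x i : ℂ)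

/-- The real vector `n` at a point, with complex entries. -/
def Tetrad.nC (e : Tetrad) (x : Pt) (i : Fin 4) : ℂ := (e.n x i : ℂ)

/-- The conjugate vector of `m`. -/
def Tetrad.mbar (e : Tetrad) (x : Pt) (i : Fin 4) : ℂ := conj (e.m x i)

/-- `g(u, v)`, extended complex bilinearly. -/
def metricC (g : MetricField) (x : Pt) (u v : Fin 4 → ℂ) : ℂ :=
  ∑ i, ∑ j, (g x i j : ℂ) * u i * v j

/-- `C_{abcd} u^a v^b w^c z^d`. -/
def weylC (g : MetricField) (x : Pt) (u v w z : Fin 4 → ℂ) : ℂ :=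
  ∑ a, ∑ b, ∑ c, ∑ d, (weyl g x a b c d : ℂ) * u a * v b * w c * z d

/-- `R_{ab} u^a v^b`. -/
def ricciC (g : MetricField) (x : Pt) (u v : Fin 4 → ℂ) : ℂ :=
  ∑ a, ∑ b, (ricci g x a b : ℂ) * u a * v b

/-- `ε_{abcd} u^a v^b w^c z^d`. -/
def volC (g : MetricField) (o : ℤˣ) (x : Pt) (u v w z : Fin 4 → ℂ) : ℂ :=
  ∑ a, ∑ b, ∑ c, ∑ d, (volForm g o x a b c d : ℂ) * u a * v b * w c * z d

/-- Covariant derivative `V_{a;b}` of the covector field `V_a = g_{ac} V^c`. -/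
def covDVec (g : MetricField) (V : Pt → Fin 4 → ℝ) (x : Pt) (a b : Fin 4) : ℝ :=
  pd b (fun y => ∑ c, g y a c * V y c) x
    - ∑ f, christoffel g f b a x * ∑ c, g x f c * V x c

/-- `V_{a;b} u^a v^b`. -/
def covDVecC (g : MetricField) (V : Pt → Fin 4 → ℝ) (x : Pt) (u v : Fin 4 → ℂ) : ℂ :=
  ∑ a, ∑ b, (covDVec g V x a b : ℂ) * u a * v b

def Psi0 (g : MetricField) (e : Tetrad) (x : Pt) : ℂ := weylC g x (e.lC x) (e.m x) (e.lC x) (e.m x)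

def Psi1 (g : MetricField) (e : Tetrad) (x : Pt) : ℂ := weylC g x (e.lC x) (e.nC x) (e.lC x) (e.m x)

def Psi2 (g : MetricField) (e : Tetrad) (x : Pt) : ℂ := weylC g x (e.lC x) (e.m x) (e.mbar x) (e.nC x)

def Psi3 (g : MetricField) (e : Tetrad) (x : Pt) : ℂ :=
  weylC g x (e.lC x) (e.nC x) (e.mbar x) (e.nC x)

def Psi4 (g : MetricField) (e : Tetrad) (x : Pt) : ℂ :=
  weylC g x (e.nC x) (e.mbar x) (e.nC x) (e.mbar x)

/-- `Φ₁₁ = ¼ R_{ab} (l^a n^b + m^a m̄^b)`; the trace of `R_{ab}` does not contribute. -/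
def Phi11 (g : MetricField) (e : Tetrad) (x : Pt) : ℂ :=
  (1 / 4) * (ricciC g x (e.lC x) (e.nC x) + ricciC g x (e.m x) (e.mbar x))

/-- `ρ = - l_{a;b} m^a m̄^b`. -/
def spinRho (g : MetricField) (e : Tetrad) (x : Pt) : ℂ := -covDVecC g e.l x (e.m x) (e.mbar x)

/-- `τ = - l_{a;b} m^a n^b`. -/
def spinTau (g : MetricField) (e : Tetrad) (x : Pt) : ℂ := -covDVecC g e.l x (e.m x) (e.nC x)

/-- `μ = n_{a;b} m̄^a m^b`. -/
def spinMu (g : MetricField) (e : Tetrad) (x : Pt) : ℂ := covDVecC g e.n x (e.mbar x) (e.m x)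

/-- `π = n_{a;b} m̄^a l^b`. -/
def spinPi (g : MetricField) (e : Tetrad) (x : Pt) : ℂ := covDVecC g e.n x (e.mbar x) (e.lC x)

/-- A smooth complex null tetrad on `U` for the metric `-2 l_{(a} n_{b)} + 2 m_{(a} m̄_{b)}`,
compatible with the orientation `o`. -/
structure IsNullTetradOn (g : MetricField) (o : ℤˣ) (e : Tetrad) (U : Set Pt) : Prop where
  smooth_l : ContDiffOn ℝ ∞ e.l U
  smooth_n : ContDiffOn ℝ ∞ e.n U
  smooth_m : ContDiffOn ℝ ∞ e.m U
  ll : ∀ x ∈ U, metricC g x (e.lC x) (e.lC x) = 0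
  nn : ∀ x ∈ U, metricC g x (e.nC x) (e.nC x) = 0
  ln : ∀ x ∈ U, metricC g x (e.lC x) (e.nC x) = -1
  lm : ∀ x ∈ U, metricC g x (e.lC x) (e.m x) = 0
  nm : ∀ x ∈ U, metricC g x (e.nC x) (e.m x) = 0
  mm : ∀ x ∈ U, metricC g x (e.m x) (e.m x) = 0
  mmbar : ∀ x ∈ U, metricC g x (e.m x) (e.mbar x) = 1
  oriented : ∀ x ∈ U, volC g o x (e.lC x) (e.nC x) (e.m x) (e.mbar x) = -Complex.I

/-- A null tetrad in which the Weyl tensor has the type D normal form: `Ψ₂` is its only component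
and does not vanish. -/
structure IsTypeDFrameOn (g : MetricField) (o : ℤˣ) (e : Tetrad) (U : Set Pt) : Prop where
  nullTetrad : IsNullTetradOn g o e U
  psi0 : ∀ x ∈ U, Psi0 g e x = 0
  psi1 : ∀ x ∈ U, Psi1 g e x = 0
  psi2 : ∀ x ∈ U, Psi2 g e x ≠ 0
  psi3 : ∀ x ∈ U, Psi3 g e x = 0
  psi4 : ∀ x ∈ U, Psi4 g e x = 0

/-- The canonical frame: boost and spin are fixed by `ρ = μ` and `τ = π`. -/
structure IsCanonicalFrameOn (g : MetricField) (o : ℤˣ) (e : Tetrad) (U : Set Pt) : Prop where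
  typeD : IsTypeDFrameOn g o e U
  rho_eq_mu : ∀ x ∈ U, spinRho g e x = spinMu g e x
  tau_eq_pi : ∀ x ∈ U, spinTau g e x = spinPi g e x

/-! ### The black hole metrics -/

/-- The function `P(p)` of the Kerr–NUT–(anti-)de Sitter metric. -/
def nutP (a l Λ p : ℝ) : ℝ := (a ^ 2 - (p - l) ^ 2) * (1 + (1 / 3) * (p - l) * (p + 3 * l) * Λ)

/-- The function `Q(q)` of the Kerr–NUT–(anti-)de Sitter metric. -/
def nutQ (a l m Λ q : ℝ) : ℝ :=
  a ^ 2 - l ^ 2 - 2 * m * q + q ^ 2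
    - (1 / 3) * (3 * l ^ 2 * (a ^ 2 - l ^ 2) + (a ^ 2 + 6 * l ^ 2) * q ^ 2 + q ^ 4) * Λ

/-- Kerr–NUT–(anti-)de Sitter metric in the coordinates `(t, r, p, q)`. -/
def nutMetric (a l m Λ : ℝ) : MetricField := fun x =>
  let p := x 2
  let q := x 3
  let P := nutP a l Λ p
  let Q := nutQ a l m Λ q
  let S := p ^ 2 + q ^ 2
  !![(P - Q) / S, (Q * p ^ 2 + P * q ^ 2) / S, 0, 0;
     (Q * p ^ 2 + P * q ^ 2) / S, (P * q ^ 4 - Q * p ^ 4) / S, 0, 0;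
     0, 0, S / P, 0;
     0, 0, 0, S / Q]

/-- The function `Q(r)` of the Kerr–Newman metric. -/
def knQ (M a q r : ℝ) : ℝ := r ^ 2 - 2 * M * r + q ^ 2 + a ^ 2

/-- Kerr–Newman metric of mass `M`, specific angular momentum `a` and charge `q` in
Boyer–Lindquist coordinates `(t, r, θ, φ)`. The Kerr metric is the case `q = 0`. -/
def knMetric (M a q : ℝ) : MetricField := fun x =>
  let r := x 1
  let s := Real.sin (x 2)
  let Q := knQ M a q r
  let R2 := r ^ 2 + a ^ 2 * Real.cos (x 2) ^ 2
  !![-(Q - a ^ 2 * s ^ 2) / R2, 0, 0, -(a * s ^ 2 * (r ^ 2 + a ^ 2 - Q)) / R2;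
     0, R2 / Q, 0, 0;
     0, 0, R2, 0;
     -(a * s ^ 2 * (r ^ 2 + a ^ 2 - Q)) / R2, 0, 0,
       ((r ^ 2 + a ^ 2) ^ 2 - Q * a ^ 2 * s ^ 2) * s ^ 2 / R2]

/-- The function `f(r)` of the Reissner–Nordström–(anti-)de Sitter metric. -/
def rnF (M q Λ r : ℝ) : ℝ := 1 - 2 * M / r + q ^ 2 / r ^ 2 - Λ * r ^ 2 / 3

/-- Reissner–Nordström–(anti-)de Sitter metric in the coordinates `(t, r, θ, φ)`. -/
def rnMetric (M q Λ : ℝ) : MetricField := fun x =>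
  let r := x 1
  Matrix.diagonal ![-rnF M q Λ r, 1 / rnF M q Λ r, r ^ 2, r ^ 2 * Real.sin (x 2) ^ 2]

/-- The four-dimensional black hole solutions, with their parameters. -/
inductive BlackHole where
  | kerrNUTAdS (a l m Λ : ℝ)
  | kerrNewman (M a q : ℝ)
  | reissnerNordstromAdS (M q Λ : ℝ)

/-- The metric, with signature `(-, +, +, +)`. -/
def BlackHole.metric : BlackHole → MetricField
  | kerrNUTAdS a l m Λ => nutMetric a l m Λ
  | kerrNewman M a q => knMetric M a q
  | reissnerNordstromAdS M q Λ => rnMetric M q Λ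

/-- The function whose zeros are the horizons. -/
def BlackHole.horizonFn : BlackHole → Pt → ℝ
  | kerrNUTAdS a l m Λ => fun x => nutQ a l m Λ (x 3)
  | kerrNewman M a q => fun x => knQ M a q (x 1)
  | reissnerNordstromAdS M q Λ => fun x => rnF M q Λ (x 1)

/-- Points at which the line element is defined and Lorentzian: off the curvature singularity, the
axis and the horizons, where the coordinates break down. -/
def BlackHole.domain : BlackHole → Set Pt
  | kerrNUTAdS a l m Λ =>
      {x | x 2 ^ 2 + x 3 ^ 2 ≠ 0 ∧ 0 < nutP a l Λ (x 2) ∧ nutQ a l m Λ (x 3) ≠ 0}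
  | kerrNewman M a q =>
      {x | x 1 ^ 2 + a ^ 2 * Real.cos (x 2) ^ 2 ≠ 0 ∧ Real.sin (x 2) ≠ 0 ∧ knQ M a q (x 1) ≠ 0}
  | reissnerNordstromAdS M q Λ =>
      {x | x 1 ≠ 0 ∧ Real.sin (x 2) ≠ 0 ∧ rnF M q Λ (x 1) ≠ 0}

/-- The electric charge. -/
def BlackHole.charge : BlackHole → ℝ
  | kerrNUTAdS _ _ _ _ => 0
  | kerrNewman _ _ q => q
  | reissnerNordstromAdS _ q _ => q

/-- The part of the domain on which the Weyl tensor does not vanish. -/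
def BlackHole.regular (B : BlackHole) : Set Pt := {x ∈ B.domain | weyl B.metric x ≠ 0}

end BlackHoleInvariants

end

open BlackHoleInvariants

open scoped ComplexConjugate ContDiff

noncomputable section

namespace BlackHoleInvariants

/-! All three families are real slices of one complex family, the Carter–Plebański metrics, given by
a function `P` of `x`, a function `Q` of `r` and a constant `c`. Replacing the real `c` by `j * c`
with `j = ± i` factors `S = r² + c² x²` as `ζ ζ'`, where `ζ = r + c x` and `ζ' = r - c x`. A
suitably scaled null coframe `(L, N, M, K)` and its connection forms then have rational
coefficients, without square roots. The sign of `j` is dictated by the orientation.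

The curvature is found by Cartan's method. Connection forms that are skew for the frame metric and
torsion-free represent the Levi-Civita connection (`coframe_christoffel`), so their curvature forms
give the Riemann tensor (`coframe_riemann`). For the Carter coframe (`hasTypeDCurvature`) the Weyl
tensor is `ψ` times the self-dual tensor `X₃ ⊗ X₃ - X₁ ⊗ X₂ - X₂ ⊗ X₁` plus `ψ'` times its
anti-self-dual analogue. On a real slice `ψ'` is the conjugate of `ψ`. The trace-free Ricci tensor
is governed by the single scalar `φ₁₁`.

The inner products of the bivectors give `I₁ + i I₂ = 48 ψ²`. The connection maps self-dual
bivectors to self-dual ones, and in the derivative of the Weyl tensor only `dψ`, `κ₁` and `ν₂`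
survive on the self-dual side. Since `κ₁ · ν₂ = τπ - ρμ`, this yields `I₃ + i I₄` (`I3_add_I4`).

To reach an arbitrary type D frame one uses the uniqueness of the principal null directions
(`principal_direction`, `aligned_of_principal`). Such a frame is the coframe's frame up to a boost,
a spin and the exchange of `L` with `N` and `M` with `K`, so `Ψ₂`, `Φ₁₁`, `ρμ` and `τπ` do not
depend on it (`typeDFrame_scalars`).

The derivatives of `ψ` in `r` and `x` are `-(3ψ + 2φ₁₁)/ζ'` and `c(3ψ - 2φ₁₁)/ζ'` (`jet_ψ`). With
`ρμ = Q/(2Sζ'²)` and, for the real `c`, `τπ = c²P/(2Sζ'²)`, this gives `∇Ψ₂.∇Ψ₂ = 2((3Ψ₂ + 2Φ₁₁)² ρμ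
- (3Ψ₂ - 2Φ₁₁)² τπ)`. The formulas for `I₅`, `I₆`, `I₇` and the `Qᵢ` follow by the chain rule and
algebra. In a canonical frame `ρμ = ρ²` and `τπ = τ²`, so `|ρ|² = Q/(2S²)`, `|τ|² = c²P/(2S²)`, and
`τ/ρ` is real. Existence is obtained by rescaling the frame with explicit square roots
(`frame_canonical`). -/

/-! ### Calculus of coordinate derivatives -/

section Calculus

/-- `f` has the partial derivatives `d i` at `x`. -/
def HasPd (f : Pt → ℂ) (x : Pt) (d : Fin 4 → ℂ) : Prop :=
  ∀ i, HasDerivAt (fun s => f (Function.update x i s)) (d i) (x i)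

variable {f h : Pt → ℂ} {x : Pt} {d d' : Fin 4 → ℂ}

theorem HasPd.pd (hf : HasPd f x d) (i : Fin 4) : pd i f x = d i := (hf i).deriv

theorem HasPd.congr_deriv (hf : HasPd f x d) (hd : ∀ i, d i = d' i) : HasPd f x d' :=
  fun i => hd i ▸ hf i

theorem hasPd_const (z : ℂ) : HasPd (fun _ => z) x (fun _ => 0) := fun _ => hasDerivAt_const _ _

theorem HasPd.add (hf : HasPd f x d) (hh : HasPd h x d') :
    HasPd (fun y => f y + h y) x (fun i => d i + d' i) := fun i => (hf i).add (hh i)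

theorem HasPd.sub (hf : HasPd f x d) (hh : HasPd h x d') :
    HasPd (fun y => f y - h y) x (fun i => d i - d' i) := fun i => (hf i).sub (hh i)

theorem HasPd.neg (hf : HasPd f x d) : HasPd (fun y => -f y) x (fun i => -d i) :=
  fun i => (hf i).neg

theorem HasPd.mul (hf : HasPd f x d) (hh : HasPd h x d') :
    HasPd (fun y => f y * h y) x (fun i => d i * h x + f x * d' i) := fun i => by
  simpa using (hf i).fun_mul (hh i)

theorem HasPd.const_mul (z : ℂ) (hf : HasPd f x d) :
    HasPd (fun y => z * f y) x (fun i => z * d i) := fun i => (hf i).const_mul z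

theorem HasPd.inv (hf : HasPd f x d) (h0 : f x ≠ 0) :
    HasPd (fun y => (f y)⁻¹) x (fun i => -d i / f x ^ 2) := fun i => by
  simpa using (hf i).fun_inv (by simpa using h0)

theorem HasPd.sum {ι : Type*} {s : Finset ι} {f : ι → Pt → ℂ} {d : ι → Fin 4 → ℂ}
    (hf : ∀ k ∈ s, HasPd (f k) x (d k)) :
    HasPd (fun y => ∑ k ∈ s, f k y) x (fun i => ∑ k ∈ s, d k i) := fun i =>
  HasDerivAt.fun_sum fun k hk => hf k hk i

theorem HasPd.conj (hf : HasPd f x d) : HasPd (fun y => conj (f y)) x (fun i => conj (d i)) :=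
  fun i => (hf i).star

/-- A coordinate line through `x` stays in `V` for a short time, so partial derivatives may be
computed from identities valid only on an open set. -/
theorem update_eventually_mem {V : Set Pt} (hV : IsOpen V) (hx : x ∈ V) (i : Fin 4) :
    ∀ᶠ s in nhds (x i), Function.update x i s ∈ V := by
  have h1 : Filter.Tendsto (fun s => Function.update x i s) (nhds (x i)) (nhds x) := by
    have := ((hasDerivAt_update x i (x i)).continuousAt).tendsto
    simpa using this
  exact h1 (hV.mem_nhds hx)

theorem HasPd.congr {V : Set Pt} (hV : IsOpen V) (hx : x ∈ V) (hfh : ∀ y ∈ V, h y = f y)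
    (hf : HasPd f x d) : HasPd h x d := fun i =>
  (hf i).congr_of_eventuallyEq ((update_eventually_mem hV hx i).mono fun _ hs => hfh _ hs)

theorem pd_congr {F : Type*} [NormedAddCommGroup F] [NormedSpace ℝ F] {f h : Pt → F}
    {V : Set Pt} (hV : IsOpen V) (hx : x ∈ V) (hfh : ∀ y ∈ V, f y = h y)
    (i : Fin 4) : pd i f x = pd i h x :=
  Filter.EventuallyEq.deriv_eq ((update_eventually_mem hV hx i).mono fun _ hs => hfh _ hs)

theorem hasDerivAt_update_of_hasFDerivAt {F : Type*} [NormedAddCommGroup F] [NormedSpace ℝ F] {f : Pt → F}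
    {f' : Pt →L[ℝ] F} (hf : HasFDerivAt f f' x) (i : Fin 4) :
    HasDerivAt (fun s => f (Function.update x i s)) (f' (Pi.single i 1)) (x i) := by
  have h1 := hasDerivAt_update x i (x i)
  have hf' : HasFDerivAt f f' (Function.update x i (x i)) := by simpa using hf
  exact hf'.comp_hasDerivAt (x i) h1

theorem hasPd_of_differentiableAt (hf : DifferentiableAt ℝ f x) : HasPd f x (fun i => pd i f x) := by
  intro i
  have h := hasDerivAt_update_of_hasFDerivAt hf.hasFDerivAt i
  exact h.differentiableAt.hasDerivAt

theorem hasPd_of_contDiffOn {V : Set Pt} (hV : IsOpen V) (hf : ContDiffOn ℝ ∞ f V) (hx : x ∈ V) :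
    HasPd f x (fun i => pd i f x) :=
  hasPd_of_differentiableAt ((hf.contDiffAt (hV.mem_nhds hx)).differentiableAt (by simp))

theorem pd_eq_fderiv {F : Type*} [NormedAddCommGroup F] [NormedSpace ℝ F] {f : Pt → F}
    {V : Set Pt} (hV : IsOpen V) (hf : ContDiffOn ℝ ∞ f V) (i : Fin 4) :
    ∀ y ∈ V, pd i f y = fderiv ℝ f y (Pi.single i 1) := fun y hy =>
  (hasDerivAt_update_of_hasFDerivAt ((hf.contDiffAt (hV.mem_nhds hy)).differentiableAt
    (by simp)).hasFDerivAt i).deriv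

theorem contDiffOn_pd {F : Type*} [NormedAddCommGroup F] [NormedSpace ℝ F] {f : Pt → F}
    {V : Set Pt} (hV : IsOpen V) (hf : ContDiffOn ℝ ∞ f V) (i : Fin 4) :
    ContDiffOn ℝ ∞ (pd i f) V := by
  have h1 : ContDiffOn ℝ ∞ (fun y => fderiv ℝ f y (Pi.single i 1)) V :=
    (hf.fderiv_of_isOpen hV (by simp)).clm_apply contDiffOn_const
  exact h1.congr (pd_eq_fderiv hV hf i)

/-- Both mixed partials are values of the second Fréchet derivative, which is symmetric. -/
theorem pd_pd_comm {V : Set Pt} (hV : IsOpen V) (hf : ContDiffOn ℝ ∞ f V) (hx : x ∈ V)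
    (i k : Fin 4) : pd i (pd k f) x = pd k (pd i f) x := by
  have key : ∀ i k : Fin 4, pd i (pd k f) x =
      fderiv ℝ (fderiv ℝ f) x (Pi.single i 1) (Pi.single k 1) := fun i k => by
    have h1 : DifferentiableAt ℝ (fderiv ℝ f) x :=
      ((hf.fderiv_of_isOpen hV (m := ∞) (by simp)).contDiffAt (hV.mem_nhds hx)).differentiableAt
        (by simp)
    rw [pd_congr hV hx (pd_eq_fderiv hV hf k) i]
    have h2 := h1.hasFDerivAt.clm_apply (hasFDerivAt_const (Pi.single k (1 : ℝ) : Pt) x)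
    rw [show pd i (fun y => fderiv ℝ f y (Pi.single k 1)) x = _ from
      (hasDerivAt_update_of_hasFDerivAt h2 i).deriv]
    simp
  rw [key, key]
  exact (hf.contDiffAt (hV.mem_nhds hx)).isSymmSndFDerivAt (by simpa using ENat.LEInfty.out) _ _

theorem pd_ofReal (f : Pt → ℝ) (i : Fin 4) : pd i (fun y => (f y : ℂ)) x = ((pd i f x : ℝ) : ℂ) := by
  unfold pd
  -- If `f` is not differentiable along the line, neither is its complexification (take real parts),
  -- and both derivatives have the default value zero.
  by_cases h : DifferentiableAt ℝ (fun s => f (Function.update x i s)) (x i)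
  · exact h.hasDerivAt.ofReal_comp.deriv
  · rw [deriv_zero_of_not_differentiableAt h, deriv_zero_of_not_differentiableAt]
    · simp
    · intro h'
      apply h
      exact Complex.reCLM.differentiableAt.comp (x i) h'

/-- All computations are made over `ℂ`; this returns the derivatives of real quantities to the real
definitions of the statement. -/
theorem hasPd_ofReal_of_pd {f : Pt → ℝ} (hf : HasPd (fun y => (f y : ℂ)) x d) (i : Fin 4) :
    ((pd i f x : ℝ) : ℂ) = d i := by
  rw [← pd_ofReal, hf.pd]

end Calculus

/-! ### Complex null coframes and their Levi-Civita connection -/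

/-- The frame metric of a null coframe `(L, N, M, K)`: `L · N = -1`, `M · K = 1`. -/
def eta : Matrix (Fin 4) (Fin 4) ℂ := !![0, -1, 0, 0; -1, 0, 0, 0; 0, 0, 0, 1; 0, 0, 1, 0]

theorem eta_mul_eta : eta * eta = 1 := by
  ext i j
  fin_cases i <;> fin_cases j <;> simp [eta, Matrix.mul_apply, Fin.sum_univ_four]

theorem eta_transpose : eta.transpose = eta := by
  ext i j
  fin_cases i <;> fin_cases j <;> simp [eta]

theorem det_eta : eta.det = 1 := by
  simp [eta, Matrix.det_succ_row_zero, Fin.sum_univ_succ, Fin.succAbove]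

/-- A coframe `θ`, the dual frame `E` and six connection one-forms. -/
structure CoframeData where
  θ : Fin 4 → Pt → Fin 4 → ℂ
  E : Fin 4 → Pt → Fin 4 → ℂ
  κ₁ : Pt → Fin 4 → ℂ
  κ₂ : Pt → Fin 4 → ℂ
  ν₁ : Pt → Fin 4 → ℂ
  ν₂ : Pt → Fin 4 → ℂ
  a : Pt → Fin 4 → ℂ
  b : Pt → Fin 4 → ℂ

namespace CoframeData

variable (c : CoframeData)

/-- The matrix of the coframe. -/
def Θ (x : Pt) : Matrix (Fin 4) (Fin 4) ℂ := Matrix.of fun α i => c.θ α x i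

/-- The matrix of the frame. -/
def F (x : Pt) : Matrix (Fin 4) (Fin 4) ℂ := Matrix.of fun i α => c.E α x i

/-- The connection matrix `(ω_i)^α_β`. -/
def conn (i : Fin 4) (x : Pt) : Matrix (Fin 4) (Fin 4) ℂ :=
  !![c.a x i, 0, -c.ν₁ x i, -c.ν₂ x i;
     0, -c.a x i, -c.κ₁ x i, -c.κ₂ x i;
     -c.κ₂ x i, -c.ν₂ x i, -c.b x i, 0;
     -c.κ₁ x i, -c.ν₁ x i, 0, c.b x i]

/-- The coordinate derivatives of the coframe. -/
def dΘ (i : Fin 4) (x : Pt) : Matrix (Fin 4) (Fin 4) ℂ :=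
  Matrix.of fun α k => pd i (fun y => c.θ α y k) x

/-- The six one-forms parametrize the Lie algebra of the frame metric; this is metric compatibility
of the connection. -/
theorem eta_conn_antisymm (i : Fin 4) (x : Pt) :
    eta * c.conn i x + (c.conn i x).transpose * eta = 0 := by
  ext p q
  fin_cases p <;> fin_cases q <;>
    simp [eta, conn, Matrix.mul_apply, Fin.sum_univ_four, Matrix.transpose_apply]

end CoframeData

/-- The matrix of Christoffel symbols `(Γ_j)^i_k`. -/
def christoffelM (g : MetricField) (j : Fin 4) (x : Pt) : Matrix (Fin 4) (Fin 4) ℂ :=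
  Matrix.of fun i k => (christoffel g i j k x : ℂ)

/-- The metric with complex entries. -/
def metricM (g : MetricField) (x : Pt) : Matrix (Fin 4) (Fin 4) ℂ := (g x).map Complex.ofReal

/-- The inverse metric with complex entries. -/
def invM (g : MetricField) (x : Pt) : Matrix (Fin 4) (Fin 4) ℂ := ((g x)⁻¹).map Complex.ofReal

/-- `c` is a smooth null coframe for `g` on `V`, with its torsion-free connection. -/
structure IsNullCoframe (g : MetricField) (V : Set Pt) (c : CoframeData) : Prop where
  isOpen : IsOpen V
  smooth_θ : ∀ α i, ContDiffOn ℝ ∞ (fun x => c.θ α x i) V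
  smooth_E : ∀ α i, ContDiffOn ℝ ∞ (fun x => c.E α x i) V
  smooth_κ₁ : ∀ i, ContDiffOn ℝ ∞ (fun x => c.κ₁ x i) V
  smooth_κ₂ : ∀ i, ContDiffOn ℝ ∞ (fun x => c.κ₂ x i) V
  smooth_ν₁ : ∀ i, ContDiffOn ℝ ∞ (fun x => c.ν₁ x i) V
  smooth_ν₂ : ∀ i, ContDiffOn ℝ ∞ (fun x => c.ν₂ x i) V
  smooth_a : ∀ i, ContDiffOn ℝ ∞ (fun x => c.a x i) V
  smooth_b : ∀ i, ContDiffOn ℝ ∞ (fun x => c.b x i) V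
  dual : ∀ x ∈ V, c.Θ x * c.F x = 1
  metric : ∀ x ∈ V, metricM g x = (c.Θ x).transpose * eta * c.Θ x
  torsion : ∀ x ∈ V, ∀ α i k, (c.dΘ i x + c.conn i x * c.Θ x) α k = (c.dΘ k x + c.conn k x * c.Θ x) α i

namespace IsNullCoframe

variable {g : MetricField} {V : Set Pt} {c : CoframeData} (h : IsNullCoframe g V c) {x : Pt}
include h

theorem dual' (hx : x ∈ V) : c.F x * c.Θ x = 1 := mul_eq_one_comm.mp (h.dual x hx)

theorem det_Θ_ne_zero (hx : x ∈ V) : (c.Θ x).det ≠ 0 := by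
  intro h0
  have := congrArg Matrix.det (h.dual x hx)
  rw [Matrix.det_mul, h0, zero_mul, Matrix.det_one] at this
  exact zero_ne_one this

/-- It makes `g` invertible, and later it expresses the volume form through the coframe. -/
theorem det_metric (hx : x ∈ V) : ((g x).det : ℂ) = (c.Θ x).det ^ 2 := by
  have h1 := congrArg Matrix.det (h.metric x hx)
  rw [Matrix.det_mul, Matrix.det_mul, Matrix.det_transpose, det_eta] at h1
  have h2 : (metricM g x).det = ((g x).det : ℂ) := by
    rw [metricM, show (g x).map Complex.ofReal = Complex.ofRealHom.mapMatrix (g x) from rfl,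
      ← RingHom.map_det]
    rfl
  rw [← h2, h1]
  ring

theorem metric_mul_inv (hx : x ∈ V) : metricM g x * invM g x = 1 := by
  have h0 : (g x).det ≠ 0 := by
    intro h0
    have := h.det_metric hx
    rw [h0] at this
    exact pow_ne_zero 2 (h.det_Θ_ne_zero hx) (by simpa using this.symm)
  have h1 : g x * (g x)⁻¹ = 1 := Matrix.mul_nonsing_inv _ (isUnit_iff_ne_zero.mpr h0)
  have h2 := congrArg Complex.ofRealHom.mapMatrix h1
  rw [map_mul, map_one] at h2
  exact h2

theorem inv_eq (hx : x ∈ V) : invM g x = c.F x * eta * (c.F x).transpose := by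
  have h1 := h.metric_mul_inv hx
  have h2 : metricM g x * (c.F x * eta * (c.F x).transpose) = 1 := by
    rw [h.metric x hx]
    have h3 : (c.Θ x).transpose * (c.F x).transpose = 1 := by
      rw [← Matrix.transpose_mul, h.dual' hx, Matrix.transpose_one]
    calc (c.Θ x).transpose * eta * c.Θ x * (c.F x * eta * (c.F x).transpose)
        = (c.Θ x).transpose * eta * (c.Θ x * c.F x) * eta * (c.F x).transpose := by
          simp only [Matrix.mul_assoc]
      _ = (c.Θ x).transpose * (eta * eta) * (c.F x).transpose := by
          rw [h.dual x hx, Matrix.mul_one, Matrix.mul_assoc (c.Θ x).transpose eta eta]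
      _ = 1 := by rw [eta_mul_eta, Matrix.mul_one, h3]
  have h4 : invM g x * metricM g x = 1 := mul_eq_one_comm.mp h1
  calc invM g x = invM g x * (metricM g x * (c.F x * eta * (c.F x).transpose)) := by
        rw [h2, Matrix.mul_one]
    _ = _ := by rw [← Matrix.mul_assoc, h4, Matrix.one_mul]

theorem coframe_inv (hx : x ∈ V) : c.Θ x * invM g x * (c.Θ x).transpose = eta := by
  rw [h.inv_eq hx]
  have h3 : (c.F x).transpose * (c.Θ x).transpose = 1 := by
    rw [← Matrix.transpose_mul, h.dual x hx, Matrix.transpose_one]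
  calc c.Θ x * (c.F x * eta * (c.F x).transpose) * (c.Θ x).transpose
      = (c.Θ x * c.F x) * eta * ((c.F x).transpose * (c.Θ x).transpose) := by
        simp only [Matrix.mul_assoc]
    _ = eta := by rw [h.dual x hx, h3, Matrix.one_mul, Matrix.mul_one]

theorem hasPd_θ (hx : x ∈ V) (α k : Fin 4) :
    HasPd (fun y => c.θ α y k) x (fun i => c.dΘ i x α k) :=
  hasPd_of_contDiffOn h.isOpen (h.smooth_θ α k) hx

theorem metric_apply (hx : x ∈ V) (l k : Fin 4) :
    (g x l k : ℂ) = ∑ p, ∑ q, c.θ p x l * eta p q * c.θ q x k := by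
  have := congrFun (congrFun (h.metric x hx) l) k
  rw [show metricM g x l k = (g x l k : ℂ) from rfl] at this
  rw [this, Matrix.mul_apply]
  simp only [Matrix.mul_apply, Finset.sum_mul]
  rw [Finset.sum_comm]
  rfl

theorem pd_metric (hx : x ∈ V) (j l k : Fin 4) :
    ((pd j (fun y => g y l k) x : ℝ) : ℂ) =
      ((c.dΘ j x).transpose * eta * c.Θ x + (c.Θ x).transpose * eta * c.dΘ j x) l k := by
  have h1 : HasPd (fun y => (g y l k : ℂ)) x _ := HasPd.congr h.isOpen hx
    (fun y hy => h.metric_apply hy l k)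
    (HasPd.sum fun p _ => HasPd.sum fun q _ =>
      ((h.hasPd_θ hx p l).mul (hasPd_const (eta p q))).mul (h.hasPd_θ hx q k))
  rw [hasPd_ofReal_of_pd h1 j, Matrix.add_apply]
  simp only [Matrix.mul_apply, Fin.sum_univ_four, Matrix.transpose_apply, CoframeData.Θ,
    Matrix.of_apply]
  ring

/-- Skewness of the connection allows `conn j * Θ` to be added to `∂_j Θ`: the extra terms cancel on
symmetrization. The torsion condition then applies to the sum. -/
theorem pd_metric_eq (hx : x ∈ V) (j l k : Fin 4) :
    ((pd j (fun y => g y l k) x : ℝ) : ℂ) =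
      ((c.Θ x).transpose * eta * (c.dΘ j x + c.conn j x * c.Θ x)) l k +
      ((c.Θ x).transpose * eta * (c.dΘ j x + c.conn j x * c.Θ x)) k l := by
  rw [h.pd_metric hx]
  have h1 : (c.dΘ j x).transpose * eta * c.Θ x + (c.Θ x).transpose * eta * c.dΘ j x =
      (c.Θ x).transpose * eta * (c.dΘ j x + c.conn j x * c.Θ x) +
      ((c.Θ x).transpose * eta * (c.dΘ j x + c.conn j x * c.Θ x)).transpose := by
    simp only [Matrix.transpose_mul, Matrix.transpose_add, Matrix.transpose_transpose,
      eta_transpose]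
    have h2 := c.eta_conn_antisymm j x
    have h3 : (c.Θ x).transpose * (eta * c.conn j x + (c.conn j x).transpose * eta) * c.Θ x = 0 := by
      rw [h2, Matrix.mul_zero, Matrix.zero_mul]
    simp only [Matrix.mul_add, Matrix.add_mul, ← Matrix.mul_assoc] at h3 ⊢
    rw [← sub_eq_zero, ← neg_eq_zero, ← h3]
    abel
  rw [h1, Matrix.add_apply, Matrix.transpose_apply]

theorem lowered_symm (hx : x ∈ V) (j l k : Fin 4) :
    ((c.Θ x).transpose * eta * (c.dΘ j x + c.conn j x * c.Θ x)) l k =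
      ((c.Θ x).transpose * eta * (c.dΘ k x + c.conn k x * c.Θ x)) l j := by
  rw [Matrix.mul_apply, Matrix.mul_apply]
  exact Finset.sum_congr rfl fun p _ => by rw [h.torsion x hx]

/-- Koszul's argument. Let `B_j(l,k)` be the lowered tensor on the right. It is symmetric in `j, k`
by absence of torsion, and `∂_j g_{lk} = B_j(l,k) + B_j(k,l)`, so the combination defining the
Christoffel symbol collapses to `2 B_j(l,k)`. -/
theorem christoffelM_eq (hx : x ∈ V) (j : Fin 4) :
    christoffelM g j x =
      invM g x * ((c.Θ x).transpose * eta * (c.dΘ j x + c.conn j x * c.Θ x)) := by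
  ext i k
  rw [Matrix.mul_apply]
  simp only [christoffelM, Matrix.of_apply, christoffel]
  push_cast
  rw [Finset.mul_sum]
  refine Finset.sum_congr rfl fun l _ => ?_
  rw [h.pd_metric_eq hx, h.pd_metric_eq hx, h.pd_metric_eq hx, h.lowered_symm hx l j k,
    h.lowered_symm hx l k j, h.lowered_symm hx k l j, h.lowered_symm hx k j l, invM,
    Matrix.map_apply, h.lowered_symm hx l j k, h.lowered_symm hx j k l]
  ring

/-- The covariant derivative of the coframe, in matrix form. -/
theorem coframe_christoffel (hx : x ∈ V) (j : Fin 4) :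
    c.Θ x * christoffelM g j x = c.dΘ j x + c.conn j x * c.Θ x := by
  rw [h.christoffelM_eq hx]
  calc _ = (c.Θ x * invM g x * (c.Θ x).transpose) * eta * (c.dΘ j x + c.conn j x * c.Θ x) := by
        simp only [Matrix.mul_assoc]
    _ = _ := by rw [h.coframe_inv hx, eta_mul_eta, Matrix.one_mul]

theorem christoffelM_eq_frame (hx : x ∈ V) (j : Fin 4) :
    christoffelM g j x = c.F x * (c.dΘ j x + c.conn j x * c.Θ x) := by
  rw [← h.coframe_christoffel hx, ← Matrix.mul_assoc, h.dual' hx, Matrix.one_mul]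

theorem smooth_conn (j α β : Fin 4) : ContDiffOn ℝ ∞ (fun x => c.conn j x α β) V := by
  have h1 := h.smooth_κ₁ j
  have h2 := h.smooth_κ₂ j
  have h3 := h.smooth_ν₁ j
  have h4 := h.smooth_ν₂ j
  have h5 := h.smooth_a j
  have h6 := h.smooth_b j
  fin_cases α <;> fin_cases β <;> simp [CoframeData.conn] <;> first | assumption | fun_prop

/-- The frame expression is visibly smooth, so the Christoffel symbols can be differentiated in the
curvature without being computed in coordinates. -/
theorem smooth_christoffel (i j k : Fin 4) :
    ContDiffOn ℝ ∞ (fun y => (christoffel g i j k y : ℂ)) V := by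
  have h1 : ∀ y ∈ V, (christoffel g i j k y : ℂ) =
      ∑ α, c.E α y i * (pd j (fun z => c.θ α z k) y + ∑ β, c.conn j y α β * c.θ β y k) := by
    intro y hy
    have := congrFun (congrFun (h.christoffelM_eq_frame hy j) i) k
    rw [Matrix.mul_apply] at this
    simp only [Matrix.add_apply, Matrix.mul_apply] at this
    exact this
  refine ContDiffOn.congr ?_ h1
  exact ContDiffOn.sum fun α _ => (h.smooth_E α i).mul
    ((contDiffOn_pd h.isOpen (h.smooth_θ α k) j).add
      (ContDiffOn.sum fun β _ => (h.smooth_conn j α β).mul (h.smooth_θ β k)))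

/-- The coordinate derivatives of the connection matrices. -/
theorem hasPd_conn (hx : x ∈ V) (j α β : Fin 4) :
    HasPd (fun y => c.conn j y α β) x (fun i => pd i (fun y => c.conn j y α β) x) :=
  hasPd_of_contDiffOn h.isOpen (h.smooth_conn j α β) hx

theorem hasPd_christoffel (hx : x ∈ V) (i j k : Fin 4) :
    HasPd (fun y => (christoffel g i j k y : ℂ)) x
      (fun l => ((pd l (christoffel g i j k) x : ℝ) : ℂ)) := by
  have := hasPd_of_contDiffOn h.isOpen (h.smooth_christoffel i j k) hx
  exact this.congr_deriv fun l => pd_ofReal _ _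

/-- The derivative of `coframe_christoffel` in the direction `k`; its skew part in `k, l` becomes
the second structure equation. -/
theorem pd_coframe_christoffel (hx : x ∈ V) (k l α j : Fin 4) :
    ∑ m, (c.dΘ k x α m * christoffelM g l x m j +
        c.θ α x m * ((pd k (christoffel g m l j) x : ℝ) : ℂ)) =
      pd k (pd l (fun y => c.θ α y j)) x +
      ∑ β, (pd k (fun y => c.conn l y α β) x * c.θ β x j + c.conn l x α β * c.dΘ k x β j) := by
  have h1 : HasPd (fun y => ∑ m, c.θ α y m * (christoffel g m l j y : ℂ)) x _ :=
    HasPd.sum fun m _ => (h.hasPd_θ hx α m).mul (h.hasPd_christoffel hx m l j)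
  have h2 : HasPd (fun y => pd l (fun z => c.θ α z j) y + ∑ β, c.conn l y α β * c.θ β y j) x _ :=
    (hasPd_of_contDiffOn h.isOpen (contDiffOn_pd h.isOpen (h.smooth_θ α j) l) hx).add
      (HasPd.sum fun β _ => (h.hasPd_conn hx l α β).mul (h.hasPd_θ hx β j))
  have h3 := (h1.congr h.isOpen hx (h := fun y => pd l (fun z => c.θ α z j) y +
    ∑ β, c.conn l y α β * c.θ β y j) fun y hy => ?_).pd k
  · rw [h2.pd k] at h3
    exact h3.symm
  · have := congrFun (congrFun (h.coframe_christoffel hy l) α) j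
    rw [Matrix.mul_apply, Matrix.add_apply, Matrix.mul_apply] at this
    exact this.symm

end IsNullCoframe

/-! ### Curvature two-forms and the second structure equation. -/

namespace CoframeData

/-- The derivative part of the curvature two-forms. -/
def dConn (c : CoframeData) (k l : Fin 4) (x : Pt) : Matrix (Fin 4) (Fin 4) ℂ :=
  Matrix.of fun α β => pd k (fun y => c.conn l y α β) x

/-- The matrix of curvature two-forms `(Ω_{kl})^α_β`. -/
def curv (c : CoframeData) (k l : Fin 4) (x : Pt) : Matrix (Fin 4) (Fin 4) ℂ :=
  c.dConn k l x - c.dConn l k x + c.conn k x * c.conn l x - c.conn l x * c.conn k x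

end CoframeData

/-- The curvature `R^i_{jkl}` as a matrix in `i, j`. -/
def riemannM (g : MetricField) (k l : Fin 4) (x : Pt) : Matrix (Fin 4) (Fin 4) ℂ :=
  Matrix.of fun i j => (riemannUp g i j k l x : ℂ)

namespace IsNullCoframe

variable {g : MetricField} {V : Set Pt} {c : CoframeData} (h : IsNullCoframe g V c) {x : Pt}
include h

/-- The second structure equation. -/
theorem coframe_riemann (hx : x ∈ V) (k l : Fin 4) :
    c.Θ x * riemannM g k l x = c.curv k l x * c.Θ x := by
  set dG : Fin 4 → Fin 4 → Matrix (Fin 4) (Fin 4) ℂ := fun k l =>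
    Matrix.of fun i j => ((pd k (christoffel g i l j) x : ℝ) : ℂ) with hdG
  set ddT : Fin 4 → Fin 4 → Matrix (Fin 4) (Fin 4) ℂ := fun k l =>
    Matrix.of fun α j => pd k (pd l (fun y => c.θ α y j)) x with hddT
  have hR : riemannM g k l x = dG k l - dG l k + christoffelM g k x * christoffelM g l x
      - christoffelM g l x * christoffelM g k x := by
    ext i j
    simp only [riemannM, riemannUp, hdG, Matrix.of_apply, Matrix.add_apply, Matrix.sub_apply,
      Matrix.mul_apply, christoffelM]
    push_cast
    rw [Finset.sum_sub_distrib]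
    ring
  have hD : ∀ k l, c.dΘ k x * christoffelM g l x + c.Θ x * dG k l =
      ddT k l + c.dConn k l x * c.Θ x + c.conn l x * c.dΘ k x := by
    intro k l
    ext α j
    have := h.pd_coframe_christoffel hx k l α j
    rw [Finset.sum_add_distrib, Finset.sum_add_distrib] at this
    simp only [Matrix.add_apply, Matrix.mul_apply]
    rw [add_assoc]
    exact this
  -- The second derivatives of the coframe drop out on antisymmetrization.
  have hS : ddT k l = ddT l k := by
    ext α j
    exact pd_pd_comm h.isOpen (h.smooth_θ α j) hx k l
  have hk := h.coframe_christoffel hx k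
  have hl := h.coframe_christoffel hx l
  have e1 := hD k l
  have e2 := hD l k
  rw [hS] at e1
  -- Eliminating the first derivatives of the coframe leaves products of `Θ` with connection and
  -- Christoffel matrices, in which the mixed terms cancel.
  have dk : c.dΘ k x = c.Θ x * christoffelM g k x - c.conn k x * c.Θ x := by rw [hk]; abel
  have dl : c.dΘ l x = c.Θ x * christoffelM g l x - c.conn l x * c.Θ x := by rw [hl]; abel
  rw [dk] at e1
  rw [dl] at e2
  have e3 : c.Θ x * dG k l - c.Θ x * dG l k =
      c.dConn k l x * c.Θ x - c.dConn l k x * c.Θ x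
      + c.conn l x * (c.Θ x * christoffelM g k x - c.conn k x * c.Θ x)
      - c.conn k x * (c.Θ x * christoffelM g l x - c.conn l x * c.Θ x)
      - (c.Θ x * christoffelM g k x - c.conn k x * c.Θ x) * christoffelM g l x
      + (c.Θ x * christoffelM g l x - c.conn l x * c.Θ x) * christoffelM g k x := by
    rw [eq_sub_of_add_eq' e1, eq_sub_of_add_eq' e2]
    abel
  rw [hR, CoframeData.curv, Matrix.mul_sub, Matrix.mul_add, Matrix.mul_sub, e3]
  noncomm_ring

end IsNullCoframe

/-! ### Contractions of complex tensors at a point -/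

section Contractions

/-- Complex covariant tensors of rank two at a point. -/
abbrev T2 := Fin 4 → Fin 4 → ℂ

/-- Complex covariant tensors of rank four at a point. -/
abbrev T4 := Fin 4 → Fin 4 → Fin 4 → Fin 4 → ℂ

/-- The bilinear form `G^{ij} u_i v_j` on covectors. -/
def dot (G : Matrix (Fin 4) (Fin 4) ℂ) : (Fin 4 → ℂ) →ₗ[ℂ] (Fin 4 → ℂ) →ₗ[ℂ] ℂ :=
  LinearMap.mk₂ ℂ (fun u v => ∑ i, ∑ j, G i j * u i * v j)
    (fun _ _ _ => by simp only [Pi.add_apply, mul_add, add_mul, Finset.sum_add_distrib])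
    (fun _ _ _ => by
      simp only [Pi.smul_apply, smul_eq_mul, Finset.mul_sum]
      exact Finset.sum_congr rfl fun _ _ => Finset.sum_congr rfl fun _ _ => by ring)
    (fun _ _ _ => by simp only [Pi.add_apply, mul_add, Finset.sum_add_distrib])
    (fun _ _ _ => by
      simp only [Pi.smul_apply, smul_eq_mul, Finset.mul_sum]
      exact Finset.sum_congr rfl fun _ _ => Finset.sum_congr rfl fun _ _ => by ring)

theorem dot_apply (G : Matrix (Fin 4) (Fin 4) ℂ) (u v : Fin 4 → ℂ) :
    dot G u v = ∑ i, ∑ j, G i j * u i * v j := rfl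

/-- `u ∧ v`. -/
def wedge (u v : Fin 4 → ℂ) : T2 := fun a b => u a * v b - v a * u b

/-- `X ⊗ Y`. -/
def tens (X Y : T2) : T4 := fun a b c d => X a b * Y c d

/-- The contraction `G^{aa'} G^{bb'} X_{a'b'} Y_{ab}`. -/
def pair2 (G : Matrix (Fin 4) (Fin 4) ℂ) : T2 →ₗ[ℂ] T2 →ₗ[ℂ] ℂ :=
  LinearMap.mk₂ ℂ (fun X Y => ∑ a, ∑ b, (∑ a', ∑ b', G a a' * G b b' * X a' b') * Y a b)
    (fun _ _ _ => by simp only [Pi.add_apply, mul_add, add_mul, Finset.sum_add_distrib])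
    (fun k X Y => by
      simp only [Pi.smul_apply, smul_eq_mul, Finset.mul_sum, Finset.sum_mul]
      exact Finset.sum_congr rfl fun _ _ => Finset.sum_congr rfl fun _ _ =>
        Finset.sum_congr rfl fun _ _ => Finset.sum_congr rfl fun _ _ => by ring)
    (fun _ _ _ => by simp only [Pi.add_apply, mul_add, Finset.sum_add_distrib])
    (fun k X Y => by
      simp only [Pi.smul_apply, smul_eq_mul, Finset.mul_sum]
      exact Finset.sum_congr rfl fun _ _ => Finset.sum_congr rfl fun _ _ => by ring)

theorem pair2_apply (G : Matrix (Fin 4) (Fin 4) ℂ) (X Y : T2) :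
    pair2 G X Y = ∑ a, ∑ b, (∑ a', ∑ b', G a a' * G b b' * X a' b') * Y a b := rfl

/-- The contraction of tensors of rank four. -/
def pair4 (G : Matrix (Fin 4) (Fin 4) ℂ) : T4 →ₗ[ℂ] T4 →ₗ[ℂ] ℂ :=
  LinearMap.mk₂ ℂ (fun S T => ∑ a, ∑ b, ∑ c, ∑ d, (∑ a', ∑ b', ∑ c', ∑ d',
      G a a' * G b b' * G c c' * G d d' * S a' b' c' d') * T a b c d)
    (fun _ _ _ => by simp only [Pi.add_apply, mul_add, add_mul, Finset.sum_add_distrib])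
    (fun k X Y => by
      simp only [Pi.smul_apply, smul_eq_mul, Finset.mul_sum, Finset.sum_mul]
      exact Finset.sum_congr rfl fun _ _ => Finset.sum_congr rfl fun _ _ =>
        Finset.sum_congr rfl fun _ _ => Finset.sum_congr rfl fun _ _ =>
        Finset.sum_congr rfl fun _ _ => Finset.sum_congr rfl fun _ _ =>
        Finset.sum_congr rfl fun _ _ => Finset.sum_congr rfl fun _ _ => by ring)
    (fun _ _ _ => by simp only [Pi.add_apply, mul_add, Finset.sum_add_distrib])
    (fun k X Y => by
      simp only [Pi.smul_apply, smul_eq_mul, Finset.mul_sum]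
      exact Finset.sum_congr rfl fun _ _ => Finset.sum_congr rfl fun _ _ =>
        Finset.sum_congr rfl fun _ _ => Finset.sum_congr rfl fun _ _ => by
        ring)

theorem pair4_apply (G : Matrix (Fin 4) (Fin 4) ℂ) (S T : T4) :
    pair4 G S T = ∑ a, ∑ b, ∑ c, ∑ d, (∑ a', ∑ b', ∑ c', ∑ d',
      G a a' * G b b' * G c c' * G d d' * S a' b' c' d') * T a b c d := rfl

/-- Factoring the eightfold sum keeps the contractions tractable: with `pair2_wedge`, every
invariant reduces to products of entries of `eta`. -/
theorem pair4_tens (G : Matrix (Fin 4) (Fin 4) ℂ) (X Y X' Y' : T2) :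
    pair4 G (tens X Y) (tens X' Y') = pair2 G X X' * pair2 G Y Y' := by
  rw [pair4_apply, pair2_apply, pair2_apply, Finset.sum_mul]
  refine Finset.sum_congr rfl fun a _ => ?_
  rw [Finset.sum_mul]
  refine Finset.sum_congr rfl fun b _ => ?_
  rw [Finset.mul_sum]
  refine Finset.sum_congr rfl fun c _ => ?_
  rw [Finset.mul_sum]
  refine Finset.sum_congr rfl fun d _ => ?_
  have : ∑ a', ∑ b', ∑ c', ∑ d', G a a' * G b b' * G c c' * G d d' * tens X Y a' b' c' d' =
      (∑ a', ∑ b', G a a' * G b b' * X a' b') * (∑ c', ∑ d', G c c' * G d d' * Y c' d') := by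
    simp only [Finset.sum_mul]
    simp only [Finset.mul_sum]
    exact Finset.sum_congr rfl fun _ _ => Finset.sum_congr rfl fun _ _ =>
        Finset.sum_congr rfl fun _ _ => Finset.sum_congr rfl fun _ _ => by
        rw [tens]; ring
  rw [this, tens]
  ring

theorem pair2_simple (G : Matrix (Fin 4) (Fin 4) ℂ) (u v u' v' : Fin 4 → ℂ) :
    pair2 G (fun a b => u a * v b) (fun a b => u' a * v' b) = dot G u' u * dot G v' v := by
  rw [pair2_apply, dot_apply, dot_apply, Finset.sum_mul]
  refine Finset.sum_congr rfl fun a _ => ?_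
  rw [Finset.mul_sum]
  refine Finset.sum_congr rfl fun b _ => ?_
  simp only [Finset.sum_mul]
  simp only [Finset.mul_sum]
  exact Finset.sum_congr rfl fun _ _ => Finset.sum_congr rfl fun _ _ => by ring

theorem pair2_wedge (G : Matrix (Fin 4) (Fin 4) ℂ) (u v u' v' : Fin 4 → ℂ) :
    pair2 G (wedge u v) (wedge u' v') =
      2 * (dot G u' u * dot G v' v - dot G u' v * dot G v' u) := by
  have h : ∀ u v : Fin 4 → ℂ, wedge u v = (fun a b => u a * v b) - fun a b => v a * u b :=
    fun _ _ => rfl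
  rw [h, h, map_sub, map_sub, LinearMap.sub_apply, LinearMap.sub_apply, pair2_simple, pair2_simple,
    pair2_simple, pair2_simple]
  ring

/-- The contraction `G^{cd} X_{da} Y_{cb}`. -/
def contract13 (G : Matrix (Fin 4) (Fin 4) ℂ) (X Y : T2) (a b : Fin 4) : ℂ :=
  ∑ c, ∑ d, G c d * (X d a * Y c b)

theorem contract13_wedge (G : Matrix (Fin 4) (Fin 4) ℂ) (u v u' v' : Fin 4 → ℂ) (a b : Fin 4) :
    contract13 G (wedge u v) (wedge u' v') a b =
      dot G u' u * (v a * v' b) - dot G v' u * (v a * u' b)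
      - dot G u' v * (u a * v' b) + dot G v' v * (u a * u' b) := by
  simp only [contract13, dot_apply, Finset.sum_mul, ← Finset.sum_sub_distrib,
    ← Finset.sum_add_distrib]
  exact Finset.sum_congr rfl fun _ _ => Finset.sum_congr rfl fun _ _ => by
    simp only [wedge]; ring

theorem contract13_sub_left (G : Matrix (Fin 4) (Fin 4) ℂ) (X X' Y : T2) (a b : Fin 4) :
    contract13 G (X - X') Y a b = contract13 G X Y a b - contract13 G X' Y a b := by
  simp only [contract13, ← Finset.sum_sub_distrib]
  exact Finset.sum_congr rfl fun _ _ => Finset.sum_congr rfl fun _ _ => by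
    simp only [Pi.sub_apply]; ring

theorem contract13_sub_right (G : Matrix (Fin 4) (Fin 4) ℂ) (X Y Y' : T2) (a b : Fin 4) :
    contract13 G X (Y - Y') a b = contract13 G X Y a b - contract13 G X Y' a b := by
  simp only [contract13, ← Finset.sum_sub_distrib]
  exact Finset.sum_congr rfl fun _ _ => Finset.sum_congr rfl fun _ _ => by
    simp only [Pi.sub_apply]; ring

theorem contract13_add_left (G : Matrix (Fin 4) (Fin 4) ℂ) (X X' Y : T2) (a b : Fin 4) :
    contract13 G (X + X') Y a b = contract13 G X Y a b + contract13 G X' Y a b := by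
  simp only [contract13, ← Finset.sum_add_distrib]
  exact Finset.sum_congr rfl fun _ _ => Finset.sum_congr rfl fun _ _ => by
    simp only [Pi.add_apply]; ring

theorem contract13_add_right (G : Matrix (Fin 4) (Fin 4) ℂ) (X Y Y' : T2) (a b : Fin 4) :
    contract13 G X (Y + Y') a b = contract13 G X Y a b + contract13 G X Y' a b := by
  simp only [contract13, ← Finset.sum_add_distrib]
  exact Finset.sum_congr rfl fun _ _ => Finset.sum_congr rfl fun _ _ => by
    simp only [Pi.add_apply]; ring

end Contractions

/-! ### Self-dual and anti-self-dual bivectors of a null coframe -/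

/-- A triple of bivectors. -/
structure BivTriple where
  X₁ : T2
  X₂ : T2
  X₃ : T2

namespace BivTriple

variable (t s : BivTriple) (G : Matrix (Fin 4) (Fin 4) ℂ)

/-- The curvature tensor of type D with unit coefficient. -/
def weylD : T4 := tens t.X₃ t.X₃ - tens t.X₁ t.X₂ - tens t.X₂ t.X₁

/-- `X₃ ⊗ X₁ + X₁ ⊗ X₃`. -/
def mix₁ : T4 := tens t.X₃ t.X₁ + tens t.X₁ t.X₃

/-- `X₃ ⊗ X₂ + X₂ ⊗ X₃`. -/
def mix₂ : T4 := tens t.X₃ t.X₂ + tens t.X₂ t.X₃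

/-- The inner products of a normalized triple. -/
structure IsNormalized : Prop where
  h11 : pair2 G t.X₁ t.X₁ = 0
  h12 : pair2 G t.X₁ t.X₂ = -2
  h13 : pair2 G t.X₁ t.X₃ = 0
  h21 : pair2 G t.X₂ t.X₁ = -2
  h22 : pair2 G t.X₂ t.X₂ = 0
  h23 : pair2 G t.X₂ t.X₃ = 0
  h31 : pair2 G t.X₃ t.X₁ = 0
  h32 : pair2 G t.X₃ t.X₂ = 0
  h33 : pair2 G t.X₃ t.X₃ = -4

/-- Two orthogonal triples. -/
structure IsOrthogonal : Prop where
  h11 : pair2 G t.X₁ s.X₁ = 0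
  h12 : pair2 G t.X₁ s.X₂ = 0
  h13 : pair2 G t.X₁ s.X₃ = 0
  h21 : pair2 G t.X₂ s.X₁ = 0
  h22 : pair2 G t.X₂ s.X₂ = 0
  h23 : pair2 G t.X₂ s.X₃ = 0
  h31 : pair2 G t.X₃ s.X₁ = 0
  h32 : pair2 G t.X₃ s.X₂ = 0
  h33 : pair2 G t.X₃ s.X₃ = 0

/-- The covariant derivative of `ψ · weylD` in one direction: `p = ∂ψ`, `k = ψ κ`, `n = ψ ν`. -/
def deriv4 (p k n : ℂ) : T4 := p • t.weylD + (3 * k) • t.mix₂ - (3 * n) • t.mix₁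

variable {t s G}

/-- `weylD` pairs with itself to `16 + 4 + 4 = 24`, `mix₁` with `mix₂` to `2 · (-4) · (-2) = 16`,
and all other pairings vanish; `144 = 3 · 3 · 16`. -/
theorem IsNormalized.pair4_deriv4 (h : t.IsNormalized G) (p k n p' k' n' : ℂ) :
    pair4 G (t.deriv4 p k n) (t.deriv4 p' k' n') =
      24 * (p * p') - 144 * (k * n' + n * k') := by
  simp only [deriv4, weylD, mix₁, mix₂, map_add, map_sub, map_smul, LinearMap.add_apply,
    LinearMap.sub_apply, LinearMap.smul_apply, pair4_tens, h.h11, h.h12, h.h13, h.h21, h.h22,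
    h.h23, h.h31, h.h32, h.h33, smul_eq_mul]
  ring

theorem IsOrthogonal.pair4_deriv4 (h : t.IsOrthogonal s G) (p k n p' k' n' : ℂ) :
    pair4 G (t.deriv4 p k n) (s.deriv4 p' k' n') = 0 := by
  simp only [deriv4, weylD, mix₁, mix₂, map_add, map_sub, map_smul, LinearMap.add_apply,
    LinearMap.sub_apply, LinearMap.smul_apply, pair4_tens, h.h11, h.h12, h.h13, h.h21, h.h22,
    h.h23, h.h31, h.h32, h.h33, smul_eq_mul]
  ring

end BivTriple

namespace CoframeData

variable (c : CoframeData)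

/-- The self-dual triple `N ∧ K`, `L ∧ M`, `L ∧ N - M ∧ K`. -/
def sd (x : Pt) : BivTriple where
  X₁ := wedge (c.θ 1 x) (c.θ 3 x)
  X₂ := wedge (c.θ 0 x) (c.θ 2 x)
  X₃ := wedge (c.θ 0 x) (c.θ 1 x) - wedge (c.θ 2 x) (c.θ 3 x)

/-- The anti-self-dual triple `N ∧ M`, `L ∧ K`, `L ∧ N + M ∧ K`. -/
def asd (x : Pt) : BivTriple where
  X₁ := wedge (c.θ 1 x) (c.θ 2 x)
  X₂ := wedge (c.θ 0 x) (c.θ 3 x)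
  X₃ := wedge (c.θ 0 x) (c.θ 1 x) + wedge (c.θ 2 x) (c.θ 3 x)

end CoframeData

namespace IsNullCoframe

variable {g : MetricField} {V : Set Pt} {c : CoframeData} (h : IsNullCoframe g V c) {x : Pt}
include h

theorem dot_θ (hx : x ∈ V) (α β : Fin 4) : dot (invM g x) (c.θ α x) (c.θ β x) = eta α β := by
  rw [← h.coframe_inv hx, dot_apply, Matrix.mul_apply]
  simp only [Matrix.mul_apply, Finset.sum_mul]
  rw [Finset.sum_comm]
  exact Finset.sum_congr rfl fun j _ => Finset.sum_congr rfl fun i _ => by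
    simp only [CoframeData.Θ, Matrix.of_apply, Matrix.transpose_apply]; ring

theorem sd_isNormalized (hx : x ∈ V) : (c.sd x).IsNormalized (invM g x) := by
  constructor <;> simp [CoframeData.sd, pair2_wedge, h.dot_θ hx, eta]
  norm_num

theorem asd_isNormalized (hx : x ∈ V) : (c.asd x).IsNormalized (invM g x) := by
  constructor <;> simp [CoframeData.asd, pair2_wedge, h.dot_θ hx, eta]
  norm_num

theorem sd_asd_isOrthogonal (hx : x ∈ V) : (c.sd x).IsOrthogonal (c.asd x) (invM g x) := by
  constructor <;> simp [CoframeData.sd, CoframeData.asd, pair2_wedge, h.dot_θ hx, eta]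

theorem asd_sd_isOrthogonal (hx : x ∈ V) : (c.asd x).IsOrthogonal (c.sd x) (invM g x) := by
  constructor <;> simp [CoframeData.sd, CoframeData.asd, pair2_wedge, h.dot_θ hx, eta]

end IsNullCoframe

/-! ### Curvature of type D -/

/-- The exterior derivative of a one-form. -/
def extD (u : Pt → Fin 4 → ℂ) (x : Pt) (k l : Fin 4) : ℂ :=
  pd k (fun y => u y l) x - pd l (fun y => u y k) x

/-- The curvature two-forms of a null coframe have type D, with Weyl scalars `ψ`, `ψ'`, Ricci
scalar `φ` and cosmological constant `Λ`. -/
structure HasTypeDCurvature (V : Set Pt) (c : CoframeData) (ψ ψ' φ : Pt → ℂ) (Λ : ℂ) : Prop where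
  sd₁ : ∀ x ∈ V, ∀ k l, extD c.ν₂ x k l + wedge (c.a x - c.b x) (c.ν₂ x) k l =
    (-Λ / 3 - ψ x) * (c.sd x).X₂ k l
  sd₂ : ∀ x ∈ V, ∀ k l, extD c.κ₁ x k l - wedge (c.a x - c.b x) (c.κ₁ x) k l =
    (-Λ / 3 - ψ x) * (c.sd x).X₁ k l
  sd₃ : ∀ x ∈ V, ∀ k l, extD c.a x k l - extD c.b x k l - 2 * wedge (c.κ₁ x) (c.ν₂ x) k l =
    (-Λ / 3 + 2 * ψ x) * (c.sd x).X₃ k l + 2 * φ x * (c.asd x).X₃ k l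
  asd₁ : ∀ x ∈ V, ∀ k l, extD c.ν₁ x k l + wedge (c.a x + c.b x) (c.ν₁ x) k l =
    (-Λ / 3 - ψ' x) * (c.asd x).X₂ k l
  asd₂ : ∀ x ∈ V, ∀ k l, extD c.κ₂ x k l - wedge (c.a x + c.b x) (c.κ₂ x) k l =
    (-Λ / 3 - ψ' x) * (c.asd x).X₁ k l
  asd₃ : ∀ x ∈ V, ∀ k l, extD c.a x k l + extD c.b x k l - 2 * wedge (c.κ₂ x) (c.ν₁ x) k l =
    (-Λ / 3 + 2 * ψ' x) * (c.asd x).X₃ k l + 2 * φ x * (c.sd x).X₃ k l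

theorem pd_neg' (k : Fin 4) (f : Pt → ℂ) (x : Pt) : pd k (fun y => -f y) x = -pd k f x :=
  deriv.fun_neg

theorem pd_const' (k : Fin 4) (z : ℂ) (x : Pt) : pd k (fun _ : Pt => z) x = 0 := by simp [pd]

theorem CoframeData.dConn_eq (c : CoframeData) (k l : Fin 4) (x : Pt) : c.dConn k l x =
    !![pd k (fun y => c.a y l) x, 0, -pd k (fun y => c.ν₁ y l) x, -pd k (fun y => c.ν₂ y l) x;
      0, -pd k (fun y => c.a y l) x, -pd k (fun y => c.κ₁ y l) x, -pd k (fun y => c.κ₂ y l) x;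
      -pd k (fun y => c.κ₂ y l) x, -pd k (fun y => c.ν₂ y l) x, -pd k (fun y => c.b y l) x, 0;
      -pd k (fun y => c.κ₁ y l) x, -pd k (fun y => c.ν₁ y l) x, 0, pd k (fun y => c.b y l) x] := by
  ext α β
  fin_cases α <;> fin_cases β <;> simp [CoframeData.dConn, CoframeData.conn, pd_neg', pd_const']

-- With the frame index lowered the curvature is skew. Its entries are the combinations in
-- `HasTypeDCurvature`, except that the entries `(0,1)` and `(2,3)` enter there through their
-- difference (self-dual) and their sum (anti-self-dual).
set_option maxHeartbeats 1000000 in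
theorem CoframeData.eta_curv (c : CoframeData) (x : Pt) (k l : Fin 4) : eta * c.curv k l x =
    !![0, extD c.a x k l - wedge (c.κ₁ x) (c.ν₂ x) k l - wedge (c.κ₂ x) (c.ν₁ x) k l,
        extD c.κ₁ x k l - wedge (c.a x - c.b x) (c.κ₁ x) k l,
        extD c.κ₂ x k l - wedge (c.a x + c.b x) (c.κ₂ x) k l;
      -(extD c.a x k l - wedge (c.κ₁ x) (c.ν₂ x) k l - wedge (c.κ₂ x) (c.ν₁ x) k l), 0,
        extD c.ν₁ x k l + wedge (c.a x + c.b x) (c.ν₁ x) k l,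
        extD c.ν₂ x k l + wedge (c.a x - c.b x) (c.ν₂ x) k l;
      -(extD c.κ₁ x k l - wedge (c.a x - c.b x) (c.κ₁ x) k l),
        -(extD c.ν₁ x k l + wedge (c.a x + c.b x) (c.ν₁ x) k l), 0,
        extD c.b x k l + wedge (c.κ₁ x) (c.ν₂ x) k l - wedge (c.κ₂ x) (c.ν₁ x) k l;
      -(extD c.κ₂ x k l - wedge (c.a x + c.b x) (c.κ₂ x) k l),
        -(extD c.ν₂ x k l + wedge (c.a x - c.b x) (c.ν₂ x) k l),
        -(extD c.b x k l + wedge (c.κ₁ x) (c.ν₂ x) k l - wedge (c.κ₂ x) (c.ν₁ x) k l), 0] := by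
  rw [CoframeData.curv, c.dConn_eq, c.dConn_eq]
  ext α β
  fin_cases α <;> fin_cases β <;>
    simp [eta, CoframeData.conn, Matrix.mul_apply, Fin.sum_univ_four, extD, wedge] <;> ring

namespace IsNullCoframe

variable {g : MetricField} {V : Set Pt} {c : CoframeData} (h : IsNullCoframe g V c) {x : Pt}
include h

theorem riemann_eq_curv (hx : x ∈ V) (a b k l : Fin 4) :
    (riemann g x a b k l : ℂ) = ((c.Θ x).transpose * (eta * c.curv k l x) * c.Θ x) a b := by
  have h1 : (riemann g x a b k l : ℂ) = (metricM g x * riemannM g k l x) a b := by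
    rw [Matrix.mul_apply]
    simp only [riemann, metricM, riemannM, Matrix.of_apply, Matrix.map_apply]
    push_cast
    rfl
  rw [h1, h.metric x hx, Matrix.mul_assoc, h.coframe_riemann hx]
  simp only [Matrix.mul_assoc]

theorem metric_eq (hx : x ∈ V) (a b : Fin 4) : (g x a b : ℂ) =
    -(c.θ 0 x a * c.θ 1 x b + c.θ 1 x a * c.θ 0 x b)
      + (c.θ 2 x a * c.θ 3 x b + c.θ 3 x a * c.θ 2 x b) := by
  rw [h.metric_apply hx]
  simp [Fin.sum_univ_four, eta]
  ring

variable {ψ ψ' φ : Pt → ℂ} {Λ : ℂ} (hc : HasTypeDCurvature V c ψ ψ' φ Λ)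
include hc

theorem riemann_eq (hx : x ∈ V) (a b k l : Fin 4) :
    (riemann g x a b k l : ℂ) =
      (-Λ / 3 - ψ x) * ((c.sd x).X₁ a b * (c.sd x).X₂ k l + (c.sd x).X₂ a b * (c.sd x).X₁ k l)
      + (-Λ / 6 + ψ x) * ((c.sd x).X₃ a b * (c.sd x).X₃ k l)
      + (-Λ / 3 - ψ' x) *
        ((c.asd x).X₁ a b * (c.asd x).X₂ k l + (c.asd x).X₂ a b * (c.asd x).X₁ k l)
      + (-Λ / 6 + ψ' x) * ((c.asd x).X₃ a b * (c.asd x).X₃ k l)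
      + φ x * ((c.sd x).X₃ a b * (c.asd x).X₃ k l + (c.asd x).X₃ a b * (c.sd x).X₃ k l) := by
  -- The first index pair is expanded in the basis of self-dual and anti-self-dual bivectors.
  have e0 : (riemann g x a b k l : ℂ) =
      (c.sd x).X₁ a b * (extD c.ν₂ x k l + wedge (c.a x - c.b x) (c.ν₂ x) k l)
      + (c.sd x).X₂ a b * (extD c.κ₁ x k l - wedge (c.a x - c.b x) (c.κ₁ x) k l)
      + (c.sd x).X₃ a b *
        (extD c.a x k l - extD c.b x k l - 2 * wedge (c.κ₁ x) (c.ν₂ x) k l) / 2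
      + (c.asd x).X₁ a b * (extD c.ν₁ x k l + wedge (c.a x + c.b x) (c.ν₁ x) k l)
      + (c.asd x).X₂ a b * (extD c.κ₂ x k l - wedge (c.a x + c.b x) (c.κ₂ x) k l)
      + (c.asd x).X₃ a b *
        (extD c.a x k l + extD c.b x k l - 2 * wedge (c.κ₂ x) (c.ν₁ x) k l) / 2 := by
    rw [h.riemann_eq_curv hx, c.eta_curv]
    simp [Matrix.mul_apply, Fin.sum_univ_four, CoframeData.Θ, Matrix.transpose_apply,
      CoframeData.sd, CoframeData.asd, wedge]
    ring
  rw [e0, hc.sd₁ x hx, hc.sd₂ x hx, hc.sd₃ x hx, hc.asd₁ x hx, hc.asd₂ x hx, hc.asd₃ x hx]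
  ring

/-- Symmetrized products of bivectors of equal duality contract to multiples of the metric, and in
these the Weyl scalars cancel. Products of opposite duality contract to a trace-free tensor, which
carries `φ`. -/
theorem ricci_eq (hx : x ∈ V) (a b : Fin 4) : (ricci g x a b : ℂ) =
    Λ * g x a b + 2 * φ x * (c.θ 0 x a * c.θ 1 x b + c.θ 1 x a * c.θ 0 x b
      + (c.θ 2 x a * c.θ 3 x b + c.θ 3 x a * c.θ 2 x b)) := by
  have e1 : ∀ k l : Fin 4, riemannM g k l x = invM g x * (metricM g x * riemannM g k l x) := by
    intro k l
    rw [← Matrix.mul_assoc, mul_eq_one_comm.mp (h.metric_mul_inv hx), Matrix.one_mul]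
  have e2 : ∀ i j k l : Fin 4, (riemannUp g i j k l x : ℂ) =
      ∑ d, invM g x i d * (riemann g x d j k l : ℂ) := by
    intro i j k l
    have := congrFun (congrFun (e1 k l) i) j
    rw [Matrix.mul_apply] at this
    refine this.trans (Finset.sum_congr rfl fun d _ => ?_)
    congr 1
    rw [Matrix.mul_apply]
    simp only [riemann, metricM, riemannM, Matrix.of_apply, Matrix.map_apply]
    push_cast
    rfl
  have e3 : (ricci g x a b : ℂ) =
      (-Λ / 3 - ψ x) * (contract13 (invM g x) (c.sd x).X₁ (c.sd x).X₂ a b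
        + contract13 (invM g x) (c.sd x).X₂ (c.sd x).X₁ a b)
      + (-Λ / 6 + ψ x) * contract13 (invM g x) (c.sd x).X₃ (c.sd x).X₃ a b
      + (-Λ / 3 - ψ' x) * (contract13 (invM g x) (c.asd x).X₁ (c.asd x).X₂ a b
        + contract13 (invM g x) (c.asd x).X₂ (c.asd x).X₁ a b)
      + (-Λ / 6 + ψ' x) * contract13 (invM g x) (c.asd x).X₃ (c.asd x).X₃ a b
      + φ x * (contract13 (invM g x) (c.sd x).X₃ (c.asd x).X₃ a b
        + contract13 (invM g x) (c.asd x).X₃ (c.sd x).X₃ a b) := by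
    simp only [ricci]
    push_cast
    simp only [e2, contract13, Finset.mul_sum, ← Finset.sum_add_distrib]
    refine Finset.sum_congr rfl fun k _ => Finset.sum_congr rfl fun d _ => ?_
    rw [h.riemann_eq hc hx]
    ring
  rw [e3, h.metric_eq hx]
  simp only [CoframeData.sd, CoframeData.asd, contract13_sub_left, contract13_sub_right,
    contract13_add_left, contract13_add_right, contract13_wedge, h.dot_θ hx]
  simp [eta]
  ring

theorem scalarCurv_eq (hx : x ∈ V) : (scalarCurv g x : ℂ) = 4 * Λ := by
  have hd : ∀ α β : Fin 4, ∑ a, ∑ b, invM g x a b * (c.θ α x a * c.θ β x b) = eta α β := by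
    intro α β
    rw [← h.dot_θ hx, dot_apply]
    simp only [mul_assoc]
  have e1 : (scalarCurv g x : ℂ) =
      (2 * φ x - Λ) * (∑ a, ∑ b, invM g x a b * (c.θ 0 x a * c.θ 1 x b)
        + ∑ a, ∑ b, invM g x a b * (c.θ 1 x a * c.θ 0 x b))
      + (2 * φ x + Λ) * (∑ a, ∑ b, invM g x a b * (c.θ 2 x a * c.θ 3 x b)
        + ∑ a, ∑ b, invM g x a b * (c.θ 3 x a * c.θ 2 x b)) := by
    simp only [scalarCurv]
    push_cast
    simp only [Finset.mul_sum, ← Finset.sum_add_distrib]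
    refine Finset.sum_congr rfl fun a _ => Finset.sum_congr rfl fun b _ => ?_
    rw [h.ricci_eq hc hx, h.metric_eq hx, invM, Matrix.map_apply]
    ring
  rw [e1, hd, hd, hd, hd]
  simp [eta]
  ring

/-- The Weyl tensor in a null coframe with curvature of type D. -/
theorem weyl_eq (hx : x ∈ V) (a b k l : Fin 4) : (weyl g x a b k l : ℂ) =
    (ψ x • (c.sd x).weylD + ψ' x • (c.asd x).weylD) a b k l := by
  simp only [weyl]
  push_cast
  rw [h.riemann_eq hc hx, h.scalarCurv_eq hc hx]
  simp only [h.ricci_eq hc hx, h.metric_eq hx]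
  simp only [BivTriple.weylD, tens, Pi.add_apply, Pi.smul_apply, Pi.sub_apply, smul_eq_mul,
    CoframeData.sd, CoframeData.asd, wedge]
  ring

end IsNullCoframe

/-! ### The volume form and the dual Weyl tensor -/

theorem contract4_ofReal (g : MetricField) (S T : Tensor4) (x : Pt) :
    (contract4 g S T x : ℂ) = pair4 (invM g x) (fun a b k l => (S x a b k l : ℂ))
      (fun a b k l => (T x a b k l : ℂ)) := by
  rw [contract4, pair4_apply]
  push_cast
  rfl

/-- The symbol is the determinant of the matrix that selects the columns `a, b, k, l`, so
multiplicativity of the determinant applies. -/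
theorem permSymbol_mul_det (A : Matrix (Fin 4) (Fin 4) ℂ) (a b k l : Fin 4) :
    A.det * (permSymbol a b k l : ℂ) = (Matrix.of fun α i => A α (![a, b, k, l] i)).det := by
  have h1 : (permSymbol a b k l : ℂ) =
      (Matrix.of fun i j : Fin 4 => if ![a, b, k, l] i = j then (1 : ℂ) else 0).det := by
    rw [permSymbol, ← Complex.ofRealHom_eq_coe, RingHom.map_det]
    congr 1
    ext i j
    simp only [RingHom.mapMatrix_apply, Matrix.map_apply, Matrix.of_apply,
      Complex.ofRealHom_eq_coe]
    split_ifs <;> simp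
  rw [h1, ← Matrix.det_transpose (Matrix.of fun i j : Fin 4 => _), ← Matrix.det_mul]
  congr 1
  ext α i
  simp [Matrix.mul_apply]

/-- A coframe is positively oriented if `ε(L, N, M, K) = -i`. -/
def CoframeData.IsOriented (c : CoframeData) (g : MetricField) (o : ℤˣ) (V : Set Pt) : Prop :=
  ∀ x ∈ V, (((o : ℤ) : ℝ) * Real.sqrt |(g x).det| : ℂ) = -Complex.I * (c.Θ x).det

/-- Laplace expansion of `L ∧ N ∧ M ∧ K` in complementary two-by-two minors. In the triples `sd` and
`asd` it has no mixed terms and opposite signs on the two dualities; hence `weylDual` multiplies the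
two halves of the Weyl tensor by `-i` and `i`. -/
theorem CoframeData.IsOriented.volForm_eq {c : CoframeData} {g : MetricField} {o : ℤˣ}
    {V : Set Pt} (ho : c.IsOriented g o V) {x : Pt} (hx : x ∈ V) (a b : Fin 4) :
    (fun k l => (volForm g o x a b k l : ℂ)) = -Complex.I •
      ((-(c.sd x).X₂ a b) • (c.sd x).X₁ - (c.sd x).X₁ a b • (c.sd x).X₂
        - ((c.sd x).X₃ a b / 2) • (c.sd x).X₃ + (c.asd x).X₂ a b • (c.asd x).X₁
        + (c.asd x).X₁ a b • (c.asd x).X₂ + ((c.asd x).X₃ a b / 2) • (c.asd x).X₃) := by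
  ext k l
  have h1 : (volForm g o x a b k l : ℂ) = -Complex.I * ((c.Θ x).det * permSymbol a b k l) := by
    rw [volForm, ← mul_assoc, ← ho x hx]
    push_cast
    rfl
  rw [h1, permSymbol_mul_det]
  simp only [Pi.smul_apply, Pi.add_apply, Pi.sub_apply, smul_eq_mul]
  congr 1
  simp [Matrix.det_succ_row_zero, Fin.sum_univ_succ, Fin.succAbove, CoframeData.Θ,
    CoframeData.sd, CoframeData.asd, wedge]
  ring

namespace IsNullCoframe

variable {g : MetricField} {V : Set Pt} {c : CoframeData} (h : IsNullCoframe g V c) {x : Pt}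
  {ψ ψ' φ : Pt → ℂ} {Λ : ℂ} (hc : HasTypeDCurvature V c ψ ψ' φ Λ) {o : ℤˣ}
  (ho : c.IsOriented g o V)
include h hc

include ho in
theorem weylDual_eq (hx : x ∈ V) (a b k l : Fin 4) : (weylDual g o x a b k l : ℂ) =
    ((-Complex.I * ψ x) • (c.sd x).weylD + (Complex.I * ψ' x) • (c.asd x).weylD) a b k l := by
  have e1 : (weylDual g o x a b k l : ℂ) = (1 / 2) * pair2 (invM g x)
      (fun p q => (weyl g x p q k l : ℂ)) (fun e f => (volForm g o x a b e f : ℂ)) := by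
    rw [weylDual, pair2_apply]
    push_cast
    congr 1
    exact Finset.sum_congr rfl fun _ _ => Finset.sum_congr rfl fun _ _ => mul_comm _ _
  have e2 : (fun p q => (weyl g x p q k l : ℂ)) =
      ψ x • ((c.sd x).X₃ k l • (c.sd x).X₃ - (c.sd x).X₂ k l • (c.sd x).X₁
        - (c.sd x).X₁ k l • (c.sd x).X₂)
      + ψ' x • ((c.asd x).X₃ k l • (c.asd x).X₃ - (c.asd x).X₂ k l • (c.asd x).X₁
        - (c.asd x).X₁ k l • (c.asd x).X₂) := by
    ext p q
    rw [h.weyl_eq hc hx]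
    simp only [BivTriple.weylD, tens, Pi.add_apply, Pi.smul_apply, Pi.sub_apply, smul_eq_mul]
    ring
  have n := h.sd_isNormalized hx
  have n' := h.asd_isNormalized hx
  have m := h.sd_asd_isOrthogonal hx
  have m' := h.asd_sd_isOrthogonal hx
  rw [e1, e2, ho.volForm_eq hx]
  simp only [map_add, map_sub, map_smul, LinearMap.add_apply, LinearMap.sub_apply,
    LinearMap.smul_apply, smul_eq_mul, n.h11, n.h12, n.h13, n.h21, n.h22, n.h23, n.h31, n.h32,
    n.h33, n'.h11, n'.h12, n'.h13, n'.h21, n'.h22, n'.h23, n'.h31, n'.h32, n'.h33,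
    m.h11, m.h12, m.h13, m.h21, m.h22, m.h23, m.h31, m.h32,
    m.h33, m'.h11, m'.h12, m'.h13, m'.h21, m'.h22, m'.h23, m'.h31, m'.h32, m'.h33]
  simp only [BivTriple.weylD, tens, Pi.add_apply, Pi.smul_apply, Pi.sub_apply, smul_eq_mul]
  ring

omit hc in
theorem pair4_weylD (hx : x ∈ V) (p p' q q' : ℂ) :
    pair4 (invM g x) (p • (c.sd x).weylD + p' • (c.asd x).weylD)
      (q • (c.sd x).weylD + q' • (c.asd x).weylD) = 24 * (p * q + p' * q') := by
  have e : ∀ (t : BivTriple) (p : ℂ), p • t.weylD = t.deriv4 p 0 0 := by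
    intro t p
    simp [BivTriple.deriv4]
  simp only [e, map_add, LinearMap.add_apply, (h.sd_isNormalized hx).pair4_deriv4,
    (h.asd_isNormalized hx).pair4_deriv4, (h.sd_asd_isOrthogonal hx).pair4_deriv4,
    (h.asd_sd_isOrthogonal hx).pair4_deriv4]
  ring

theorem I1_eq (hx : x ∈ V) : (I1 g x : ℂ) = 24 * (ψ x ^ 2 + ψ' x ^ 2) := by
  rw [I1, contract4_ofReal]
  have e : (fun a b k l => (weyl g x a b k l : ℂ)) =
      ψ x • (c.sd x).weylD + ψ' x • (c.asd x).weylD := by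
    ext a b k l
    exact h.weyl_eq hc hx a b k l
  rw [e, h.pair4_weylD hx]
  ring

include ho in
theorem I2_eq (hx : x ∈ V) : (I2 g o x : ℂ) = 24 * Complex.I * (ψ' x ^ 2 - ψ x ^ 2) := by
  rw [I2, contract4_ofReal]
  have e : (fun a b k l => (weyl g x a b k l : ℂ)) =
      ψ x • (c.sd x).weylD + ψ' x • (c.asd x).weylD := by
    ext a b k l
    exact h.weyl_eq hc hx a b k l
  have e' : (fun a b k l => (weylDual g o x a b k l : ℂ)) =
      (-Complex.I * ψ x) • (c.sd x).weylD + (Complex.I * ψ' x) • (c.asd x).weylD := by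
    ext a b k l
    exact h.weylDual_eq hc ho hx a b k l
  rw [e, e', h.pair4_weylD hx]
  ring

end IsNullCoframe

/-! ### Covariant derivatives -/

/-- `D_{ae} = u_{a;e}` at `x`. -/
def HasNabla1 (g : MetricField) (u : Pt → Fin 4 → ℂ) (x : Pt) (D : Fin 4 → Fin 4 → ℂ) : Prop :=
  ∀ a, HasPd (fun y => u y a) x (fun e => D a e + ∑ f, (christoffel g f e a x : ℂ) * u x f)

/-- `D e a b = X_{ab;e}` at `x`. -/
def HasNabla2 (g : MetricField) (X : Pt → T2) (x : Pt) (D : Fin 4 → T2) : Prop :=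
  ∀ a b, HasPd (fun y => X y a b) x (fun e => D e a b +
    ∑ f, ((christoffel g f e a x : ℂ) * X x f b + (christoffel g f e b x : ℂ) * X x a f))

/-- `D e a b k l = T_{abkl;e}` at `x`. -/
def HasNabla4 (g : MetricField) (T : Pt → T4) (x : Pt) (D : Fin 4 → T4) : Prop :=
  ∀ a b k l, HasPd (fun y => T y a b k l) x (fun e => D e a b k l +
    ∑ f, ((christoffel g f e a x : ℂ) * T x f b k l + (christoffel g f e b x : ℂ) * T x a f k l +
      (christoffel g f e k x : ℂ) * T x a b f l + (christoffel g f e l x : ℂ) * T x a b k f))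

section Nabla

variable {g : MetricField} {x : Pt}

theorem HasNabla1.wedge {u v : Pt → Fin 4 → ℂ} {D D' : Fin 4 → Fin 4 → ℂ}
    (hu : HasNabla1 g u x D) (hv : HasNabla1 g v x D') :
    HasNabla2 g (fun y => wedge (u y) (v y)) x (fun e =>
      wedge (fun a => D a e) (v x) + wedge (u x) (fun a => D' a e)) := fun a b => by
  refine (((hu a).mul (hv b)).sub ((hv a).mul (hu b))).congr_deriv fun e => ?_
  simp only [BlackHoleInvariants.wedge, Pi.add_apply, Fin.sum_univ_four]
  ring

theorem HasNabla2.add {X Y : Pt → T2} {D D' : Fin 4 → T2} (hX : HasNabla2 g X x D)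
    (hY : HasNabla2 g Y x D') : HasNabla2 g (fun y => X y + Y y) x (fun e => D e + D' e) :=
  fun a b => by
  refine ((hX a b).add (hY a b)).congr_deriv fun e => ?_
  simp only [Pi.add_apply, Fin.sum_univ_four]
  ring

theorem HasNabla2.sub {X Y : Pt → T2} {D D' : Fin 4 → T2} (hX : HasNabla2 g X x D)
    (hY : HasNabla2 g Y x D') : HasNabla2 g (fun y => X y - Y y) x (fun e => D e - D' e) :=
  fun a b => by
  refine ((hX a b).sub (hY a b)).congr_deriv fun e => ?_
  simp only [Pi.sub_apply, Fin.sum_univ_four]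
  ring

theorem HasNabla2.congr {X : Pt → T2} {D D' : Fin 4 → T2} (hX : HasNabla2 g X x D)
    (hD : ∀ e, D e = D' e) : HasNabla2 g X x D' := by
  rwa [show D' = D from (funext hD).symm]

theorem HasNabla2.tens {X Y : Pt → T2} {D D' : Fin 4 → T2} (hX : HasNabla2 g X x D)
    (hY : HasNabla2 g Y x D') : HasNabla4 g (fun y => tens (X y) (Y y)) x
      (fun e => tens (D e) (Y x) + tens (X x) (D' e)) := fun a b k l => by
  refine ((hX a b).mul (hY k l)).congr_deriv fun e => ?_
  simp only [BlackHoleInvariants.tens, Pi.add_apply, Fin.sum_univ_four]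
  ring

theorem HasNabla4.add {X Y : Pt → T4} {D D' : Fin 4 → T4} (hX : HasNabla4 g X x D)
    (hY : HasNabla4 g Y x D') : HasNabla4 g (fun y => X y + Y y) x (fun e => D e + D' e) :=
  fun a b k l => by
  refine ((hX a b k l).add (hY a b k l)).congr_deriv fun e => ?_
  simp only [Pi.add_apply, Fin.sum_univ_four]
  ring

theorem HasNabla4.sub {X Y : Pt → T4} {D D' : Fin 4 → T4} (hX : HasNabla4 g X x D)
    (hY : HasNabla4 g Y x D') : HasNabla4 g (fun y => X y - Y y) x (fun e => D e - D' e) :=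
  fun a b k l => by
  refine ((hX a b k l).sub (hY a b k l)).congr_deriv fun e => ?_
  simp only [Pi.sub_apply, Fin.sum_univ_four]
  ring

theorem HasNabla4.smul {X : Pt → T4} {D : Fin 4 → T4} {f : Pt → ℂ} {d : Fin 4 → ℂ}
    (hf : HasPd f x d) (hX : HasNabla4 g X x D) :
    HasNabla4 g (fun y => f y • X y) x (fun e => d e • X x + f x • D e) :=
  fun a b k l => by
  refine (hf.mul (hX a b k l)).congr_deriv fun e => ?_
  simp only [Pi.add_apply, Pi.smul_apply, smul_eq_mul, Fin.sum_univ_four]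
  ring

theorem HasNabla4.congr {X : Pt → T4} {D D' : Fin 4 → T4} (hX : HasNabla4 g X x D)
    (hD : ∀ e, D' e = D e) : HasNabla4 g X x D' := by
  rwa [funext hD]

theorem HasNabla4.covD_eq {V : Set Pt} (hV : IsOpen V) (hx : x ∈ V) {T : Tensor4} {X : Pt → T4}
    {D : Fin 4 → T4} (hX : HasNabla4 g X x D)
    (hT : ∀ y ∈ V, ∀ a b k l, (T y a b k l : ℂ) = X y a b k l) (a b k l e : Fin 4) :
    (covD g T x a b k l e : ℂ) = D e a b k l := by
  have h1 : HasPd (fun y => (T y a b k l : ℂ)) x _ :=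
    (hX a b k l).congr hV hx fun y hy => hT y hy a b k l
  rw [covD, Complex.ofReal_sub, hasPd_ofReal_of_pd h1]
  push_cast
  simp only [hT x hx]
  ring

theorem contractCovD_ofReal (S T : Tensor4) :
    (contractCovD g S T x : ℂ) = ∑ e, ∑ e', invM g x e e' *
      pair4 (invM g x) (fun a b k l => (covD g S x a b k l e' : ℂ))
        (fun a b k l => (covD g T x a b k l e : ℂ)) := by
  rw [contractCovD]
  simp only [pair4_apply]
  push_cast
  rfl

end Nabla

namespace IsNullCoframe

variable {g : MetricField} {V : Set Pt} {c : CoframeData} (h : IsNullCoframe g V c) {x : Pt}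
include h

theorem hasNabla1_θ (hx : x ∈ V) (α : Fin 4) :
    HasNabla1 g (c.θ α) x (fun a e => -∑ β, c.conn e x α β * c.θ β x a) := fun a => by
  refine (h.hasPd_θ hx α a).congr_deriv fun e => ?_
  have := congrFun (congrFun (h.coframe_christoffel hx e) α) a
  rw [Matrix.mul_apply, Matrix.add_apply, Matrix.mul_apply] at this
  rw [eq_sub_of_add_eq this.symm]
  simp only [christoffelM, CoframeData.Θ, Matrix.of_apply]
  rw [Finset.sum_congr rfl fun f _ => mul_comm (c.θ α x f) _]
  ring

/-- The self-dual bivectors form a parallel subbundle: the connection acts on the triple through `a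
- b`, `κ₁` and `ν₂` only. On the anti-self-dual triple the forms are `a + b`, `κ₂` and `ν₁`. -/
theorem hasNabla_sd₁ (hx : x ∈ V) : HasNabla2 g (fun y => (c.sd y).X₁) x (fun e =>
    (c.a x e - c.b x e) • (c.sd x).X₁ - c.κ₁ x e • (c.sd x).X₃) := by
  refine ((h.hasNabla1_θ hx 1).wedge (h.hasNabla1_θ hx 3)).congr fun e => ?_
  ext a b
  simp [wedge, CoframeData.sd, CoframeData.conn, Fin.sum_univ_four]
  ring

theorem hasNabla_sd₂ (hx : x ∈ V) : HasNabla2 g (fun y => (c.sd y).X₂) x (fun e =>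
    (-(c.a x e - c.b x e)) • (c.sd x).X₂ + c.ν₂ x e • (c.sd x).X₃) := by
  refine ((h.hasNabla1_θ hx 0).wedge (h.hasNabla1_θ hx 2)).congr fun e => ?_
  ext a b
  simp [wedge, CoframeData.sd, CoframeData.conn, Fin.sum_univ_four]
  ring

theorem hasNabla_sd₃ (hx : x ∈ V) : HasNabla2 g (fun y => (c.sd y).X₃) x (fun e =>
    (2 * c.κ₁ x e) • (c.sd x).X₂ - (2 * c.ν₂ x e) • (c.sd x).X₁) := by
  refine (((h.hasNabla1_θ hx 0).wedge (h.hasNabla1_θ hx 1)).sub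
    ((h.hasNabla1_θ hx 2).wedge (h.hasNabla1_θ hx 3))).congr fun e => ?_
  ext a b
  simp [wedge, CoframeData.sd, CoframeData.conn, Fin.sum_univ_four]
  ring

theorem hasNabla_asd₁ (hx : x ∈ V) : HasNabla2 g (fun y => (c.asd y).X₁) x (fun e =>
    (c.a x e + c.b x e) • (c.asd x).X₁ - c.κ₂ x e • (c.asd x).X₃) := by
  refine ((h.hasNabla1_θ hx 1).wedge (h.hasNabla1_θ hx 2)).congr fun e => ?_
  ext a b
  simp [wedge, CoframeData.asd, CoframeData.conn, Fin.sum_univ_four]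
  ring

theorem hasNabla_asd₂ (hx : x ∈ V) : HasNabla2 g (fun y => (c.asd y).X₂) x (fun e =>
    (-(c.a x e + c.b x e)) • (c.asd x).X₂ + c.ν₁ x e • (c.asd x).X₃) := by
  refine ((h.hasNabla1_θ hx 0).wedge (h.hasNabla1_θ hx 3)).congr fun e => ?_
  ext a b
  simp [wedge, CoframeData.asd, CoframeData.conn, Fin.sum_univ_four]
  ring

theorem hasNabla_asd₃ (hx : x ∈ V) : HasNabla2 g (fun y => (c.asd y).X₃) x (fun e =>
    (2 * c.κ₂ x e) • (c.asd x).X₂ - (2 * c.ν₁ x e) • (c.asd x).X₁) := by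
  refine (((h.hasNabla1_θ hx 0).wedge (h.hasNabla1_θ hx 1)).add
    ((h.hasNabla1_θ hx 2).wedge (h.hasNabla1_θ hx 3))).congr fun e => ?_
  ext a b
  simp [wedge, CoframeData.asd, CoframeData.conn, Fin.sum_univ_four]
  ring

-- Under the rescaling generated by `A` the bivectors `X₁` and `X₂` have opposite weights and `X₃`
-- has weight zero. So `A` drops out of the derivative of `weylD`, and only `κ` and `ν` remain.
omit h in
theorem hasNabla4_weylD {t : Pt → BivTriple} {f : Pt → ℂ} {d A κ ν : Fin 4 → ℂ}
    (hf : HasPd f x d)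
    (h₁ : HasNabla2 g (fun y => (t y).X₁) x fun e => A e • (t x).X₁ - κ e • (t x).X₃)
    (h₂ : HasNabla2 g (fun y => (t y).X₂) x fun e => (-A e) • (t x).X₂ + ν e • (t x).X₃)
    (h₃ : HasNabla2 g (fun y => (t y).X₃) x fun e =>
      (2 * κ e) • (t x).X₂ - (2 * ν e) • (t x).X₁) :
    HasNabla4 g (fun y => f y • (t y).weylD) x
      (fun e => (t x).deriv4 (d e) (f x * κ e) (f x * ν e)) := by
  have h4 := HasNabla4.smul hf (((h₃.tens h₃).sub (h₁.tens h₂)).sub (h₂.tens h₁))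
  refine h4.congr fun e => ?_
  ext a b k l
  simp only [BivTriple.deriv4, BivTriple.weylD, BivTriple.mix₁, BivTriple.mix₂, tens,
    Pi.add_apply, Pi.sub_apply, Pi.smul_apply, smul_eq_mul]
  ring

theorem hasNabla4_typeD (hx : x ∈ V) {f f' : Pt → ℂ} {d d' : Fin 4 → ℂ} (hf : HasPd f x d)
    (hf' : HasPd f' x d') :
    HasNabla4 g (fun y => f y • (c.sd y).weylD + f' y • (c.asd y).weylD) x (fun e =>
      (c.sd x).deriv4 (d e) (f x * c.κ₁ x e) (f x * c.ν₂ x e) +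
      (c.asd x).deriv4 (d' e) (f' x * c.κ₂ x e) (f' x * c.ν₁ x e)) :=
  (hasNabla4_weylD hf (h.hasNabla_sd₁ hx) (h.hasNabla_sd₂ hx) (h.hasNabla_sd₃ hx)).add
    (hasNabla4_weylD hf' (h.hasNabla_asd₁ hx) (h.hasNabla_asd₂ hx) (h.hasNabla_asd₃ hx))

/-- Orthogonality of the two dualities splits the contraction; in each half `pair4_deriv4` is
contracted over the derivative index. -/
theorem contractCovD_typeD (hx : x ∈ V) {f f' p p' : Pt → ℂ} {df df' dp dp' : Fin 4 → ℂ}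
    (hf : HasPd f x df) (hf' : HasPd f' x df') (hp : HasPd p x dp) (hp' : HasPd p' x dp')
    {S T : Tensor4}
    (hS : ∀ y ∈ V, ∀ a b k l, (S y a b k l : ℂ) =
      (f y • (c.sd y).weylD + f' y • (c.asd y).weylD) a b k l)
    (hT : ∀ y ∈ V, ∀ a b k l, (T y a b k l : ℂ) =
      (p y • (c.sd y).weylD + p' y • (c.asd y).weylD) a b k l) :
    (contractCovD g S T x : ℂ) =
      24 * dot (invM g x) dp df - 144 * (f x * p x) *
        (dot (invM g x) (c.ν₂ x) (c.κ₁ x) + dot (invM g x) (c.κ₁ x) (c.ν₂ x))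
      + 24 * dot (invM g x) dp' df' - 144 * (f' x * p' x) *
        (dot (invM g x) (c.ν₁ x) (c.κ₂ x) + dot (invM g x) (c.κ₂ x) (c.ν₁ x)) := by
  have eS := (h.hasNabla4_typeD hx hf hf').covD_eq h.isOpen hx hS
  have eT := (h.hasNabla4_typeD hx hp hp').covD_eq h.isOpen hx hT
  have eS' : ∀ e, (fun a b k l => (covD g S x a b k l e : ℂ)) = _ := fun e => by
    ext a b k l
    exact eS a b k l e
  have eT' : ∀ e, (fun a b k l => (covD g T x a b k l e : ℂ)) = _ := fun e => by
    ext a b k l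
    exact eT a b k l e
  rw [contractCovD_ofReal]
  simp only [eS', eT', map_add, LinearMap.add_apply, (h.sd_isNormalized hx).pair4_deriv4,
    (h.asd_isNormalized hx).pair4_deriv4, (h.sd_asd_isOrthogonal hx).pair4_deriv4,
    (h.asd_sd_isOrthogonal hx).pair4_deriv4, dot_apply, Finset.mul_sum, mul_add,
    ← Finset.sum_add_distrib, ← Finset.sum_sub_distrib]
  exact Finset.sum_congr rfl fun _ _ => Finset.sum_congr rfl fun _ _ => by ring

/-- The differential invariants of the Weyl tensor. -/
theorem I3_add_I4 {ψ ψ' φ : Pt → ℂ} {Λ : ℂ} (hc : HasTypeDCurvature V c ψ ψ' φ Λ) {o : ℤˣ}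
    (ho : c.IsOriented g o V) (hx : x ∈ V) {d d' : Fin 4 → ℂ} (hψ : HasPd ψ x d)
    (hψ' : HasPd ψ' x d') :
    (I3 g x : ℂ) + Complex.I * I4 g o x = 48 * dot (invM g x) d d - 288 * ψ x ^ 2 *
      (dot (invM g x) (c.ν₂ x) (c.κ₁ x) + dot (invM g x) (c.κ₁ x) (c.ν₂ x)) := by
  rw [I3, I4, h.contractCovD_typeD hx hψ hψ' hψ hψ' (fun y hy => h.weyl_eq hc hy)
    (fun y hy => h.weyl_eq hc hy), h.contractCovD_typeD hx (hψ.const_mul (-Complex.I))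
    (hψ'.const_mul Complex.I) hψ hψ' (fun y hy => h.weylDual_eq hc ho hy)
    (fun y hy => h.weyl_eq hc hy)]
  have e : ∀ (z : ℂ) (u : Fin 4 → ℂ), (fun i => z * u i) = z • u := fun _ _ => rfl
  rw [e, e, map_smul, map_smul, smul_eq_mul, smul_eq_mul]
  -- The dual tensor carries the coefficients `-iψ` and `iψ'`, so adding `i I₄` doubles the
  -- self-dual part and cancels the anti-self-dual one.
  linear_combination (48 * (ψ x ^ 2 * 3 * (dot (invM g x) (c.ν₂ x) (c.κ₁ x) +
    dot (invM g x) (c.κ₁ x) (c.ν₂ x))) - 24 * dot (invM g x) d d + 24 * dot (invM g x) d' d'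
    - 144 * ψ' x ^ 2 * (dot (invM g x) (c.ν₁ x) (c.κ₂ x) +
    dot (invM g x) (c.κ₂ x) (c.ν₁ x))) * Complex.I_mul_I

end IsNullCoframe

/-! ### The Carter–Plebański family of metrics -/

/-- Parameters of a Carter–Plebański metric, the functions `r`, `x` and the coordinate one-forms
and vector fields of a chart `(t, φ, x, r)` of it. The parameters are complex because the
coordinate `φ` absorbs a factor `±i`. -/
structure Carter where
  c : ℂ
  p₀ : ℂ
  p₁ : ℂ
  ε : ℂ
  Λ : ℂ
  m : ℂ
  w : ℂ
  A₀ : ℂ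
  r : Pt → ℂ
  x : Pt → ℂ
  dt : Fin 4 → ℂ
  dφ : Fin 4 → ℂ
  dx : Pt → Fin 4 → ℂ
  dr : Fin 4 → ℂ
  vt : Fin 4 → ℂ
  vφ : Fin 4 → ℂ
  vx : Pt → Fin 4 → ℂ
  vr : Fin 4 → ℂ

namespace Carter

variable (C : Carter)

/-- The structure function of `x`. -/
def P (y : Pt) : ℂ := C.p₀ + 2 * C.p₁ * C.x y - C.ε * C.x y ^ 2 + C.Λ / 3 * C.c ^ 2 * C.x y ^ 4

/-- The derivative of `P`. -/
def P₁ (y : Pt) : ℂ := 2 * C.p₁ - 2 * C.ε * C.x y + 4 * (C.Λ / 3) * C.c ^ 2 * C.x y ^ 3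

/-- The second derivative of `P`. -/
def P₂ (y : Pt) : ℂ := -2 * C.ε + 12 * (C.Λ / 3) * C.c ^ 2 * C.x y ^ 2

/-- The structure function of `r`. -/
def Q (y : Pt) : ℂ :=
  -C.c ^ 2 * C.p₀ + C.w - 2 * C.m * C.r y + C.ε * C.r y ^ 2 - C.Λ / 3 * C.r y ^ 4

/-- The derivative of `Q`. -/
def Q₁ (y : Pt) : ℂ := -2 * C.m + 2 * C.ε * C.r y - 4 * (C.Λ / 3) * C.r y ^ 3

/-- The second derivative of `Q`. -/
def Q₂ (y : Pt) : ℂ := 2 * C.ε - 12 * (C.Λ / 3) * C.r y ^ 2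

/-- `r + c x`. -/
def ζ (y : Pt) : ℂ := C.r y + C.c * C.x y

/-- `r - c x`. -/
def ζ' (y : Pt) : ℂ := C.r y - C.c * C.x y

/-- `c x² + A₀`. -/
def A (y : Pt) : ℂ := C.c * C.x y ^ 2 + C.A₀

/-- `r² + c A₀`. -/
def B (y : Pt) : ℂ := C.r y ^ 2 + C.c * C.A₀

/-- The one-form with the given components. -/
def form (ft fφ fx fr : Pt → ℂ) (y : Pt) (i : Fin 4) : ℂ :=
  ft y * C.dt i + fφ y * C.dφ i + fx y * C.dx y i + fr y * C.dr i

/-- The vector field with the given components. -/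
def vec (ft fφ fx fr : Pt → ℂ) (y : Pt) (i : Fin 4) : ℂ :=
  ft y * C.vt i + fφ y * C.vφ i + fx y * C.vx y i + fr y * C.vr i

/-- The two-form with the given components. -/
def form2 (y : Pt) (tφ tx tr φx φr xr : ℂ) : T2 :=
  tφ • wedge C.dt C.dφ + tx • wedge C.dt (C.dx y) + tr • wedge C.dt C.dr
    + φx • wedge C.dφ (C.dx y) + φr • wedge C.dφ C.dr + xr • wedge (C.dx y) C.dr

/-- The canonical null coframe, its dual frame and its connection forms. -/
def coframe : CoframeData where
  θ := ![
    C.form (fun y => C.Q y * (C.ζ y)⁻¹ * (C.ζ' y)⁻¹ / 2)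
      (fun y => C.A y * C.Q y * (C.ζ y)⁻¹ * (C.ζ' y)⁻¹ / 2) (fun _ => 0) (fun _ => 1 / 2),
    C.form (fun _ => 1) C.A (fun _ => 0) (fun y => -(C.ζ y * C.ζ' y * (C.Q y)⁻¹)),
    C.form (fun y => -(C.c * C.P y * (C.ζ y)⁻¹ * (C.ζ' y)⁻¹ / 2))
      (fun y => -(C.B y * C.P y * (C.ζ y)⁻¹ * (C.ζ' y)⁻¹ / 2)) (fun _ => 1 / 2) (fun _ => 0),
    C.form (fun _ => C.c) C.B (fun y => C.ζ y * C.ζ' y * (C.P y)⁻¹) (fun _ => 0)]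
  E := ![
    C.vec (fun y => C.B y * (C.Q y)⁻¹) (fun y => -(C.c * (C.Q y)⁻¹)) (fun _ => 0) (fun _ => 1),
    C.vec (fun y => C.B y * (C.ζ y)⁻¹ * (C.ζ' y)⁻¹ / 2)
      (fun y => -(C.c * (C.ζ y)⁻¹ * (C.ζ' y)⁻¹ / 2)) (fun _ => 0)
      (fun y => -(C.Q y * (C.ζ y)⁻¹ * (C.ζ' y)⁻¹ / 2)),
    C.vec (fun y => C.A y * (C.P y)⁻¹) (fun y => -(C.P y)⁻¹) (fun _ => 1) (fun _ => 0),
    C.vec (fun y => -(C.A y * (C.ζ y)⁻¹ * (C.ζ' y)⁻¹ / 2))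
      (fun y => (C.ζ y)⁻¹ * (C.ζ' y)⁻¹ / 2) (fun y => C.P y * (C.ζ y)⁻¹ * (C.ζ' y)⁻¹ / 2)
      (fun _ => 0)]
  κ₁ := C.form (fun _ => 0) (fun y => -C.ζ y) (fun y => -(C.ζ y * (C.P y)⁻¹))
    (fun y => -(C.c * C.ζ y * (C.Q y)⁻¹))
  κ₂ := C.form (fun _ => 0) (fun y => C.P y * (C.ζ y)⁻¹ / 2) (fun y => -((C.ζ y)⁻¹ / 2))
    (fun y => C.c * C.P y * (C.ζ y)⁻¹ * (C.Q y)⁻¹ / 2)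
  ν₁ := C.form (fun _ => 0) (fun y => C.Q y * (C.ζ y)⁻¹ / 2)
    (fun y => C.Q y * (C.P y)⁻¹ * (C.ζ y)⁻¹ / 2) (fun y => -(C.c * (C.ζ y)⁻¹ / 2))
  ν₂ := C.form (fun _ => 0)
    (fun y => -(C.P y * C.Q y * (C.ζ y)⁻¹ * ((C.ζ' y)⁻¹ * (C.ζ' y)⁻¹) / 4))
    (fun y => C.Q y * (C.ζ y)⁻¹ * ((C.ζ' y)⁻¹ * (C.ζ' y)⁻¹) / 4)
    (fun y => C.c * C.P y * (C.ζ y)⁻¹ * ((C.ζ' y)⁻¹ * (C.ζ' y)⁻¹) / 4)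
  a := C.form
    (fun y => C.Q₁ y * ((C.ζ y)⁻¹ * (C.ζ' y)⁻¹) / 2 - C.r y * (C.Q y + C.c ^ 2 * C.P y)
      * ((C.ζ y)⁻¹ * (C.ζ' y)⁻¹) * ((C.ζ y)⁻¹ * (C.ζ' y)⁻¹))
    (fun y => C.A y * (C.Q₁ y * ((C.ζ y)⁻¹ * (C.ζ' y)⁻¹) / 2) - C.r y * (C.A y * C.Q y
      + C.c * C.B y * C.P y) * ((C.ζ y)⁻¹ * (C.ζ' y)⁻¹) * ((C.ζ y)⁻¹ * (C.ζ' y)⁻¹))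
    (fun y => -(C.c ^ 2 * C.x y * ((C.ζ y)⁻¹ * (C.ζ' y)⁻¹)))
    (fun y => C.r y * ((C.ζ y)⁻¹ * (C.ζ' y)⁻¹) - C.Q₁ y * (C.Q y)⁻¹ / 2)
  b := C.form
    (fun y => C.c * C.P₁ y * ((C.ζ y)⁻¹ * (C.ζ' y)⁻¹) / 2 + C.c * C.x y *
      (C.Q y + C.c ^ 2 * C.P y) * ((C.ζ y)⁻¹ * (C.ζ' y)⁻¹) * ((C.ζ y)⁻¹ * (C.ζ' y)⁻¹))
    (fun y => C.B y * (C.P₁ y * ((C.ζ y)⁻¹ * (C.ζ' y)⁻¹) / 2) + C.c * C.x y * (C.A y * C.Q y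
      + C.c * C.B y * C.P y) * ((C.ζ y)⁻¹ * (C.ζ' y)⁻¹) * ((C.ζ y)⁻¹ * (C.ζ' y)⁻¹))
    (fun y => C.P₁ y * (C.P y)⁻¹ / 2 + C.c ^ 2 * C.x y * ((C.ζ y)⁻¹ * (C.ζ' y)⁻¹))
    (fun y => -(C.r y * ((C.ζ y)⁻¹ * (C.ζ' y)⁻¹)))

/-- The Weyl scalar. -/
def ψ (y : Pt) : ℂ :=
  (C.c * C.p₁ - C.m) * ((C.ζ' y)⁻¹) ^ 3 + C.w * ((C.ζ' y)⁻¹) ^ 3 * (C.ζ y)⁻¹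

/-- The Weyl scalar of the opposite duality. -/
def ψ' (y : Pt) : ℂ :=
  (-C.c * C.p₁ - C.m) * ((C.ζ y)⁻¹) ^ 3 + C.w * ((C.ζ y)⁻¹) ^ 3 * (C.ζ' y)⁻¹

/-- The Ricci scalar `Φ₁₁`. -/
def φ₁₁ (y : Pt) : ℂ := C.w * ((C.ζ y)⁻¹) ^ 2 * ((C.ζ' y)⁻¹) ^ 2 / 2

/-- The chart of `C` is defined and smooth on `V`, off the zeros of `P`, `Q` and `r² - c² x²`. -/
structure IsChart (V : Set Pt) : Prop where
  isOpen : IsOpen V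
  smooth_r : ContDiffOn ℝ ∞ C.r V
  smooth_x : ContDiffOn ℝ ∞ C.x V
  smooth_dx : ∀ i, ContDiffOn ℝ ∞ (fun y => C.dx y i) V
  smooth_vx : ∀ i, ContDiffOn ℝ ∞ (fun y => C.vx y i) V
  hasPd_r : ∀ y ∈ V, HasPd C.r y C.dr
  hasPd_x : ∀ y ∈ V, HasPd C.x y (C.dx y)
  dx_closed : ∀ y ∈ V, ∀ i k, pd i (fun z => C.dx z k) y = pd k (fun z => C.dx z i) y
  dual : ∀ y ∈ V, (Matrix.of ![C.dt, C.dφ, C.dx y, C.dr]) *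
    (Matrix.of ![C.vt, C.vφ, C.vx y, C.vr]).transpose = 1
  ζ_ne : ∀ y ∈ V, C.ζ y ≠ 0
  ζ'_ne : ∀ y ∈ V, C.ζ' y ≠ 0
  P_ne : ∀ y ∈ V, C.P y ≠ 0
  Q_ne : ∀ y ∈ V, C.Q y ≠ 0

/-- `f` has the partial derivatives `fr`, `fx` with respect to `r`, `x`. -/
def HasJet (f : Pt → ℂ) (y : Pt) (fr fx : ℂ) : Prop :=
  HasPd f y (fun i => fr * C.dr i + fx * C.dx y i)

variable {C} {f h : Pt → ℂ} {y : Pt} {fr fx hr hx : ℂ}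

theorem HasJet.add (hf : C.HasJet f y fr fx) (hh : C.HasJet h y hr hx) :
    C.HasJet (fun z => f z + h z) y (fr + hr) (fx + hx) :=
  (HasPd.add hf hh).congr_deriv fun i => by ring

theorem HasJet.sub (hf : C.HasJet f y fr fx) (hh : C.HasJet h y hr hx) :
    C.HasJet (fun z => f z - h z) y (fr - hr) (fx - hx) :=
  (HasPd.sub hf hh).congr_deriv fun i => by ring

theorem HasJet.neg (hf : C.HasJet f y fr fx) : C.HasJet (fun z => -f z) y (-fr) (-fx) :=
  (HasPd.neg hf).congr_deriv fun i => by ring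

theorem HasJet.mul (hf : C.HasJet f y fr fx) (hh : C.HasJet h y hr hx) :
    C.HasJet (fun z => f z * h z) y (fr * h y + f y * hr) (fx * h y + f y * hx) :=
  (HasPd.mul hf hh).congr_deriv fun i => by ring

theorem hasJet_const (z : ℂ) : C.HasJet (fun _ => z) y 0 0 :=
  (hasPd_const z).congr_deriv fun i => by ring

theorem HasJet.div_const (hf : C.HasJet f y fr fx) (z : ℂ) :
    C.HasJet (fun y => f y / z) y (fr / z) (fx / z) := by
  simp only [div_eq_mul_inv]
  exact (HasPd.mul hf (hasPd_const z⁻¹)).congr_deriv fun i => by ring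

/-- The exponent is written `n + 1` so that no subtraction of natural numbers occurs in the
derivative. -/
theorem HasJet.pow (hf : C.HasJet f y fr fx) (n : ℕ) :
    C.HasJet (fun z => f z ^ (n + 1)) y ((n + 1) * f y ^ n * fr) ((n + 1) * f y ^ n * fx) := by
  induction n with
  | zero => simpa using hf
  | succ n ih =>
    have := ih.mul hf
    simp only [← pow_succ] at this
    refine HasPd.congr_deriv this fun i => ?_
    push_cast
    ring

theorem HasJet.inv (hf : C.HasJet f y fr fx) (h0 : f y ≠ 0) :
    C.HasJet (fun z => (f z)⁻¹) y (-fr * (f y)⁻¹ ^ 2) (-fx * (f y)⁻¹ ^ 2) :=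
  (HasPd.inv hf h0).congr_deriv fun i => by field_simp; ring

theorem HasJet.congr (hf : C.HasJet f y fr fx) (h₁ : fr = hr) (h₂ : fx = hx) :
    C.HasJet f y hr hx := h₁ ▸ h₂ ▸ hf

namespace IsChart

variable {V : Set Pt} (H : C.IsChart V) (hy : y ∈ V)
include H hy

theorem jet_r : C.HasJet C.r y 1 0 := (H.hasPd_r y hy).congr_deriv fun i => by ring

theorem jet_x : C.HasJet C.x y 0 1 := (H.hasPd_x y hy).congr_deriv fun i => by ring

theorem jet_ζ : C.HasJet C.ζ y 1 C.c :=
  ((H.jet_r hy).add ((hasJet_const C.c).mul (H.jet_x hy))).congr (by ring) (by ring)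

theorem jet_ζ' : C.HasJet C.ζ' y 1 (-C.c) :=
  ((H.jet_r hy).sub ((hasJet_const C.c).mul (H.jet_x hy))).congr (by ring) (by ring)

theorem jet_A : C.HasJet C.A y 0 (2 * C.c * C.x y) :=
  (((hasJet_const C.c).mul ((H.jet_x hy).pow 1)).add (hasJet_const C.A₀)).congr
    (by ring) (by push_cast; ring)

theorem jet_B : C.HasJet C.B y (2 * C.r y) 0 :=
  (((H.jet_r hy).pow 1).add (hasJet_const (C.c * C.A₀))).congr (by push_cast; ring) (by ring)

theorem jet_P : C.HasJet C.P y 0 (C.P₁ y) :=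
  ((((hasJet_const C.p₀).add ((hasJet_const (2 * C.p₁)).mul (H.jet_x hy))).sub
    ((hasJet_const C.ε).mul ((H.jet_x hy).pow 1))).add
    ((hasJet_const (C.Λ / 3 * C.c ^ 2)).mul ((H.jet_x hy).pow 3))).congr
    (by ring) (by push_cast; rw [P₁]; ring)

theorem jet_P₁ : C.HasJet C.P₁ y 0 (C.P₂ y) :=
  (((hasJet_const (2 * C.p₁)).sub
    ((hasJet_const (2 * C.ε)).mul (H.jet_x hy))).add
    ((hasJet_const (4 * (C.Λ / 3) * C.c ^ 2)).mul ((H.jet_x hy).pow 2))).congr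
    (by ring) (by push_cast; rw [P₂]; ring)

theorem jet_Q : C.HasJet C.Q y (C.Q₁ y) 0 :=
  ((((hasJet_const (-C.c ^ 2 * C.p₀ + C.w)).sub ((hasJet_const (2 * C.m)).mul (H.jet_r hy))).add
    ((hasJet_const C.ε).mul ((H.jet_r hy).pow 1))).sub
    ((hasJet_const (C.Λ / 3)).mul ((H.jet_r hy).pow 3))).congr
    (by push_cast; rw [Q₁]; ring) (by ring)

theorem jet_Q₁ : C.HasJet C.Q₁ y (C.Q₂ y) 0 :=
  (((hasJet_const (-2 * C.m)).add
    ((hasJet_const (2 * C.ε)).mul (H.jet_r hy))).sub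
    ((hasJet_const (4 * (C.Λ / 3))).mul ((H.jet_r hy).pow 2))).congr
    (by push_cast; rw [Q₂]; ring) (by ring)

theorem jet_iζ : C.HasJet (fun z => (C.ζ z)⁻¹) y (-(C.ζ y)⁻¹ ^ 2) (-C.c * (C.ζ y)⁻¹ ^ 2) :=
  ((H.jet_ζ hy).inv (H.ζ_ne y hy)).congr (by ring) (by ring)

theorem jet_iζ' : C.HasJet (fun z => (C.ζ' z)⁻¹) y (-(C.ζ' y)⁻¹ ^ 2) (C.c * (C.ζ' y)⁻¹ ^ 2) :=
  ((H.jet_ζ' hy).inv (H.ζ'_ne y hy)).congr (by ring) (by ring)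

theorem jet_iP : C.HasJet (fun z => (C.P z)⁻¹) y 0 (-C.P₁ y * (C.P y)⁻¹ ^ 2) :=
  ((H.jet_P hy).inv (H.P_ne y hy)).congr (by ring) (by ring)

theorem jet_iQ : C.HasJet (fun z => (C.Q z)⁻¹) y (-C.Q₁ y * (C.Q y)⁻¹ ^ 2) 0 :=
  ((H.jet_Q hy).inv (H.Q_ne y hy)).congr (by ring) (by ring)

/-- `dt`, `dφ`, `dr` are constant and `dx` is closed, so only the coefficients are differentiated.
Each structure equation thereby becomes six identities between functions of `r` and `x`. -/
theorem extD_form {ft fφ fx fr : Pt → ℂ} {tr tx φr φx xr xx rr rx : ℂ}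
    (ht : C.HasJet ft y tr tx) (hφ : C.HasJet fφ y φr φx) (hx : C.HasJet fx y xr xx)
    (hr : C.HasJet fr y rr rx) (k l : Fin 4) :
    extD (C.form ft fφ fx fr) y k l = C.form2 y 0 (-tx) (-tr) (-φx) (-φr) (rx - xr) k l := by
  have hd : ∀ k, HasPd (fun z => C.dx z k) y (fun i => pd i (fun z => C.dx z k) y) := fun k =>
    hasPd_of_contDiffOn H.isOpen (H.smooth_dx k) hy
  have hF : ∀ k, HasPd (fun z => C.form ft fφ fx fr z k) y _ := fun k =>
    (((HasPd.mul ht (hasPd_const (C.dt k))).add (HasPd.mul hφ (hasPd_const (C.dφ k)))).add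
      (HasPd.mul hx (hd k))).add (HasPd.mul hr (hasPd_const (C.dr k)))
  rw [extD, (hF l).pd k, (hF k).pd l, H.dx_closed y hy k l]
  simp only [form2, wedge, Pi.add_apply, Pi.smul_apply, smul_eq_mul]
  ring

end IsChart

theorem wedge_form (ft fφ fx fr gt gφ gx gr : Pt → ℂ) (k l : Fin 4) :
    wedge (C.form ft fφ fx fr y) (C.form gt gφ gx gr y) k l =
      C.form2 y (ft y * gφ y - fφ y * gt y) (ft y * gx y - fx y * gt y)
        (ft y * gr y - fr y * gt y) (fφ y * gx y - fx y * gφ y) (fφ y * gr y - fr y * gφ y)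
        (fx y * gr y - fr y * gx y) k l := by
  simp only [form2, form, wedge, Pi.add_apply, Pi.smul_apply, smul_eq_mul]
  ring

theorem form_sub (ft fφ fx fr gt gφ gx gr : Pt → ℂ) :
    C.form ft fφ fx fr y - C.form gt gφ gx gr y = C.form (fun z => ft z - gt z)
      (fun z => fφ z - gφ z) (fun z => fx z - gx z) (fun z => fr z - gr z) y := by
  ext i
  simp only [form, Pi.sub_apply]
  ring

theorem form_add (ft fφ fx fr gt gφ gx gr : Pt → ℂ) :
    C.form ft fφ fx fr y + C.form gt gφ gx gr y = C.form (fun z => ft z + gt z)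
      (fun z => fφ z + gφ z) (fun z => fx z + gx z) (fun z => fr z + gr z) y := by
  ext i
  simp only [form, Pi.add_apply]
  ring

theorem form2_congr {a b c d e f a' b' c' d' e' f' : ℂ} (h₁ : a = a') (h₂ : b = b') (h₃ : c = c')
    (h₄ : d = d') (h₅ : e = e') (h₆ : f = f') (k l : Fin 4) :
    C.form2 y a b c d e f k l = C.form2 y a' b' c' d' e' f' k l := by
  rw [h₁, h₂, h₃, h₄, h₅, h₆]

theorem form2_add (a b c d e f a' b' c' d' e' f' : ℂ) (k l : Fin 4) :
    C.form2 y a b c d e f k l + C.form2 y a' b' c' d' e' f' k l =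
      C.form2 y (a + a') (b + b') (c + c') (d + d') (e + e') (f + f') k l := by
  simp only [form2, Pi.add_apply, Pi.smul_apply, smul_eq_mul]
  ring

theorem form2_sub (a b c d e f a' b' c' d' e' f' : ℂ) (k l : Fin 4) :
    C.form2 y a b c d e f k l - C.form2 y a' b' c' d' e' f' k l =
      C.form2 y (a - a') (b - b') (c - c') (d - d') (e - e') (f - f') k l := by
  simp only [form2, Pi.add_apply, Pi.smul_apply, smul_eq_mul]
  ring

theorem mul_form2 (z a b c d e f : ℂ) (k l : Fin 4) :
    z * C.form2 y a b c d e f k l =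
      C.form2 y (z * a) (z * b) (z * c) (z * d) (z * e) (z * f) k l := by
  simp only [form2, Pi.add_apply, Pi.smul_apply, smul_eq_mul]
  ring

theorem form2_zero (k l : Fin 4) : C.form2 y 0 0 0 0 0 0 k l = 0 := by
  simp [form2]

end Carter

/-! ### First structure equation and curvature scalars of the Carter coframe. -/

namespace Carter

variable {C : Carter} {y : Pt}

namespace IsChart

variable {V : Set Pt} (H : C.IsChart V) (hy : y ∈ V)
include H hy

theorem ζ_ne_zero : C.r y + C.c * C.x y ≠ 0 := H.ζ_ne y hy

theorem ζ'_ne_zero : C.r y - C.c * C.x y ≠ 0 := H.ζ'_ne y hy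

/-- The functions `P` and `Q` stay opaque here and in the three companions: torsion vanishes for any
structure functions, and their derivatives are accounted for by `a` and `b`. -/
theorem torsion_L (k l : Fin 4) : extD (C.coframe.θ 0) y k l +
    (wedge (C.coframe.a y) (C.coframe.θ 0 y) k l - wedge (C.coframe.ν₁ y) (C.coframe.θ 2 y) k l
      - wedge (C.coframe.ν₂ y) (C.coframe.θ 3 y) k l) = 0 := by
  have hz := H.ζ_ne_zero hy
  have hz' := H.ζ'_ne_zero hy
  have hP := H.P_ne y hy
  have hQ := H.Q_ne y hy
  have jz := H.jet_iζ hy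
  have jz' := H.jet_iζ' hy
  simp only [coframe, Matrix.cons_val]
  rw [H.extD_form hy ((((H.jet_Q hy).mul jz).mul jz').div_const 2)
    (((((H.jet_A hy).mul (H.jet_Q hy)).mul jz).mul jz').div_const 2) (hasJet_const 0)
    (hasJet_const _), wedge_form, wedge_form, wedge_form, form2_sub, form2_sub, form2_add]
  refine (form2_congr ?_ ?_ ?_ ?_ ?_ ?_ k l).trans (form2_zero k l) <;>
     simp only [ζ, ζ', A, B] <;> field_simp <;> ring

theorem torsion_N (k l : Fin 4) : extD (C.coframe.θ 1) y k l -
    (wedge (C.coframe.a y) (C.coframe.θ 1 y) k l + wedge (C.coframe.κ₁ y) (C.coframe.θ 2 y) k l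
      + wedge (C.coframe.κ₂ y) (C.coframe.θ 3 y) k l) = 0 := by
  have hz := H.ζ_ne_zero hy
  have hz' := H.ζ'_ne_zero hy
  have hP := H.P_ne y hy
  have hQ := H.Q_ne y hy
  simp only [coframe, Matrix.cons_val]
  rw [H.extD_form hy (hasJet_const 1) (H.jet_A hy) (hasJet_const 0)
    ((((H.jet_ζ hy).mul (H.jet_ζ' hy)).mul (H.jet_iQ hy)).neg),
    wedge_form, wedge_form, wedge_form, form2_add, form2_add, form2_sub]
  refine (form2_congr ?_ ?_ ?_ ?_ ?_ ?_ k l).trans (form2_zero k l) <;>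
     simp only [ζ, ζ', A, B] <;> field_simp <;> ring

theorem torsion_M (k l : Fin 4) : extD (C.coframe.θ 2) y k l -
    (wedge (C.coframe.κ₂ y) (C.coframe.θ 0 y) k l + wedge (C.coframe.ν₂ y) (C.coframe.θ 1 y) k l
      + wedge (C.coframe.b y) (C.coframe.θ 2 y) k l) = 0 := by
  have hz := H.ζ_ne_zero hy
  have hz' := H.ζ'_ne_zero hy
  have hP := H.P_ne y hy
  have hQ := H.Q_ne y hy
  have jz := H.jet_iζ hy
  have jz' := H.jet_iζ' hy
  simp only [coframe, Matrix.cons_val]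
  rw [H.extD_form hy
    ((((((hasJet_const C.c).mul (H.jet_P hy)).mul jz).mul jz').div_const 2).neg)
    ((((((H.jet_B hy).mul (H.jet_P hy)).mul jz).mul jz').div_const 2).neg) (hasJet_const (1 / 2))
    (hasJet_const _), wedge_form, wedge_form, wedge_form, form2_add, form2_add, form2_sub]
  refine (form2_congr ?_ ?_ ?_ ?_ ?_ ?_ k l).trans (form2_zero k l) <;>
     simp only [ζ, ζ', A, B] <;> field_simp <;> ring

theorem torsion_K (k l : Fin 4) : extD (C.coframe.θ 3) y k l +
    (wedge (C.coframe.b y) (C.coframe.θ 3 y) k l - wedge (C.coframe.κ₁ y) (C.coframe.θ 0 y) k l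
      - wedge (C.coframe.ν₁ y) (C.coframe.θ 1 y) k l) = 0 := by
  have hz := H.ζ_ne_zero hy
  have hz' := H.ζ'_ne_zero hy
  have hP := H.P_ne y hy
  have hQ := H.Q_ne y hy
  simp only [coframe, Matrix.cons_val]
  rw [H.extD_form hy (hasJet_const C.c) (H.jet_B hy)
    (((H.jet_ζ hy).mul (H.jet_ζ' hy)).mul (H.jet_iP hy)) (hasJet_const 0),
    wedge_form, wedge_form, wedge_form, form2_sub, form2_sub, form2_add]
  refine (form2_congr ?_ ?_ ?_ ?_ ?_ ?_ k l).trans (form2_zero k l) <;>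
     simp only [ζ, ζ', A, B] <;> field_simp <;> ring

theorem torsion (α i k : Fin 4) :
    (C.coframe.dΘ i y + C.coframe.conn i y * C.coframe.Θ y) α k =
      (C.coframe.dΘ k y + C.coframe.conn k y * C.coframe.Θ y) α i := by
  have h0 := H.torsion_L hy i k
  have h1 := H.torsion_N hy i k
  have h2 := H.torsion_M hy i k
  have h3 := H.torsion_K hy i k
  simp only [Matrix.add_apply, Matrix.mul_apply, CoframeData.dΘ, CoframeData.Θ, Matrix.of_apply,
    Fin.sum_univ_four, CoframeData.conn]
  simp only [extD, wedge] at h0 h1 h2 h3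
  fin_cases α <;> simp
  · linear_combination h0
  · linear_combination h1
  · linear_combination h2
  · linear_combination h3

omit hy in
theorem smooth_form {ft fφ fx fr : Pt → ℂ} (ht : ContDiffOn ℝ ∞ ft V) (hφ : ContDiffOn ℝ ∞ fφ V)
    (hx : ContDiffOn ℝ ∞ fx V) (hr : ContDiffOn ℝ ∞ fr V) (i : Fin 4) :
    ContDiffOn ℝ ∞ (fun z => C.form ft fφ fx fr z i) V :=
  (((ht.mul contDiffOn_const).add (hφ.mul contDiffOn_const)).add (hx.mul (H.smooth_dx i))).add
    (hr.mul contDiffOn_const)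

omit hy in
theorem smooth_vec {ft fφ fx fr : Pt → ℂ} (ht : ContDiffOn ℝ ∞ ft V) (hφ : ContDiffOn ℝ ∞ fφ V)
    (hx : ContDiffOn ℝ ∞ fx V) (hr : ContDiffOn ℝ ∞ fr V) (i : Fin 4) :
    ContDiffOn ℝ ∞ (fun z => C.vec ft fφ fx fr z i) V :=
  (((ht.mul contDiffOn_const).add (hφ.mul contDiffOn_const)).add (hx.mul (H.smooth_vx i))).add
    (hr.mul contDiffOn_const)

theorem form_vec (ft fφ fx fr vt vφ vx vr : Pt → ℂ) :
    ∑ i, C.form ft fφ fx fr y i * C.vec vt vφ vx vr y i =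
      ft y * vt y + fφ y * vφ y + fx y * vx y + fr y * vr y := by
  have hd : ∀ p q : Fin 4, ∑ i, (![C.dt, C.dφ, C.dx y, C.dr] p) i *
      (![C.vt, C.vφ, C.vx y, C.vr] q) i = (1 : Matrix (Fin 4) (Fin 4) ℂ) p q := by
    intro p q
    have := congrFun (congrFun (H.dual y hy) p) q
    rw [Matrix.mul_apply] at this
    exact this
  have e : ∀ i, C.form ft fφ fx fr y i = ∑ p, (![ft y, fφ y, fx y, fr y] p) *
      (![C.dt, C.dφ, C.dx y, C.dr] p) i := fun i => by
    simp [form, Fin.sum_univ_four]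
  have e' : ∀ i, C.vec vt vφ vx vr y i = ∑ q, (![vt y, vφ y, vx y, vr y] q) *
      (![C.vt, C.vφ, C.vx y, C.vr] q) i := fun i => by
    simp [vec, Fin.sum_univ_four]
  have e2 : ∑ i, C.form ft fφ fx fr y i * C.vec vt vφ vx vr y i =
      ∑ p, ∑ q, (![ft y, fφ y, fx y, fr y] p) * (![vt y, vφ y, vx y, vr y] q) *
        ∑ i, (![C.dt, C.dφ, C.dx y, C.dr] p) i * (![C.vt, C.vφ, C.vx y, C.vr] q) i := by
    simp only [e, e', Finset.sum_mul]
    simp only [Finset.mul_sum]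
    rw [Finset.sum_comm]
    refine Finset.sum_congr rfl fun p _ => ?_
    rw [Finset.sum_comm]
    exact Finset.sum_congr rfl fun q _ => Finset.sum_congr rfl fun i _ => by ring
  rw [e2]
  simp only [hd]
  simp [Fin.sum_univ_four]

/-- Apart from the duality of the coordinate forms and vectors, the relation behind it is `B - c A =
ζ ζ'`. -/
theorem dual_coframe : C.coframe.Θ y * C.coframe.F y = 1 := by
  have hz := H.ζ_ne_zero hy
  have hz' := H.ζ'_ne_zero hy
  have hP := H.P_ne y hy
  have hQ := H.Q_ne y hy
  ext α β
  rw [Matrix.mul_apply]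
  simp only [CoframeData.Θ, CoframeData.F, Matrix.of_apply, coframe]
  fin_cases α <;> fin_cases β <;> simp [H.form_vec hy] <;> simp only [ζ, ζ', A, B] <;>
    field_simp <;> ring

omit hy in
theorem isNullCoframe {g : MetricField}
    (hg : ∀ z ∈ V, metricM g z = (C.coframe.Θ z).transpose * eta * C.coframe.Θ z) :
    IsNullCoframe g V C.coframe := by
  have hr := H.smooth_r
  have hx := H.smooth_x
  have hP : ContDiffOn ℝ ∞ C.P V := by unfold P; fun_prop
  have hP₁ : ContDiffOn ℝ ∞ C.P₁ V := by unfold P₁; fun_prop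
  have hQ : ContDiffOn ℝ ∞ C.Q V := by unfold Q; fun_prop
  have hQ₁ : ContDiffOn ℝ ∞ C.Q₁ V := by unfold Q₁; fun_prop
  have hζ : ContDiffOn ℝ ∞ C.ζ V := by unfold ζ; fun_prop
  have hζ' : ContDiffOn ℝ ∞ C.ζ' V := by unfold ζ'; fun_prop
  have hA : ContDiffOn ℝ ∞ C.A V := by unfold A; fun_prop
  have hB : ContDiffOn ℝ ∞ C.B V := by unfold B; fun_prop
  have iP : ContDiffOn ℝ ∞ (fun z => (C.P z)⁻¹) V := hP.inv H.P_ne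
  have iQ : ContDiffOn ℝ ∞ (fun z => (C.Q z)⁻¹) V := hQ.inv H.Q_ne
  have iζ : ContDiffOn ℝ ∞ (fun z => (C.ζ z)⁻¹) V := hζ.inv H.ζ_ne
  have iζ' : ContDiffOn ℝ ∞ (fun z => (C.ζ' z)⁻¹) V := hζ'.inv H.ζ'_ne
  constructor
  · exact H.isOpen
  · intro α i
    fin_cases α <;> simp only [coframe] <;>
      exact H.smooth_form (by fun_prop) (by fun_prop) (by fun_prop) (by fun_prop) i
  · intro α i
    fin_cases α <;> simp only [coframe] <;>
      exact H.smooth_vec (by fun_prop) (by fun_prop) (by fun_prop) (by fun_prop) i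
  · exact fun i => H.smooth_form (by fun_prop) (by fun_prop) (by fun_prop) (by fun_prop) i
  · exact fun i => H.smooth_form (by fun_prop) (by fun_prop) (by fun_prop) (by fun_prop) i
  · exact fun i => H.smooth_form (by fun_prop) (by fun_prop) (by fun_prop) (by fun_prop) i
  · exact fun i => H.smooth_form (by fun_prop) (by fun_prop) (by fun_prop) (by fun_prop) i
  · exact fun i => H.smooth_form (by fun_prop) (by fun_prop) (by fun_prop) (by fun_prop) i
  · exact fun i => H.smooth_form (by fun_prop) (by fun_prop) (by fun_prop) (by fun_prop) i
  · exact fun z hz => H.dual_coframe hz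
  · exact hg
  · exact fun z hz α i k => H.torsion hz α i k

/-- The self-dual coefficients, for arbitrary structure functions. -/
theorem ψ_eq : -C.Λ / 3 - C.ψ y =
    (C.Q₁ y - C.c * C.P₁ y) * (C.ζ y)⁻¹ * (C.ζ' y)⁻¹ ^ 2 / 2
      - (C.Q y + C.c ^ 2 * C.P y) * (C.ζ y)⁻¹ * (C.ζ' y)⁻¹ ^ 3 := by
  have hz := H.ζ_ne_zero hy
  have hz' := H.ζ'_ne_zero hy
  simp only [ψ, ζ, ζ', P, Q, P₁, Q₁]
  field_simp
  ring

theorem ψ'_eq : -C.Λ / 3 - C.ψ' y =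
    (C.Q₁ y + C.c * C.P₁ y) * (C.ζ' y)⁻¹ * (C.ζ y)⁻¹ ^ 2 / 2
      - (C.Q y + C.c ^ 2 * C.P y) * (C.ζ' y)⁻¹ * (C.ζ y)⁻¹ ^ 3 := by
  have hz := H.ζ_ne_zero hy
  have hz' := H.ζ'_ne_zero hy
  simp only [ψ', ζ, ζ', P, Q, P₁, Q₁]
  field_simp
  ring

/-- This is the coefficient of `L ∧ N` in the third self-dual equation; `ψ_sub_φ` belongs to `M ∧
K`. The former involves `Q₂` but not `P₂`, the latter `P₂` but not `Q₂`. In this form `curvature₃`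
does not need the polynomials `P` and `Q` expanded. -/
theorem ψ_add_φ : -C.Λ / 3 + 2 * C.ψ y + 2 * C.φ₁₁ y =
    C.Q₂ y * (C.ζ y)⁻¹ * (C.ζ' y)⁻¹ / 2
      - (C.Q₁ y - C.c * C.P₁ y) / 2 * ((C.ζ y)⁻¹ ^ 2 * (C.ζ' y)⁻¹ + (C.ζ y)⁻¹ * (C.ζ' y)⁻¹ ^ 2)
      - C.Q₁ y * (C.ζ y)⁻¹ * (C.ζ' y)⁻¹ ^ 2 + (C.Q y + C.c ^ 2 * C.P y) *
        ((C.ζ y)⁻¹ ^ 2 * (C.ζ' y)⁻¹ ^ 2 + 2 * ((C.ζ y)⁻¹ * (C.ζ' y)⁻¹ ^ 3)) := by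
  have hz := H.ζ_ne_zero hy
  have hz' := H.ζ'_ne_zero hy
  simp only [ψ, φ₁₁, ζ, ζ', P, Q, P₁, Q₁, Q₂]
  field_simp
  ring

theorem ψ_sub_φ : -C.Λ / 3 + 2 * C.ψ y - 2 * C.φ₁₁ y =
    C.P₂ y * (C.ζ y)⁻¹ * (C.ζ' y)⁻¹ / 2
      + (C.Q₁ y - C.c * C.P₁ y) / 2 * ((C.ζ y)⁻¹ ^ 2 * (C.ζ' y)⁻¹ - (C.ζ y)⁻¹ * (C.ζ' y)⁻¹ ^ 2)
      + C.c * C.P₁ y * (C.ζ y)⁻¹ * (C.ζ' y)⁻¹ ^ 2 + (C.Q y + C.c ^ 2 * C.P y) *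
        (2 * ((C.ζ y)⁻¹ * (C.ζ' y)⁻¹ ^ 3) - (C.ζ y)⁻¹ ^ 2 * (C.ζ' y)⁻¹ ^ 2) := by
  have hz := H.ζ_ne_zero hy
  have hz' := H.ζ'_ne_zero hy
  simp only [ψ, φ₁₁, ζ, ζ', P, Q, P₁, Q₁, P₂]
  field_simp
  ring

theorem ψ'_add_φ : -C.Λ / 3 + 2 * C.ψ' y + 2 * C.φ₁₁ y =
    C.Q₂ y * (C.ζ y)⁻¹ * (C.ζ' y)⁻¹ / 2
      - (C.Q₁ y + C.c * C.P₁ y) / 2 * ((C.ζ' y)⁻¹ ^ 2 * (C.ζ y)⁻¹ + (C.ζ' y)⁻¹ * (C.ζ y)⁻¹ ^ 2)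
      - C.Q₁ y * (C.ζ' y)⁻¹ * (C.ζ y)⁻¹ ^ 2 + (C.Q y + C.c ^ 2 * C.P y) *
        ((C.ζ y)⁻¹ ^ 2 * (C.ζ' y)⁻¹ ^ 2 + 2 * ((C.ζ' y)⁻¹ * (C.ζ y)⁻¹ ^ 3)) := by
  have hz := H.ζ_ne_zero hy
  have hz' := H.ζ'_ne_zero hy
  simp only [ψ', φ₁₁, ζ, ζ', P, Q, P₁, Q₁, Q₂]
  field_simp
  ring

theorem ψ'_sub_φ : -C.Λ / 3 + 2 * C.ψ' y - 2 * C.φ₁₁ y =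
    C.P₂ y * (C.ζ y)⁻¹ * (C.ζ' y)⁻¹ / 2
      + (C.Q₁ y + C.c * C.P₁ y) / 2 * ((C.ζ' y)⁻¹ ^ 2 * (C.ζ y)⁻¹ - (C.ζ' y)⁻¹ * (C.ζ y)⁻¹ ^ 2)
      - C.c * C.P₁ y * (C.ζ' y)⁻¹ * (C.ζ y)⁻¹ ^ 2 + (C.Q y + C.c ^ 2 * C.P y) *
        (2 * ((C.ζ' y)⁻¹ * (C.ζ y)⁻¹ ^ 3) - (C.ζ y)⁻¹ ^ 2 * (C.ζ' y)⁻¹ ^ 2) := by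
  have hz := H.ζ_ne_zero hy
  have hz' := H.ζ'_ne_zero hy
  simp only [ψ', φ₁₁, ζ, ζ', P, Q, P₁, Q₁, P₂]
  field_simp
  ring

end IsChart

end Carter

/-! ### Second structure equation: the curvature forms of the Carter coframe. -/

namespace Carter

variable {C : Carter} {y : Pt}

namespace IsChart

variable {V : Set Pt} (H : C.IsChart V) (hy : y ∈ V)
include H hy

/-- After `ψ_eq` both sides involve only `P`, `Q` and their first derivatives, and the six
coefficients are compared as rational expressions in these symbols. -/
theorem curvature_sd₁ (k l : Fin 4) : extD C.coframe.ν₂ y k l +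
    wedge (C.coframe.a y - C.coframe.b y) (C.coframe.ν₂ y) k l =
      (-C.Λ / 3 - C.ψ y) * (C.coframe.sd y).X₂ k l := by
  have hz := H.ζ_ne_zero hy
  have hz' := H.ζ'_ne_zero hy
  have hP := H.P_ne y hy
  have hQ := H.Q_ne y hy
  have jz := H.jet_iζ hy
  have jz' := H.jet_iζ' hy
  rw [H.ψ_eq hy]
  simp only [CoframeData.sd, coframe, Matrix.cons_val]
  rw [H.extD_form hy (hasJet_const 0)
    ((((((H.jet_P hy).mul (H.jet_Q hy)).mul jz).mul (jz'.mul jz')).div_const 4).neg)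
    ((((H.jet_Q hy).mul jz).mul (jz'.mul jz')).div_const 4)
    (((((hasJet_const C.c).mul (H.jet_P hy)).mul jz).mul (jz'.mul jz')).div_const 4),
    form_sub, wedge_form, wedge_form, form2_add, mul_form2]
  refine form2_congr ?_ ?_ ?_ ?_ ?_ ?_ k l <;> simp only [ζ, ζ', A, B] <;> field_simp <;> ring

theorem curvature_sd₂ (k l : Fin 4) : extD C.coframe.κ₁ y k l -
    wedge (C.coframe.a y - C.coframe.b y) (C.coframe.κ₁ y) k l =
      (-C.Λ / 3 - C.ψ y) * (C.coframe.sd y).X₁ k l := by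
  have hz := H.ζ_ne_zero hy
  have hz' := H.ζ'_ne_zero hy
  have hP := H.P_ne y hy
  have hQ := H.Q_ne y hy
  rw [H.ψ_eq hy]
  simp only [CoframeData.sd, coframe, Matrix.cons_val]
  rw [H.extD_form hy (hasJet_const 0) (H.jet_ζ hy).neg ((H.jet_ζ hy).mul (H.jet_iP hy)).neg
    (((hasJet_const C.c).mul (H.jet_ζ hy)).mul (H.jet_iQ hy)).neg,
    form_sub, wedge_form, wedge_form, form2_sub, mul_form2]
  refine form2_congr ?_ ?_ ?_ ?_ ?_ ?_ k l <;> simp only [ζ, ζ', A, B] <;> field_simp <;> ring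

theorem curvature_asd₁ (k l : Fin 4) : extD C.coframe.ν₁ y k l +
    wedge (C.coframe.a y + C.coframe.b y) (C.coframe.ν₁ y) k l =
      (-C.Λ / 3 - C.ψ' y) * (C.coframe.asd y).X₂ k l := by
  have hz := H.ζ_ne_zero hy
  have hz' := H.ζ'_ne_zero hy
  have hP := H.P_ne y hy
  have hQ := H.Q_ne y hy
  have jz := H.jet_iζ hy
  rw [H.ψ'_eq hy]
  simp only [CoframeData.asd, coframe, Matrix.cons_val]
  rw [H.extD_form hy (hasJet_const 0) (((H.jet_Q hy).mul jz).div_const 2)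
    ((((H.jet_Q hy).mul (H.jet_iP hy)).mul jz).div_const 2)
    ((((hasJet_const C.c).mul jz).div_const 2).neg),
    form_add, wedge_form, wedge_form, form2_add, mul_form2]
  refine form2_congr ?_ ?_ ?_ ?_ ?_ ?_ k l <;> simp only [ζ, ζ', A, B] <;> field_simp <;> ring

theorem curvature_asd₂ (k l : Fin 4) : extD C.coframe.κ₂ y k l -
    wedge (C.coframe.a y + C.coframe.b y) (C.coframe.κ₂ y) k l =
      (-C.Λ / 3 - C.ψ' y) * (C.coframe.asd y).X₁ k l := by
  have hz := H.ζ_ne_zero hy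
  have hz' := H.ζ'_ne_zero hy
  have hP := H.P_ne y hy
  have hQ := H.Q_ne y hy
  have jz := H.jet_iζ hy
  rw [H.ψ'_eq hy]
  simp only [CoframeData.asd, coframe, Matrix.cons_val]
  rw [H.extD_form hy (hasJet_const 0) (((H.jet_P hy).mul jz).div_const 2) (jz.div_const 2).neg
    (((((hasJet_const C.c).mul (H.jet_P hy)).mul jz).mul (H.jet_iQ hy)).div_const 2),
    form_add, wedge_form, wedge_form, form2_sub, mul_form2]
  refine form2_congr ?_ ?_ ?_ ?_ ?_ ?_ k l <;> simp only [ζ, ζ', A, B] <;> field_simp <;> ring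

theorem curvature₃ (k l : Fin 4) :
    extD C.coframe.a y k l - extD C.coframe.b y k l -
      2 * wedge (C.coframe.κ₁ y) (C.coframe.ν₂ y) k l =
        (-C.Λ / 3 + 2 * C.ψ y) * (C.coframe.sd y).X₃ k l
          + 2 * C.φ₁₁ y * (C.coframe.asd y).X₃ k l ∧
    extD C.coframe.a y k l + extD C.coframe.b y k l -
      2 * wedge (C.coframe.κ₂ y) (C.coframe.ν₁ y) k l =
        (-C.Λ / 3 + 2 * C.ψ' y) * (C.coframe.asd y).X₃ k l
          + 2 * C.φ₁₁ y * (C.coframe.sd y).X₃ k l := by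
  have hz := H.ζ_ne_zero hy
  have hz' := H.ζ'_ne_zero hy
  have hP := H.P_ne y hy
  have hQ := H.Q_ne y hy
  have jS := (H.jet_iζ hy).mul (H.jet_iζ' hy)
  have jc : C.HasJet (fun _ => C.c) y 0 0 := hasJet_const C.c
  have jF := (((H.jet_A hy).mul (H.jet_Q hy)).add ((jc.mul (H.jet_B hy)).mul (H.jet_P hy)))
  have jG := ((H.jet_Q hy).add ((hasJet_const (C.c ^ 2)).mul (H.jet_P hy)))
  have ha := H.extD_form hy
    ((((H.jet_Q₁ hy).mul jS).div_const 2).sub ((((H.jet_r hy).mul jG).mul jS).mul jS))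
    (((H.jet_A hy).mul (((H.jet_Q₁ hy).mul jS).div_const 2)).sub
      ((((H.jet_r hy).mul jF).mul jS).mul jS))
    (((hasJet_const (C.c ^ 2)).mul (H.jet_x hy)).mul jS).neg
    (((H.jet_r hy).mul jS).sub (((H.jet_Q₁ hy).mul (H.jet_iQ hy)).div_const 2)) k l
  have hb := H.extD_form hy
    ((((jc.mul (H.jet_P₁ hy)).mul jS).div_const 2).add
      ((((jc.mul (H.jet_x hy)).mul jG).mul jS).mul jS))
    (((H.jet_B hy).mul (((H.jet_P₁ hy).mul jS).div_const 2)).add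
      ((((jc.mul (H.jet_x hy)).mul jF).mul jS).mul jS))
    ((((H.jet_P₁ hy).mul (H.jet_iP hy)).div_const 2).add
      (((hasJet_const (C.c ^ 2)).mul (H.jet_x hy)).mul jS))
    ((H.jet_r hy).mul jS).neg k l
  have e : (-C.Λ / 3 + 2 * C.ψ y) * (C.coframe.sd y).X₃ k l
        + 2 * C.φ₁₁ y * (C.coframe.asd y).X₃ k l =
      (-C.Λ / 3 + 2 * C.ψ y + 2 * C.φ₁₁ y) * wedge (C.coframe.θ 0 y) (C.coframe.θ 1 y) k l
      - (-C.Λ / 3 + 2 * C.ψ y - 2 * C.φ₁₁ y) *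
        wedge (C.coframe.θ 2 y) (C.coframe.θ 3 y) k l := by
    simp only [CoframeData.sd, CoframeData.asd, Pi.add_apply, Pi.sub_apply]
    ring
  have e' : (-C.Λ / 3 + 2 * C.ψ' y) * (C.coframe.asd y).X₃ k l
        + 2 * C.φ₁₁ y * (C.coframe.sd y).X₃ k l =
      (-C.Λ / 3 + 2 * C.ψ' y + 2 * C.φ₁₁ y) * wedge (C.coframe.θ 0 y) (C.coframe.θ 1 y) k l
      + (-C.Λ / 3 + 2 * C.ψ' y - 2 * C.φ₁₁ y) *
        wedge (C.coframe.θ 2 y) (C.coframe.θ 3 y) k l := by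
    simp only [CoframeData.sd, CoframeData.asd, Pi.add_apply, Pi.sub_apply]
    ring
  rw [e, e', H.ψ_add_φ hy, H.ψ_sub_φ hy, H.ψ'_add_φ hy, H.ψ'_sub_φ hy]
  simp only [coframe, Matrix.cons_val]
  rw [ha, hb]
  constructor
  · rw [wedge_form, wedge_form, wedge_form, mul_form2, mul_form2, mul_form2, form2_sub, form2_sub,
      form2_sub]
    refine form2_congr ?_ ?_ ?_ ?_ ?_ ?_ k l <;> simp only [ζ, ζ', A, B] <;> field_simp <;> ring
  · rw [wedge_form, wedge_form, wedge_form, mul_form2, mul_form2, mul_form2, form2_add, form2_sub,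
      form2_add]
    refine form2_congr ?_ ?_ ?_ ?_ ?_ ?_ k l <;> simp only [ζ, ζ', A, B] <;> field_simp <;> ring

omit hy in
theorem hasTypeDCurvature : HasTypeDCurvature V C.coframe C.ψ C.ψ' C.φ₁₁ C.Λ where
  sd₁ _ hx k l := H.curvature_sd₁ hx k l
  sd₂ _ hx k l := H.curvature_sd₂ hx k l
  sd₃ _ hx k l := (H.curvature₃ hx k l).1
  asd₁ _ hx k l := H.curvature_asd₁ hx k l
  asd₂ _ hx k l := H.curvature_asd₂ hx k l
  asd₃ _ hx k l := (H.curvature₃ hx k l).2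

end IsChart

end Carter

/-! ### Evaluation of tensors on vectors -/

section Evaluation

/-- `u_i v^i`. -/
def ev (u v : Fin 4 → ℂ) : ℂ := ∑ i, u i * v i

/-- `X_{ab} u^a v^b`. -/
def ev2 (X : T2) (u v : Fin 4 → ℂ) : ℂ := ∑ a, ∑ b, X a b * u a * v b

/-- `T_{abkl} u^a v^b w^k z^l`. -/
def ev4 (T : T4) (u v w z : Fin 4 → ℂ) : ℂ :=
  ∑ a, ∑ b, ∑ k, ∑ l, T a b k l * u a * v b * w k * z l

theorem ev2_simple (p q u v : Fin 4 → ℂ) :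
    ev2 (fun a b => p a * q b) u v = ev p u * ev q v := by
  simp only [ev2, ev, Finset.sum_mul]
  simp only [Finset.mul_sum]
  exact Finset.sum_congr rfl fun _ _ => Finset.sum_congr rfl fun _ _ => by ring

theorem ev2_add (X Y : T2) (u v : Fin 4 → ℂ) : ev2 (X + Y) u v = ev2 X u v + ev2 Y u v := by
  simp only [ev2, Pi.add_apply, add_mul, Finset.sum_add_distrib]

theorem ev2_sub (X Y : T2) (u v : Fin 4 → ℂ) : ev2 (X - Y) u v = ev2 X u v - ev2 Y u v := by
  simp only [ev2, Pi.sub_apply, sub_mul, Finset.sum_sub_distrib]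

theorem ev2_wedge (p q u v : Fin 4 → ℂ) :
    ev2 (wedge p q) u v = ev p u * ev q v - ev q u * ev p v := by
  rw [show wedge p q = (fun a b => p a * q b) - fun a b => q a * p b from rfl, ev2_sub,
    ev2_simple, ev2_simple]

theorem ev4_add (X Y : T4) (u v w z : Fin 4 → ℂ) :
    ev4 (X + Y) u v w z = ev4 X u v w z + ev4 Y u v w z := by
  simp only [ev4, Pi.add_apply, add_mul, Finset.sum_add_distrib]

theorem ev4_sub (X Y : T4) (u v w z : Fin 4 → ℂ) :
    ev4 (X - Y) u v w z = ev4 X u v w z - ev4 Y u v w z := by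
  simp only [ev4, Pi.sub_apply, sub_mul, Finset.sum_sub_distrib]

theorem ev4_smul (s : ℂ) (X : T4) (u v w z : Fin 4 → ℂ) :
    ev4 (s • X) u v w z = s * ev4 X u v w z := by
  simp only [ev4, Pi.smul_apply, smul_eq_mul, Finset.mul_sum]
  exact Finset.sum_congr rfl fun _ _ => Finset.sum_congr rfl fun _ _ =>
    Finset.sum_congr rfl fun _ _ => Finset.sum_congr rfl fun _ _ => by ring

theorem ev4_tens (X Y : T2) (u v w z : Fin 4 → ℂ) :
    ev4 (tens X Y) u v w z = ev2 X u v * ev2 Y w z := by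
  simp only [ev4, ev2, tens, Finset.sum_mul]
  simp only [Finset.mul_sum]
  exact Finset.sum_congr rfl fun _ _ => Finset.sum_congr rfl fun _ _ =>
    Finset.sum_congr rfl fun _ _ => Finset.sum_congr rfl fun _ _ => by ring

theorem ev_conj (u v : Fin 4 → ℂ) : conj (ev u v) = ev (fun i => conj (u i)) fun i => conj (v i) := by
  simp [ev, map_sum]

end Evaluation

/-! ### Tetrads relative to a null coframe -/

namespace CoframeData

/-- The components of a vector in the frame. -/
def cmp (c : CoframeData) (x : Pt) (v : Fin 4 → ℂ) (α : Fin 4) : ℂ := ev (c.θ α x) v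

/-- The coframe is adapted to the real structure: `L`, `N` are real, `K` is conjugate to `M` up to
a positive factor. -/
def IsReal (c : CoframeData) (V : Set Pt) : Prop :=
  ∀ x ∈ V, (∀ i, conj (c.θ 0 x i) = c.θ 0 x i) ∧ (∀ i, conj (c.θ 1 x i) = c.θ 1 x i) ∧
    ∃ s : ℝ, 0 < s ∧ ∀ i, conj (c.θ 2 x i) = s * c.θ 3 x i

end CoframeData

namespace IsNullCoframe

variable {g : MetricField} {V : Set Pt} {c : CoframeData} (h : IsNullCoframe g V c) {x : Pt}
include h

theorem metricC_eq (hx : x ∈ V) (u v : Fin 4 → ℂ) : metricC g x u v =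
    -(c.cmp x u 0 * c.cmp x v 1 + c.cmp x u 1 * c.cmp x v 0)
      + (c.cmp x u 2 * c.cmp x v 3 + c.cmp x u 3 * c.cmp x v 2) := by
  have e : metricC g x u v = ev2 ((fun a b => c.θ 2 x a * c.θ 3 x b)
      + (fun a b => c.θ 3 x a * c.θ 2 x b) - (fun a b => c.θ 0 x a * c.θ 1 x b)
      - (fun a b => c.θ 1 x a * c.θ 0 x b)) u v := by
    simp only [metricC, ev2]
    refine Finset.sum_congr rfl fun a _ => Finset.sum_congr rfl fun b _ => ?_
    rw [h.metric_eq hx]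
    simp only [Pi.add_apply, Pi.sub_apply]
    ring
  rw [e, ev2_sub, ev2_sub, ev2_add, ev2_simple, ev2_simple, ev2_simple, ev2_simple]
  simp only [CoframeData.cmp]
  ring

theorem cmp_frame (hx : x ∈ V) (u : Fin 4 → ℂ) (i : Fin 4) :
    u i = ∑ α, c.cmp x u α * c.E α x i := by
  have := congrFun (congrArg (fun A => A.mulVec u) (h.dual' hx)) i
  simp only [Matrix.one_mulVec, ← Matrix.mulVec_mulVec] at this
  rw [← this, Matrix.mulVec, dotProduct]
  exact Finset.sum_congr rfl fun α _ => mul_comm _ _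

variable {ψ ψ' φ : Pt → ℂ} {Λ : ℂ} (hc : HasTypeDCurvature V c ψ ψ' φ Λ)

include hc in
theorem weylC_eq (hx : x ∈ V) (u v w z : Fin 4 → ℂ) : weylC g x u v w z =
    ψ x * (ev2 (c.sd x).X₃ u v * ev2 (c.sd x).X₃ w z - ev2 (c.sd x).X₁ u v * ev2 (c.sd x).X₂ w z
      - ev2 (c.sd x).X₂ u v * ev2 (c.sd x).X₁ w z)
    + ψ' x * (ev2 (c.asd x).X₃ u v * ev2 (c.asd x).X₃ w z
      - ev2 (c.asd x).X₁ u v * ev2 (c.asd x).X₂ w z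
      - ev2 (c.asd x).X₂ u v * ev2 (c.asd x).X₁ w z) := by
  have e : weylC g x u v w z = ev4 (ψ x • (c.sd x).weylD + ψ' x • (c.asd x).weylD) u v w z := by
    simp only [weylC, ev4]
    refine Finset.sum_congr rfl fun a _ => Finset.sum_congr rfl fun b _ =>
      Finset.sum_congr rfl fun k _ => Finset.sum_congr rfl fun l _ => ?_
    rw [h.weyl_eq hc hx]
  rw [e, ev4_add, ev4_smul, ev4_smul]
  simp only [BivTriple.weylD, ev4_sub, ev4_tens]

include hc in
theorem ricciC_eq (hx : x ∈ V) (u v : Fin 4 → ℂ) : ricciC g x u v =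
    Λ * metricC g x u v + 2 * φ x * (c.cmp x u 0 * c.cmp x v 1 + c.cmp x u 1 * c.cmp x v 0
      + (c.cmp x u 2 * c.cmp x v 3 + c.cmp x u 3 * c.cmp x v 2)) := by
  have e : ricciC g x u v = Λ * metricC g x u v + 2 * φ x * ev2
      ((fun a b => c.θ 0 x a * c.θ 1 x b) + (fun a b => c.θ 1 x a * c.θ 0 x b)
      + (fun a b => c.θ 2 x a * c.θ 3 x b) + (fun a b => c.θ 3 x a * c.θ 2 x b)) u v := by
    simp only [metricC, ev2, ricciC, Finset.mul_sum, ← Finset.sum_add_distrib]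
    refine Finset.sum_congr rfl fun a _ => Finset.sum_congr rfl fun b _ => ?_
    rw [h.ricci_eq hc hx]
    simp only [Pi.add_apply]
    ring
  rw [e, ev2_add, ev2_add, ev2_add, ev2_simple, ev2_simple, ev2_simple, ev2_simple]
  simp only [CoframeData.cmp]
  ring

omit h in
theorem volC_eq {o : ℤˣ} (ho : c.IsOriented g o V) (hx : x ∈ V) (u v w z : Fin 4 → ℂ) :
    volC g o x u v w z = -Complex.I *
      (-(ev2 (c.sd x).X₂ u v * ev2 (c.sd x).X₁ w z) - ev2 (c.sd x).X₁ u v * ev2 (c.sd x).X₂ w z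
        - ev2 (c.sd x).X₃ u v * ev2 (c.sd x).X₃ w z / 2
        + ev2 (c.asd x).X₂ u v * ev2 (c.asd x).X₁ w z
        + ev2 (c.asd x).X₁ u v * ev2 (c.asd x).X₂ w z
        + ev2 (c.asd x).X₃ u v * ev2 (c.asd x).X₃ w z / 2) := by
  have e : volC g o x u v w z = ev4 (-Complex.I • ((-1 : ℂ) • tens (c.sd x).X₂ (c.sd x).X₁
      - tens (c.sd x).X₁ (c.sd x).X₂ - (1 / 2 : ℂ) • tens (c.sd x).X₃ (c.sd x).X₃
      + tens (c.asd x).X₂ (c.asd x).X₁ + tens (c.asd x).X₁ (c.asd x).X₂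
      + (1 / 2 : ℂ) • tens (c.asd x).X₃ (c.asd x).X₃)) u v w z := by
    simp only [volC, ev4]
    refine Finset.sum_congr rfl fun a _ => Finset.sum_congr rfl fun b _ =>
      Finset.sum_congr rfl fun k _ => Finset.sum_congr rfl fun l _ => ?_
    rw [show (volForm g o x a b k l : ℂ) = _ from
      congrFun (congrFun (ho.volForm_eq hx a b) k) l]
    simp only [tens, Pi.add_apply, Pi.smul_apply, Pi.sub_apply, smul_eq_mul]
    ring
  rw [e]
  simp only [ev4_smul, ev4_add, ev4_sub, ev4_tens]
  ring

end IsNullCoframe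

namespace CoframeData

variable (c : CoframeData) (x : Pt) (u v : Fin 4 → ℂ)

theorem ev2_sd₁ : ev2 (c.sd x).X₁ u v =
    c.cmp x u 1 * c.cmp x v 3 - c.cmp x u 3 * c.cmp x v 1 := ev2_wedge _ _ _ _

theorem ev2_sd₂ : ev2 (c.sd x).X₂ u v =
    c.cmp x u 0 * c.cmp x v 2 - c.cmp x u 2 * c.cmp x v 0 := ev2_wedge _ _ _ _

theorem ev2_sd₃ : ev2 (c.sd x).X₃ u v =
    c.cmp x u 0 * c.cmp x v 1 - c.cmp x u 1 * c.cmp x v 0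
      - (c.cmp x u 2 * c.cmp x v 3 - c.cmp x u 3 * c.cmp x v 2) := by
  rw [sd, ev2_sub, ev2_wedge, ev2_wedge]
  rfl

theorem ev2_asd₁ : ev2 (c.asd x).X₁ u v =
    c.cmp x u 1 * c.cmp x v 2 - c.cmp x u 2 * c.cmp x v 1 := ev2_wedge _ _ _ _

theorem ev2_asd₂ : ev2 (c.asd x).X₂ u v =
    c.cmp x u 0 * c.cmp x v 3 - c.cmp x u 3 * c.cmp x v 0 := ev2_wedge _ _ _ _

theorem ev2_asd₃ : ev2 (c.asd x).X₃ u v =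
    c.cmp x u 0 * c.cmp x v 1 - c.cmp x u 1 * c.cmp x v 0
      + (c.cmp x u 2 * c.cmp x v 3 - c.cmp x u 3 * c.cmp x v 2) := by
  rw [asd, ev2_add, ev2_wedge, ev2_wedge]
  rfl

end CoframeData

/-! ### Uniqueness of the principal null directions -/

/-- A null vector `l` with `Ψ₀ = 0` is a multiple of `L` or `N`. -/
theorem principal_direction {l n m m' : Fin 4 → ℂ} {ψ ψ' : ℂ} (hψ : ψ ≠ 0)
    (hl : l 2 = 0 ↔ l 3 = 0)
    (ll : -(l 0 * l 1 + l 1 * l 0) + (l 2 * l 3 + l 3 * l 2) = 0)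
    (lm : -(l 0 * m 1 + l 1 * m 0) + (l 2 * m 3 + l 3 * m 2) = 0)
    (mm : -(m 0 * m 1 + m 1 * m 0) + (m 2 * m 3 + m 3 * m 2) = 0)
    (x1 : (l 0 * m 2 - l 2 * m 0) * (n 1 * m' 3 - n 3 * m' 1)
      + (l 1 * m 3 - l 3 * m 1) * (n 0 * m' 2 - n 2 * m' 0)
      + (l 0 * m 1 - l 1 * m 0 - (l 2 * m 3 - l 3 * m 2)) *
        (n 0 * m' 1 - n 1 * m' 0 - (n 2 * m' 3 - n 3 * m' 2)) / 2 = 1)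
    (h0 : ψ * ((l 0 * m 1 - l 1 * m 0 - (l 2 * m 3 - l 3 * m 2)) ^ 2
        - 2 * ((l 1 * m 3 - l 3 * m 1) * (l 0 * m 2 - l 2 * m 0)))
      + ψ' * ((l 0 * m 1 - l 1 * m 0 + (l 2 * m 3 - l 3 * m 2)) ^ 2
        - 2 * ((l 1 * m 2 - l 2 * m 1) * (l 0 * m 3 - l 3 * m 0))) = 0) :
    (l 1 = 0 ∧ l 2 = 0 ∧ l 3 = 0) ∨ (l 0 = 0 ∧ l 2 = 0 ∧ l 3 = 0) := by
  have ll' : l 0 * l 1 = l 2 * l 3 := by linear_combination -(1 / 2) * ll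
  have mm' : m 0 * m 1 = m 2 * m 3 := by linear_combination -(1 / 2) * mm
  by_cases hl0 : l 0 = 0
  · right
    have : l 2 * l 3 = 0 := by rw [← ll', hl0, zero_mul]
    rcases mul_eq_zero.mp this with h2 | h3
    · exact ⟨hl0, h2, hl.mp h2⟩
    · exact ⟨hl0, hl.mpr h3, h3⟩
  · left
    -- By `x1` the self-dual part of `l ∧ m` is nonzero; since `l` and `m` are null and orthogonal,
    -- all three of its components would vanish together with this one.
    have hX2 : l 0 * m 2 - l 2 * m 0 ≠ 0 := by
      intro hX
      have e1 : l 0 * (l 0 * m 1 - l 2 * m 3) = 0 := by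
        linear_combination -l 0 * lm - m 0 * ll' + l 3 * hX
      have e2 : l 0 * m 1 - l 2 * m 3 = 0 := (mul_eq_zero.mp e1).resolve_left hl0
      have e3 : l 0 * m 1 - l 1 * m 0 - (l 2 * m 3 - l 3 * m 2) = 0 := by
        linear_combination lm + 2 * e2
      have e4 : l 0 * (l 1 * m 3 - l 3 * m 1) = 0 := by
        linear_combination m 3 * ll' - l 3 * e2
      have e5 := (mul_eq_zero.mp e4).resolve_left hl0
      rw [hX, e3, e5] at x1
      norm_num at x1
    -- A totally null plane is either self-dual or anti-self-dual. As the self-dual part is nonzero,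
    -- the anti-self-dual part of `l ∧ m` vanishes, and `ψ'` drops out of `h0`.
    have e1 : (l 0 * m 2 - l 2 * m 0) * (l 0 * m 3 - l 3 * m 0) = 0 := by
      linear_combination -l 0 ^ 2 * mm' - l 0 * m 0 * lm - m 0 ^ 2 * ll'
    have hY2 := (mul_eq_zero.mp e1).resolve_left hX2
    have e2 : l 0 * (l 0 * m 1 - l 3 * m 2) = 0 := by
      linear_combination -l 0 * lm - m 0 * ll' + l 2 * hY2
    have e3 := (mul_eq_zero.mp e2).resolve_left hl0
    have hY3 : l 0 * m 1 - l 1 * m 0 + (l 2 * m 3 - l 3 * m 2) = 0 := by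
      linear_combination lm + 2 * e3
    have hX3 : l 0 * (l 0 * m 1 - l 1 * m 0 - (l 2 * m 3 - l 3 * m 2)) =
        2 * l 3 * (l 0 * m 2 - l 2 * m 0) := by
      linear_combination 2 * l 0 * e3 - l 0 * hY3 - 2 * m 0 * ll'
    have hX1 : l 0 ^ 2 * (l 1 * m 3 - l 3 * m 1) = -l 3 ^ 2 * (l 0 * m 2 - l 2 * m 0) := by
      linear_combination l 0 * m 3 * ll' - l 0 * l 3 * e3 + l 2 * l 3 * hY2
    -- Write `X₂ = l 0 * m 2 - l 2 * m 0`. The other two self-dual components are `X₂` times `2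
    -- l₃/l₀` and `-(l₃/l₀)²`, so `Ψ₀ = (4 + 2) ψ (l₃/l₀)² X₂²`.
    have e4 : ψ * (6 * l 3 ^ 2 * (l 0 * m 2 - l 2 * m 0) ^ 2) = 0 := by
      linear_combination l 0 ^ 2 * h0 - l 0 ^ 2 * ψ' *
        (l 0 * m 1 - l 1 * m 0 + (l 2 * m 3 - l 3 * m 2)) * hY3
        + 2 * l 0 ^ 2 * ψ' * (l 1 * m 2 - l 2 * m 1) * hY2
        + 2 * ψ * (l 0 * m 2 - l 2 * m 0) * hX1
        - ψ * (l 0 * (l 0 * m 1 - l 1 * m 0 - (l 2 * m 3 - l 3 * m 2))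
          + 2 * l 3 * (l 0 * m 2 - l 2 * m 0)) * hX3
    have h3 : l 3 = 0 := by
      by_contra h3
      exact mul_ne_zero hψ (mul_ne_zero (mul_ne_zero (by norm_num) (pow_ne_zero 2 h3))
        (pow_ne_zero 2 hX2)) e4
    refine ⟨?_, hl.mpr h3, h3⟩
    have : l 0 * l 1 = 0 := by rw [ll', h3, mul_zero]
    exact (mul_eq_zero.mp this).resolve_left hl0

/-! ### Alignment of type D frames with a null coframe -/

/-- Null tetrad components with `Ψ₀ = Ψ₄ = 0` are those of the frame `(L, N, M, K)`, or of
`(N, L, K, M)`, up to scale. -/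
theorem aligned_of_principal {l n m k : Fin 4 → ℂ} {ψ ψ' : ℂ} (hψ : ψ ≠ 0)
    (hl : l 2 = 0 ↔ l 3 = 0) (hn : n 2 = 0 ↔ n 3 = 0)
    (ll : -(l 0 * l 1 + l 1 * l 0) + (l 2 * l 3 + l 3 * l 2) = 0)
    (nn : -(n 0 * n 1 + n 1 * n 0) + (n 2 * n 3 + n 3 * n 2) = 0)
    (ln : -(l 0 * n 1 + l 1 * n 0) + (l 2 * n 3 + l 3 * n 2) = -1)
    (lm : -(l 0 * m 1 + l 1 * m 0) + (l 2 * m 3 + l 3 * m 2) = 0)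
    (lk : -(l 0 * k 1 + l 1 * k 0) + (l 2 * k 3 + l 3 * k 2) = 0)
    (nm : -(n 0 * m 1 + n 1 * m 0) + (n 2 * m 3 + n 3 * m 2) = 0)
    (nk : -(n 0 * k 1 + n 1 * k 0) + (n 2 * k 3 + n 3 * k 2) = 0)
    (mm : -(m 0 * m 1 + m 1 * m 0) + (m 2 * m 3 + m 3 * m 2) = 0)
    (kk : -(k 0 * k 1 + k 1 * k 0) + (k 2 * k 3 + k 3 * k 2) = 0)
    (mk : -(m 0 * k 1 + m 1 * k 0) + (m 2 * k 3 + m 3 * k 2) = 1)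
    (or : -((l 0 * n 2 - l 2 * n 0) * (m 1 * k 3 - m 3 * k 1))
      - (l 1 * n 3 - l 3 * n 1) * (m 0 * k 2 - m 2 * k 0)
      - (l 0 * n 1 - l 1 * n 0 - (l 2 * n 3 - l 3 * n 2)) *
        (m 0 * k 1 - m 1 * k 0 - (m 2 * k 3 - m 3 * k 2)) / 2
      + (l 0 * n 3 - l 3 * n 0) * (m 1 * k 2 - m 2 * k 1)
      + (l 1 * n 2 - l 2 * n 1) * (m 0 * k 3 - m 3 * k 0)
      + (l 0 * n 1 - l 1 * n 0 + (l 2 * n 3 - l 3 * n 2)) *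
        (m 0 * k 1 - m 1 * k 0 + (m 2 * k 3 - m 3 * k 2)) / 2 = 1)
    (h0 : ψ * ((l 0 * m 1 - l 1 * m 0 - (l 2 * m 3 - l 3 * m 2)) ^ 2
        - 2 * ((l 1 * m 3 - l 3 * m 1) * (l 0 * m 2 - l 2 * m 0)))
      + ψ' * ((l 0 * m 1 - l 1 * m 0 + (l 2 * m 3 - l 3 * m 2)) ^ 2
        - 2 * ((l 1 * m 2 - l 2 * m 1) * (l 0 * m 3 - l 3 * m 0))) = 0)
    (h4 : ψ * ((n 0 * k 1 - n 1 * k 0 - (n 2 * k 3 - n 3 * k 2)) ^ 2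
        - 2 * ((n 1 * k 3 - n 3 * k 1) * (n 0 * k 2 - n 2 * k 0)))
      + ψ' * ((n 0 * k 1 - n 1 * k 0 + (n 2 * k 3 - n 3 * k 2)) ^ 2
        - 2 * ((n 1 * k 2 - n 2 * k 1) * (n 0 * k 3 - n 3 * k 0))) = 0) :
    ((l 1 = 0 ∧ l 2 = 0 ∧ l 3 = 0) ∧ (n 0 = 0 ∧ n 2 = 0 ∧ n 3 = 0) ∧
      (m 0 = 0 ∧ m 1 = 0 ∧ m 3 = 0) ∧ (k 0 = 0 ∧ k 1 = 0 ∧ k 2 = 0) ∧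
      l 0 * n 1 = 1 ∧ m 2 * k 3 = 1) ∨
    ((l 0 = 0 ∧ l 2 = 0 ∧ l 3 = 0) ∧ (n 1 = 0 ∧ n 2 = 0 ∧ n 3 = 0) ∧
      (m 0 = 0 ∧ m 1 = 0 ∧ m 2 = 0) ∧ (k 0 = 0 ∧ k 1 = 0 ∧ k 3 = 0) ∧
      l 1 * n 0 = 1 ∧ m 3 * k 2 = 1) := by
  -- Half of the orientation identity, corrected by the metric products, is the self-dual pairing of
  -- `l ∧ m` with `n ∧ k`. Here the orientation decides that `l ∧ m` is self-dual rather than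
  -- anti-self-dual.
  have x1 : (l 0 * m 2 - l 2 * m 0) * (n 1 * k 3 - n 3 * k 1)
      + (l 1 * m 3 - l 3 * m 1) * (n 0 * k 2 - n 2 * k 0)
      + (l 0 * m 1 - l 1 * m 0 - (l 2 * m 3 - l 3 * m 2)) *
        (n 0 * k 1 - n 1 * k 0 - (n 2 * k 3 - n 3 * k 2)) / 2 = 1 := by
    linear_combination (1 / 2) * or
      - (1 / 2) * (-(m 0 * k 1 + m 1 * k 0) + (m 2 * k 3 + m 3 * k 2)) * ln + (1 / 2) * mk
      + (1 / 2) * (-(l 0 * k 1 + l 1 * k 0) + (l 2 * k 3 + l 3 * k 2)) * nm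
  have x2 : (n 0 * k 2 - n 2 * k 0) * (l 1 * m 3 - l 3 * m 1)
      + (n 1 * k 3 - n 3 * k 1) * (l 0 * m 2 - l 2 * m 0)
      + (n 0 * k 1 - n 1 * k 0 - (n 2 * k 3 - n 3 * k 2)) *
        (l 0 * m 1 - l 1 * m 0 - (l 2 * m 3 - l 3 * m 2)) / 2 = 1 := by
    linear_combination x1
  have hL := principal_direction hψ hl ll lm mm x1 h0
  have hN := principal_direction hψ hn nn nk kk x2 h4
  rcases hL with ⟨l1, l2, l3⟩ | ⟨l0, l2, l3⟩
  · left
    have e1 : l 0 * n 1 = 1 := by rw [l1, l2, l3] at ln; linear_combination -ln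
    have hl0 : l 0 ≠ 0 := left_ne_zero_of_mul_eq_one e1
    have hn1 : n 1 ≠ 0 := right_ne_zero_of_mul_eq_one e1
    obtain ⟨n1, -, -⟩ | ⟨n0, n2, n3⟩ := hN
    · exact absurd n1 hn1
    rw [l1, l2, l3] at lm lk or
    rw [n0, n2, n3] at nm nk or
    have m1 : m 1 = 0 := (mul_eq_zero.mp (by linear_combination -lm : l 0 * m 1 = 0)).resolve_left hl0
    have k1 : k 1 = 0 := (mul_eq_zero.mp (by linear_combination -lk : l 0 * k 1 = 0)).resolve_left hl0
    have m0 : m 0 = 0 := (mul_eq_zero.mp (by linear_combination -nm : n 1 * m 0 = 0)).resolve_left hn1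
    have k0 : k 0 = 0 := (mul_eq_zero.mp (by linear_combination -nk : n 1 * k 0 = 0)).resolve_left hn1
    rw [m0, m1, k0, k1] at mk or
    rw [m0, m1] at mm
    rw [k0, k1] at kk
    -- The product `m · k` gives the sum of `m 2 * k 3` and `m 3 * k 2`, the orientation their
    -- difference, and both equal one. So `m` points along `M` and not along `K`.
    have e2 : m 2 * k 3 = 1 := by
      linear_combination (1 / 2) * mk + (1 / 2) * or - (1 / 2) * (m 2 * k 3 - m 3 * k 2) * e1
    have m3 : m 3 = 0 := (mul_eq_zero.mp (by linear_combination (1 / 2) * mm :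
      m 2 * m 3 = 0)).resolve_left (left_ne_zero_of_mul_eq_one e2)
    have k2 : k 2 = 0 := (mul_eq_zero.mp (by linear_combination (1 / 2) * kk :
      k 3 * k 2 = 0)).resolve_left (right_ne_zero_of_mul_eq_one e2)
    exact ⟨⟨l1, l2, l3⟩, ⟨n0, n2, n3⟩, ⟨m0, m1, m3⟩, ⟨k0, k1, k2⟩, e1, e2⟩
  · right
    have e1 : l 1 * n 0 = 1 := by rw [l0, l2, l3] at ln; linear_combination -ln
    have hl1 : l 1 ≠ 0 := left_ne_zero_of_mul_eq_one e1
    have hn0 : n 0 ≠ 0 := right_ne_zero_of_mul_eq_one e1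
    obtain ⟨n1, n2, n3⟩ | ⟨n0, -, -⟩ := hN
    swap
    · exact absurd n0 hn0
    rw [l0, l2, l3] at lm lk or
    rw [n1, n2, n3] at nm nk or
    have m0 : m 0 = 0 := (mul_eq_zero.mp (by linear_combination -lm : l 1 * m 0 = 0)).resolve_left hl1
    have k0 : k 0 = 0 := (mul_eq_zero.mp (by linear_combination -lk : l 1 * k 0 = 0)).resolve_left hl1
    have m1 : m 1 = 0 := (mul_eq_zero.mp (by linear_combination -nm : n 0 * m 1 = 0)).resolve_left hn0
    have k1 : k 1 = 0 := (mul_eq_zero.mp (by linear_combination -nk : n 0 * k 1 = 0)).resolve_left hn0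
    rw [m0, m1, k0, k1] at mk or
    rw [m0, m1] at mm
    rw [k0, k1] at kk
    have e2 : m 3 * k 2 = 1 := by
      linear_combination (1 / 2) * mk + (1 / 2) * or + (1 / 2) * (m 2 * k 3 - m 3 * k 2) * e1
    have m2 : m 2 = 0 := (mul_eq_zero.mp (by linear_combination (1 / 2) * mm :
      m 3 * m 2 = 0)).resolve_left (left_ne_zero_of_mul_eq_one e2)
    have k3 : k 3 = 0 := (mul_eq_zero.mp (by linear_combination (1 / 2) * kk :
      k 2 * k 3 = 0)).resolve_left (right_ne_zero_of_mul_eq_one e2)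
    exact ⟨⟨l0, l2, l3⟩, ⟨n1, n2, n3⟩, ⟨m0, m1, m2⟩, ⟨k0, k1, k3⟩, e1, e2⟩

namespace CoframeData

/-- At `x`, `l`, `n`, `m`, `m̄` are multiples of `L`, `N`, `M`, `K`. -/
structure Aligned (c : CoframeData) (e : Tetrad) (x : Pt) : Prop where
  l : c.cmp x (e.lC x) 1 = 0 ∧ c.cmp x (e.lC x) 2 = 0 ∧ c.cmp x (e.lC x) 3 = 0
  n : c.cmp x (e.nC x) 0 = 0 ∧ c.cmp x (e.nC x) 2 = 0 ∧ c.cmp x (e.nC x) 3 = 0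
  m : c.cmp x (e.m x) 0 = 0 ∧ c.cmp x (e.m x) 1 = 0 ∧ c.cmp x (e.m x) 3 = 0
  mbar : c.cmp x (e.mbar x) 0 = 0 ∧ c.cmp x (e.mbar x) 1 = 0 ∧ c.cmp x (e.mbar x) 2 = 0
  ln : c.cmp x (e.lC x) 0 * c.cmp x (e.nC x) 1 = 1
  mm : c.cmp x (e.m x) 2 * c.cmp x (e.mbar x) 3 = 1

/-- At `x`, `l`, `n`, `m`, `m̄` are multiples of `N`, `L`, `K`, `M`. -/
structure AlignedSwap (c : CoframeData) (e : Tetrad) (x : Pt) : Prop where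
  l : c.cmp x (e.lC x) 0 = 0 ∧ c.cmp x (e.lC x) 2 = 0 ∧ c.cmp x (e.lC x) 3 = 0
  n : c.cmp x (e.nC x) 1 = 0 ∧ c.cmp x (e.nC x) 2 = 0 ∧ c.cmp x (e.nC x) 3 = 0
  m : c.cmp x (e.m x) 0 = 0 ∧ c.cmp x (e.m x) 1 = 0 ∧ c.cmp x (e.m x) 2 = 0
  mbar : c.cmp x (e.mbar x) 0 = 0 ∧ c.cmp x (e.mbar x) 1 = 0 ∧ c.cmp x (e.mbar x) 3 = 0
  ln : c.cmp x (e.lC x) 1 * c.cmp x (e.nC x) 0 = 1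
  mm : c.cmp x (e.m x) 3 * c.cmp x (e.mbar x) 2 = 1

end CoframeData

theorem metricC_conj (g : MetricField) (x : Pt) (u v : Fin 4 → ℂ) :
    conj (metricC g x u v) = metricC g x (fun i => conj (u i)) fun i => conj (v i) := by
  simp [metricC, map_sum]

theorem Tetrad.conj_lC (e : Tetrad) (x : Pt) : (fun i => conj (e.lC x i)) = e.lC x := by
  ext i
  simp [Tetrad.lC]

theorem Tetrad.conj_nC (e : Tetrad) (x : Pt) : (fun i => conj (e.nC x i)) = e.nC x := by
  ext i
  simp [Tetrad.nC]

namespace IsNullTetradOn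

variable {g : MetricField} {o : ℤˣ} {e : Tetrad} {U : Set Pt} (h : IsNullTetradOn g o e U) {x : Pt}
include h

theorem lmbar (hx : x ∈ U) : metricC g x (e.lC x) (e.mbar x) = 0 := by
  have := congrArg conj (h.lm x hx)
  rwa [metricC_conj, e.conj_lC, map_zero] at this

theorem nmbar (hx : x ∈ U) : metricC g x (e.nC x) (e.mbar x) = 0 := by
  have := congrArg conj (h.nm x hx)
  rwa [metricC_conj, e.conj_nC, map_zero] at this

theorem mbarmbar (hx : x ∈ U) : metricC g x (e.mbar x) (e.mbar x) = 0 := by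
  have := congrArg conj (h.mm x hx)
  rwa [metricC_conj, map_zero] at this

end IsNullTetradOn

namespace CoframeData.IsReal

variable {c : CoframeData} {V : Set Pt} (hr : c.IsReal V) {x : Pt}
include hr

theorem conj_cmp₀ (hx : x ∈ V) (u : Fin 4 → ℂ) :
    conj (c.cmp x u 0) = c.cmp x (fun i => conj (u i)) 0 := by
  rw [cmp, ev_conj, cmp]
  congr 1
  exact funext (hr x hx).1

theorem conj_cmp₁ (hx : x ∈ V) (u : Fin 4 → ℂ) :
    conj (c.cmp x u 1) = c.cmp x (fun i => conj (u i)) 1 := by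
  rw [cmp, ev_conj, cmp]
  congr 1
  exact funext (hr x hx).2.1

theorem exists_conj_cmp₂ (hx : x ∈ V) : ∃ s : ℝ, 0 < s ∧ ∀ u : Fin 4 → ℂ,
    conj (c.cmp x u 2) = s * c.cmp x (fun i => conj (u i)) 3 := by
  obtain ⟨s, hs, h⟩ := (hr x hx).2.2
  refine ⟨s, hs, fun u => ?_⟩
  rw [cmp, ev_conj, cmp, ev, ev, Finset.mul_sum]
  exact Finset.sum_congr rfl fun i _ => by rw [h i]; ring

/-- For a real vector the `M` and `K` components are conjugate up to a nonzero factor; this supplies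
`hl` and `hn` in `aligned_of_principal`. -/
theorem cmp₂_eq_zero_iff (hx : x ∈ V) {u : Fin 4 → ℂ} (hu : (fun i => conj (u i)) = u) :
    c.cmp x u 2 = 0 ↔ c.cmp x u 3 = 0 := by
  obtain ⟨s, hs, h⟩ := hr.exists_conj_cmp₂ hx
  have := h u
  rw [hu] at this
  rw [← map_eq_zero (starRingEnd ℂ), this, mul_eq_zero, or_iff_right]
  exact_mod_cast hs.ne'

end CoframeData.IsReal

namespace IsNullCoframe

variable {g : MetricField} {V : Set Pt} {c : CoframeData} (h : IsNullCoframe g V c) {x : Pt}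
variable {ψ ψ' φ : Pt → ℂ} {Λ : ℂ} (hc : HasTypeDCurvature V c ψ ψ' φ Λ) {o : ℤˣ}
include h hc

theorem aligned_or_swap (ho : c.IsOriented g o V) (hr : c.IsReal V) (hψ : ψ' x = conj (ψ x))
    {U : Set Pt} {e : Tetrad} (he : IsTypeDFrameOn g o e U) (hx : x ∈ V) (hxU : x ∈ U) :
    c.Aligned e x ∨ c.AlignedSwap e x := by
  have t := he.nullTetrad
  have hψ0 : ψ x ≠ 0 := fun h0 => he.psi2 x hxU <| by
    rw [Psi2, h.weylC_eq hc hx, hψ, h0, map_zero]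
    ring
  have h0 := he.psi0 x hxU
  have h4 := he.psi4 x hxU
  rw [Psi0, h.weylC_eq hc hx] at h0
  rw [Psi4, h.weylC_eq hc hx] at h4
  have or := t.oriented x hxU
  rw [volC_eq ho hx] at or
  simp only [CoframeData.ev2_sd₁, CoframeData.ev2_sd₂, CoframeData.ev2_sd₃, CoframeData.ev2_asd₁,
    CoframeData.ev2_asd₂, CoframeData.ev2_asd₃] at h0 h4 or
  have gC := fun u v => h.metricC_eq hx u v
  rcases aligned_of_principal (ψ' := ψ' x) hψ0 (hr.cmp₂_eq_zero_iff hx (e.conj_lC x))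
    (hr.cmp₂_eq_zero_iff hx (e.conj_nC x))
    ((gC _ _).symm.trans (t.ll x hxU)) ((gC _ _).symm.trans (t.nn x hxU))
    ((gC _ _).symm.trans (t.ln x hxU)) ((gC _ _).symm.trans (t.lm x hxU))
    ((gC _ _).symm.trans (t.lmbar hxU)) ((gC _ _).symm.trans (t.nm x hxU))
    ((gC _ _).symm.trans (t.nmbar hxU)) ((gC _ _).symm.trans (t.mm x hxU))
    ((gC _ _).symm.trans (t.mbarmbar hxU)) ((gC _ _).symm.trans (t.mmbar x hxU))
    (mul_left_cancel₀ (neg_ne_zero.mpr Complex.I_ne_zero) (or.trans (mul_one _).symm))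
    (by linear_combination h0) (by linear_combination h4) with H | H
  · exact .inl ⟨H.1, H.2.1, H.2.2.1, H.2.2.2.1, H.2.2.2.2.1, H.2.2.2.2.2⟩
  · exact .inr ⟨H.1, H.2.1, H.2.2.1, H.2.2.2.1, H.2.2.2.2.1, H.2.2.2.2.2⟩

theorem psi2_of_aligned {e : Tetrad} (hx : x ∈ V) (ha : c.Aligned e x ∨ c.AlignedSwap e x) :
    Psi2 g e x = ψ x := by
  rw [Psi2, h.weylC_eq hc hx]
  simp only [CoframeData.ev2_sd₁, CoframeData.ev2_sd₂, CoframeData.ev2_sd₃, CoframeData.ev2_asd₁,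
    CoframeData.ev2_asd₂, CoframeData.ev2_asd₃]
  rcases ha with ha | ha <;> simp only [ha.l, ha.n, ha.m, ha.mbar]
  · linear_combination ψ x * c.cmp x (e.m x) 2 * c.cmp x (e.mbar x) 3 * ha.ln + ψ x * ha.mm
  · linear_combination ψ x * c.cmp x (e.m x) 3 * c.cmp x (e.mbar x) 2 * ha.ln + ψ x * ha.mm

theorem phi11_of_aligned {e : Tetrad} (hx : x ∈ V) (ha : c.Aligned e x ∨ c.AlignedSwap e x) :
    Phi11 g e x = φ x := by
  rw [Phi11, h.ricciC_eq hc hx, h.ricciC_eq hc hx, h.metricC_eq hx, h.metricC_eq hx]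
  rcases ha with ha | ha <;>
  · simp only [ha.l, ha.n, ha.m, ha.mbar]
    linear_combination (-Λ / 4 + φ x / 2) * ha.ln + (Λ / 4 + φ x / 2) * ha.mm

end IsNullCoframe

/-! ### Spin coefficients of aligned frames -/

namespace CoframeData

variable (c : CoframeData) (x : Pt)

/-- The coefficient `ρ` of the frame `(L, N, M, K)`. -/
def rho : ℂ := ev (c.κ₁ x) (c.E 3 x)

/-- The coefficient `τ` of the frame `(L, N, M, K)`. -/
def tau : ℂ := ev (c.κ₁ x) (c.E 1 x)

/-- The coefficient `μ` of the frame `(L, N, M, K)`. -/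
def mu : ℂ := -ev (c.ν₂ x) (c.E 2 x)

/-- The coefficient `π` of the frame `(L, N, M, K)`. -/
def pi : ℂ := -ev (c.ν₂ x) (c.E 0 x)

end CoframeData

theorem ev_neg_left (u v : Fin 4 → ℂ) : ev (fun i => -u i) v = -ev u v := by
  simp [ev]

theorem ev_zero_left (v : Fin 4 → ℂ) : ev (fun _ => 0) v = 0 := by
  simp [ev]

namespace IsNullCoframe

variable {g : MetricField} {V : Set Pt} {c : CoframeData} (h : IsNullCoframe g V c) {x : Pt}
include h

theorem ev_eq (hx : x ∈ V) (u v : Fin 4 → ℂ) :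
    ev u v = ∑ α, c.cmp x v α * ev u (c.E α x) := by
  simp only [ev, Finset.mul_sum]
  rw [Finset.sum_comm]
  refine Finset.sum_congr rfl fun i _ => ?_
  rw [h.cmp_frame hx v i, Finset.mul_sum]
  exact Finset.sum_congr rfl fun α _ => by ring

theorem lower_eq (hx : x ∈ V) (u : Fin 4 → ℂ) (a : Fin 4) : ∑ k, (g x a k : ℂ) * u k =
    -(c.θ 0 x a * c.cmp x u 1 + c.θ 1 x a * c.cmp x u 0)
      + (c.θ 2 x a * c.cmp x u 3 + c.θ 3 x a * c.cmp x u 2) := by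
  simp only [CoframeData.cmp, ev, Finset.mul_sum, ← Finset.sum_add_distrib,
    ← Finset.sum_neg_distrib]
  refine Finset.sum_congr rfl fun k _ => ?_
  rw [h.metric_eq hx]
  ring

theorem covDVecC_eq {W : Set Pt} (hW : IsOpen W) (hWV : W ⊆ V) (hx : x ∈ W) {u : Pt → Fin 4 → ℝ}
    {f : Pt → ℂ} {d : Fin 4 → ℂ} (hf : HasPd f x d) {β : Fin 4}
    (hu : ∀ y ∈ W, ∀ a, ∑ k, (g y a k : ℂ) * (u y k : ℂ) = f y * c.θ β y a) (v w : Fin 4 → ℂ) :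
    covDVecC g u x v w = ev d w * c.cmp x v β
      - f x * ∑ γ, ev (fun i => c.conn i x β γ) w * c.cmp x v γ := by
  have e : ∀ a b, (covDVec g u x a b : ℂ) = d b * c.θ β x a
      - f x * ∑ γ, c.conn b x β γ * c.θ γ x a := fun a b => by
    have h1 : HasPd (fun y => ((∑ k, g y a k * u y k : ℝ) : ℂ)) x _ :=
      (hf.mul (h.hasNabla1_θ (hWV hx) β a)).congr hW hx fun y hy => by
        push_cast
        exact hu y hy a
    have h2 : ∀ i, ((∑ k, g x i k * u x k : ℝ) : ℂ) = f x * c.θ β x i := fun i => by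
      push_cast
      exact hu x hx i
    rw [covDVec, Complex.ofReal_sub, hasPd_ofReal_of_pd h1]
    rw [Complex.ofReal_sum]
    simp only [Complex.ofReal_mul, h2]
    simp only [Fin.sum_univ_four]
    ring
  simp only [covDVecC, e, CoframeData.cmp, ev, Fin.sum_univ_four]
  ring

theorem smooth_cmp {U : Set Pt} {u : Pt → Fin 4 → ℂ} (hu : ContDiffOn ℝ ∞ u U) (α : Fin 4) :
    ContDiffOn ℝ ∞ (fun y => c.cmp y (u y) α) (U ∩ V) := by
  simp only [CoframeData.cmp, ev]
  exact ContDiffOn.sum fun i _ => ((h.smooth_θ α i).mono Set.inter_subset_right).mul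
    ((contDiffOn_pi.mp hu i).mono Set.inter_subset_left)

/-- A real vector field that is a multiple of the null frame vector of index `α`, dual to `β`. -/
theorem covDVecC_of_cmp {W : Set Pt} (hW : IsOpen W) (hWV : W ⊆ V) (hx : x ∈ W)
    {u : Pt → Fin 4 → ℝ} (hu : ContDiffOn ℝ ∞ u W) {α β : Fin 4}
    (hlow : ∀ y ∈ W, ∀ a, ∑ k, (g y a k : ℂ) * (u y k : ℂ) =
      -c.cmp y (fun i => (u y i : ℂ)) α * c.θ β y a) {v : Fin 4 → ℂ} (w : Fin 4 → ℂ)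
    (hv : c.cmp x v β = 0) :
    covDVecC g u x v w = c.cmp x (fun i => (u x i : ℂ)) α *
      ∑ γ, ev (fun i => c.conn i x β γ) w * c.cmp x v γ := by
  have hu' : ContDiffOn ℝ ∞ (fun y i => (u y i : ℂ)) W :=
    contDiffOn_pi.mpr fun i => Complex.ofRealCLM.contDiff.comp_contDiffOn (contDiffOn_pi.mp hu i)
  have h1 := h.smooth_cmp hu' α
  rw [Set.inter_eq_left.mpr hWV] at h1
  rw [h.covDVecC_eq hW hWV hx (hasPd_of_contDiffOn hW h1 hx).neg hlow, hv]
  ring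

section

variable {e : Tetrad} {W : Set Pt} (hW : IsOpen W) (hWV : W ⊆ V) (hl : ContDiffOn ℝ ∞ e.l W)
  (hn : ContDiffOn ℝ ∞ e.n W)
include hW hWV hl hn

/-- The covector of `l` is a multiple of `N`, and differentiating the factor gives a multiple of `N`
again, which `m` annihilates. So `ρ` and `τ` are read off from `κ₁`; in the same way `μ` and `π`
come from `ν₂`. -/
theorem spin_of_aligned (ha : ∀ y ∈ W, c.Aligned e y) (hx : x ∈ W) :
    spinRho g e x = c.cmp x (e.lC x) 0 * c.rho x ∧
    spinMu g e x = c.cmp x (e.nC x) 1 * c.mu x ∧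
    spinTau g e x = c.cmp x (e.m x) 2 * c.tau x ∧
    spinPi g e x = c.cmp x (e.mbar x) 3 * c.pi x := by
  have a := ha x hx
  have hL := fun w => h.covDVecC_of_cmp hW hWV hx hl (α := 0) (β := 1) (fun y hy i => by
    have := ha y hy
    rw [show (fun k => (e.l y k : ℂ)) = e.lC y from rfl,
      show ∑ k, (g y i k : ℂ) * (e.l y k : ℂ) = ∑ k, (g y i k : ℂ) * e.lC y k from rfl,
      h.lower_eq (hWV hy)]
    simp only [this.l]
    ring) w a.m.2.1
  have hN := fun w => h.covDVecC_of_cmp hW hWV hx hn (α := 1) (β := 0) (fun y hy i => by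
    have := ha y hy
    rw [show (fun k => (e.n y k : ℂ)) = e.nC y from rfl,
      show ∑ k, (g y i k : ℂ) * (e.n y k : ℂ) = ∑ k, (g y i k : ℂ) * e.nC y k from rfl,
      h.lower_eq (hWV hy)]
    simp only [this.n]
    ring) w a.mbar.1
  rw [show (fun k => (e.l x k : ℂ)) = e.lC x from rfl] at hL
  rw [show (fun k => (e.n x k : ℂ)) = e.nC x from rfl] at hN
  have k1 := fun w => h.ev_eq (hWV hx) (c.κ₁ x) w
  have k2 := fun w => h.ev_eq (hWV hx) (c.ν₂ x) w
  simp only [Fin.sum_univ_four] at hL hN k1 k2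
  refine ⟨?_, ?_, ?_, ?_⟩
  · rw [spinRho, hL]
    simp only [CoframeData.conn, Matrix.of_apply, Matrix.cons_val, ev_neg_left, ev_zero_left, a.m, a.mbar]
    rw [k1]
    simp only [a.l, a.n, a.m, a.mbar, CoframeData.rho]
    linear_combination c.cmp x (e.lC x) 0 * ev (c.κ₁ x) (c.E 3 x) * a.mm
  · rw [spinMu, hN]
    simp only [CoframeData.conn, Matrix.of_apply, Matrix.cons_val, ev_neg_left, ev_zero_left, a.m, a.mbar]
    rw [k2]
    simp only [a.l, a.n, a.m, a.mbar, CoframeData.mu]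
    linear_combination -c.cmp x (e.nC x) 1 * ev (c.ν₂ x) (c.E 2 x) * a.mm
  · rw [spinTau, hL]
    simp only [CoframeData.conn, Matrix.of_apply, Matrix.cons_val, ev_neg_left, ev_zero_left, a.m, a.mbar]
    rw [k1]
    simp only [a.l, a.n, a.m, a.mbar, CoframeData.tau]
    linear_combination c.cmp x (e.m x) 2 * ev (c.κ₁ x) (c.E 1 x) * a.ln
  · rw [spinPi, hN]
    simp only [CoframeData.conn, Matrix.of_apply, Matrix.cons_val, ev_neg_left, ev_zero_left, a.m, a.mbar]
    rw [k2]
    simp only [a.l, a.n, a.m, a.mbar, CoframeData.pi]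
    linear_combination -c.cmp x (e.mbar x) 3 * ev (c.ν₂ x) (c.E 0 x) * a.ln

/-- Exchanging `L` with `N` and `M` with `K` interchanges `ρ` with `-μ` and `τ` with `-π`. -/
theorem spin_of_alignedSwap (ha : ∀ y ∈ W, c.AlignedSwap e y) (hx : x ∈ W) :
    spinRho g e x = -(c.cmp x (e.lC x) 1 * c.mu x) ∧
    spinMu g e x = -(c.cmp x (e.nC x) 0 * c.rho x) ∧
    spinTau g e x = -(c.cmp x (e.m x) 3 * c.pi x) ∧
    spinPi g e x = -(c.cmp x (e.mbar x) 2 * c.tau x) := by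
  have a := ha x hx
  have hL := fun w => h.covDVecC_of_cmp hW hWV hx hl (α := 1) (β := 0) (fun y hy i => by
    have := ha y hy
    rw [show (fun k => (e.l y k : ℂ)) = e.lC y from rfl,
      show ∑ k, (g y i k : ℂ) * (e.l y k : ℂ) = ∑ k, (g y i k : ℂ) * e.lC y k from rfl,
      h.lower_eq (hWV hy)]
    simp only [this.l]
    ring) w a.m.1
  have hN := fun w => h.covDVecC_of_cmp hW hWV hx hn (α := 0) (β := 1) (fun y hy i => by
    have := ha y hy
    rw [show (fun k => (e.n y k : ℂ)) = e.nC y from rfl,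
      show ∑ k, (g y i k : ℂ) * (e.n y k : ℂ) = ∑ k, (g y i k : ℂ) * e.nC y k from rfl,
      h.lower_eq (hWV hy)]
    simp only [this.n]
    ring) w a.mbar.2.1
  rw [show (fun k => (e.l x k : ℂ)) = e.lC x from rfl] at hL
  rw [show (fun k => (e.n x k : ℂ)) = e.nC x from rfl] at hN
  have k1 := fun w => h.ev_eq (hWV hx) (c.κ₁ x) w
  have k2 := fun w => h.ev_eq (hWV hx) (c.ν₂ x) w
  simp only [Fin.sum_univ_four] at hL hN k1 k2
  refine ⟨?_, ?_, ?_, ?_⟩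
  · rw [spinRho, hL]
    simp only [CoframeData.conn, Matrix.of_apply, Matrix.cons_val, ev_neg_left, ev_zero_left, a.m, a.mbar]
    rw [k2]
    simp only [a.l, a.n, a.m, a.mbar, CoframeData.mu]
    linear_combination c.cmp x (e.lC x) 1 * ev (c.ν₂ x) (c.E 2 x) * a.mm
  · rw [spinMu, hN]
    simp only [CoframeData.conn, Matrix.of_apply, Matrix.cons_val, ev_neg_left, ev_zero_left, a.m, a.mbar]
    rw [k1]
    simp only [a.l, a.n, a.m, a.mbar, CoframeData.rho]
    linear_combination -c.cmp x (e.nC x) 0 * ev (c.κ₁ x) (c.E 3 x) * a.mm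
  · rw [spinTau, hL]
    simp only [CoframeData.conn, Matrix.of_apply, Matrix.cons_val, ev_neg_left, ev_zero_left, a.m, a.mbar]
    rw [k2]
    simp only [a.l, a.n, a.m, a.mbar, CoframeData.pi]
    linear_combination c.cmp x (e.m x) 3 * ev (c.ν₂ x) (c.E 0 x) * a.ln
  · rw [spinPi, hN]
    simp only [CoframeData.conn, Matrix.of_apply, Matrix.cons_val, ev_neg_left, ev_zero_left, a.m, a.mbar]
    rw [k1]
    simp only [a.l, a.n, a.m, a.mbar, CoframeData.tau]
    linear_combination -c.cmp x (e.mbar x) 2 * ev (c.κ₁ x) (c.E 1 x) * a.ln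

end

variable {ψ ψ' φ : Pt → ℂ} {Λ : ℂ} (hc : HasTypeDCurvature V c ψ ψ' φ Λ) {o : ℤˣ}
include hc

/-- The Newman–Penrose scalars of an arbitrary type D frame. -/
theorem typeDFrame_scalars (ho : c.IsOriented g o V) (hr : c.IsReal V)
    (hψ : ∀ y ∈ V, ψ' y = conj (ψ y)) {U : Set Pt} (hU : IsOpen U) {e : Tetrad}
    (he : IsTypeDFrameOn g o e U) (hx : x ∈ V) (hxU : x ∈ U) :
    Psi2 g e x = ψ x ∧ Phi11 g e x = φ x ∧ ∃ A : ℝ, A ≠ 0 ∧ ∃ z : ℂ, z ≠ 0 ∧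
      ((spinRho g e x = A * c.rho x ∧ spinMu g e x = (A : ℂ)⁻¹ * c.mu x ∧
        spinTau g e x = z * c.tau x ∧ spinPi g e x = z⁻¹ * c.pi x) ∨
      (spinRho g e x = -(A * c.mu x) ∧ spinMu g e x = -((A : ℂ)⁻¹ * c.rho x) ∧
        spinTau g e x = -(z * c.pi x) ∧ spinPi g e x = -(z⁻¹ * c.tau x))) := by
  have al := fun y (hy : y ∈ U ∩ V) => h.aligned_or_swap hc ho hr (hψ y hy.2) he hy.2 hy.1
  refine ⟨h.psi2_of_aligned hc hx (al x ⟨hxU, hx⟩), h.phi11_of_aligned hc hx (al x ⟨hxU, hx⟩), ?_⟩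
  have t := he.nullTetrad
  have hlC : ContDiffOn ℝ ∞ e.lC U := contDiffOn_pi.mpr fun i =>
    Complex.ofRealCLM.contDiff.comp_contDiffOn (contDiffOn_pi.mp t.smooth_l i)
  -- Spin coefficients contain derivatives, so one alignment must hold on a whole neighbourhood. The
  -- nonvanishing of one component of `l` is an open condition that excludes the other alignment.
  have hWo : ∀ α, IsOpen {y ∈ U ∩ V | c.cmp y (e.lC y) α ≠ 0} := fun α =>
    (h.smooth_cmp hlC α).continuousOn.isOpen_inter_preimage (hU.inter h.isOpen)
      isOpen_compl_singleton
  have hre : ∀ {α}, conj (c.cmp x (e.lC x) α) = c.cmp x (e.lC x) α → c.cmp x (e.lC x) α ≠ 0 →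
      ∃ A : ℝ, A ≠ 0 ∧ c.cmp x (e.lC x) α = A := fun {α} h1 h2 => by
    obtain ⟨A, hA⟩ := Complex.conj_eq_iff_real.mp h1
    exact ⟨A, fun h0 => h2 (by rw [hA, h0, Complex.ofReal_zero]), hA⟩
  have r0 := hr.conj_cmp₀ hx (e.lC x)
  have r1 := hr.conj_cmp₁ hx (e.lC x)
  rw [e.conj_lC] at r0 r1
  rcases al x ⟨hxU, hx⟩ with a | a
  · have h0 := left_ne_zero_of_mul_eq_one a.ln
    obtain ⟨A, hA, hlA⟩ := hre r0 h0
    have hs := h.spin_of_aligned (hWo 0) (fun y hy => hy.1.2)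
      (t.smooth_l.mono fun y hy => hy.1.1) (t.smooth_n.mono fun y hy => hy.1.1)
      (fun y hy => (al y hy.1).resolve_right fun b => hy.2 b.l.1) ⟨⟨hxU, hx⟩, h0⟩
    refine ⟨A, hA, _, left_ne_zero_of_mul_eq_one a.mm, .inl ?_⟩
    rwa [← hlA, inv_eq_of_mul_eq_one_right a.ln, inv_eq_of_mul_eq_one_right a.mm]
  · have h0 := left_ne_zero_of_mul_eq_one a.ln
    obtain ⟨A, hA, hlA⟩ := hre r1 h0
    have hs := h.spin_of_alignedSwap (hWo 1) (fun y hy => hy.1.2)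
      (t.smooth_l.mono fun y hy => hy.1.1) (t.smooth_n.mono fun y hy => hy.1.1)
      (fun y hy => (al y hy.1).resolve_left fun b => hy.2 b.l.1) ⟨⟨hxU, hx⟩, h0⟩
    refine ⟨A, hA, _, left_ne_zero_of_mul_eq_one a.mm, .inr ?_⟩
    rwa [← hlA, inv_eq_of_mul_eq_one_right a.ln, inv_eq_of_mul_eq_one_right a.mm]

end IsNullCoframe

namespace Carter

variable (C : Carter) (y : Pt) (i : Fin 4)

theorem θ₀_apply : C.coframe.θ 0 y i = (C.Q y * ((C.ζ y)⁻¹ * (C.ζ' y)⁻¹) *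
    (C.dt i + C.A y * C.dφ i) + C.dr i) / 2 := by
  change C.Q y * (C.ζ y)⁻¹ * (C.ζ' y)⁻¹ / 2 * C.dt i
    + C.A y * C.Q y * (C.ζ y)⁻¹ * (C.ζ' y)⁻¹ / 2 * C.dφ i + 0 * C.dx y i + 1 / 2 * C.dr i = _
  ring

theorem θ₁_apply : C.coframe.θ 1 y i = C.dt i + C.A y * C.dφ i
    - (C.ζ y * C.ζ' y) * (C.Q y)⁻¹ * C.dr i := by
  change 1 * C.dt i + C.A y * C.dφ i + 0 * C.dx y i + -(C.ζ y * C.ζ' y * (C.Q y)⁻¹) * C.dr i = _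
  ring

theorem θ₂_apply : C.coframe.θ 2 y i = (C.dx y i - C.P y * ((C.ζ y)⁻¹ * (C.ζ' y)⁻¹) *
    (C.c * C.dt i + C.B y * C.dφ i)) / 2 := by
  change -(C.c * C.P y * (C.ζ y)⁻¹ * (C.ζ' y)⁻¹ / 2) * C.dt i
    + -(C.B y * C.P y * (C.ζ y)⁻¹ * (C.ζ' y)⁻¹ / 2) * C.dφ i + 1 / 2 * C.dx y i + 0 * C.dr i = _
  ring

theorem θ₃_apply : C.coframe.θ 3 y i = (C.ζ y * C.ζ' y) * (C.P y)⁻¹ * C.dx y i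
    + (C.c * C.dt i + C.B y * C.dφ i) := by
  change C.c * C.dt i + C.B y * C.dφ i + C.ζ y * C.ζ' y * (C.P y)⁻¹ * C.dx y i + 0 * C.dr i = _
  ring

end Carter

/-! ### Real charts of the Carter–Plebański family -/

/-- Real parameters of a Carter–Plebański metric, with the functions `r`, `x` and the coordinate
one-forms and vector fields of a chart `(t, φ, x, r)` of it. -/
structure RealCarter where
  c : ℝ
  p₀ : ℝ
  p₁ : ℝ
  ε : ℝ
  Λ : ℝ
  m : ℝ
  w : ℝ
  A₀ : ℝ
  r : Pt → ℝ
  x : Pt → ℝ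
  dt : Fin 4 → ℝ
  dφ : Fin 4 → ℝ
  dx : Pt → Fin 4 → ℝ
  dr : Fin 4 → ℝ
  vt : Fin 4 → ℝ
  vφ : Fin 4 → ℝ
  vx : Pt → Fin 4 → ℝ
  vr : Fin 4 → ℝ

namespace RealCarter

variable (R : RealCarter) (y : Pt)

/-- The structure function of `x`. -/
def P : ℝ := R.p₀ + 2 * R.p₁ * R.x y - R.ε * R.x y ^ 2 - R.Λ / 3 * R.c ^ 2 * R.x y ^ 4

/-- The structure function of `r`. -/
def Q : ℝ := R.c ^ 2 * R.p₀ + R.w - 2 * R.m * R.r y + R.ε * R.r y ^ 2 - R.Λ / 3 * R.r y ^ 4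

/-- `r² + c² x²`. -/
def S : ℝ := R.r y ^ 2 + R.c ^ 2 * R.x y ^ 2

/-- The timelike one-form `dt - (c x² + A₀) dφ`. -/
def time (i : Fin 4) : ℝ := R.dt i - (R.c * R.x y ^ 2 + R.A₀) * R.dφ i

/-- The axial one-form `c dt + (r² - c A₀) dφ`. -/
def axial (i : Fin 4) : ℝ := R.c * R.dt i + (R.r y ^ 2 - R.c * R.A₀) * R.dφ i

/-- The metric. -/
def metric : MetricField := fun y => Matrix.of fun i k =>
  -(R.Q y / R.S y) * R.time y i * R.time y k + R.S y / R.Q y * R.dr i * R.dr k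
    + R.S y / R.P y * R.dx y i * R.dx y k + R.P y / R.S y * R.axial y i * R.axial y k

/-- The matrix of the coordinate one-forms. -/
def D : Matrix (Fin 4) (Fin 4) ℝ := Matrix.of ![R.dt, R.dφ, R.dx y, R.dr]

/-- The complex form of the chart; `j = ± i`. -/
def toCarter (j : ℂ) : Carter where
  c := j * R.c
  p₀ := R.p₀
  p₁ := R.p₁
  ε := R.ε
  Λ := R.Λ
  m := R.m
  w := R.w
  A₀ := j * R.A₀
  r := fun y => R.r y
  x := fun y => R.x y
  dt := fun i => R.dt i
  dφ := fun i => j * R.dφ i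
  dx := fun y i => R.dx y i
  dr := fun i => R.dr i
  vt := fun i => R.vt i
  vφ := fun i => j⁻¹ * R.vφ i
  vx := fun y i => R.vx y i
  vr := fun i => R.vr i

/-- The chart of `R` is defined and smooth on `V`, off the zeros of `P`, `Q` and `r² + c² x²`. -/
structure IsChart (V : Set Pt) : Prop where
  isOpen : IsOpen V
  smooth_r : ContDiffOn ℝ ∞ R.r V
  smooth_x : ContDiffOn ℝ ∞ R.x V
  smooth_dx : ∀ i, ContDiffOn ℝ ∞ (fun y => R.dx y i) V
  smooth_vx : ∀ i, ContDiffOn ℝ ∞ (fun y => R.vx y i) V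
  pd_r : ∀ y ∈ V, ∀ i, pd i R.r y = R.dr i
  pd_x : ∀ y ∈ V, ∀ i, pd i R.x y = R.dx y i
  dual : ∀ y ∈ V, R.D y * (Matrix.of ![R.vt, R.vφ, R.vx y, R.vr]).transpose = 1
  S_pos : ∀ y ∈ V, 0 < R.S y
  P_pos : ∀ y ∈ V, 0 < R.P y
  Q_ne : ∀ y ∈ V, R.Q y ≠ 0

variable {R} {y} {j : ℂ}

theorem toCarter_P (hj : j ^ 2 = -1) : (R.toCarter j).P y = R.P y := by
  simp only [Carter.P, P, toCarter]
  push_cast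
  linear_combination R.Λ / 3 * R.c ^ 2 * R.x y ^ 4 * hj

theorem toCarter_Q (hj : j ^ 2 = -1) : (R.toCarter j).Q y = R.Q y := by
  simp only [Carter.Q, Q, toCarter]
  push_cast
  linear_combination -R.c ^ 2 * R.p₀ * hj

theorem toCarter_A : (R.toCarter j).A y = j * (R.c * R.x y ^ 2 + R.A₀) := by
  simp only [Carter.A, toCarter]
  ring

theorem toCarter_B (hj : j ^ 2 = -1) : (R.toCarter j).B y = R.r y ^ 2 - R.c * R.A₀ := by
  simp only [Carter.B, toCarter]
  linear_combination R.c * R.A₀ * hj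

theorem toCarter_ζ_mul (hj : j ^ 2 = -1) :
    (R.toCarter j).ζ y * (R.toCarter j).ζ' y = R.S y := by
  simp only [Carter.ζ, Carter.ζ', toCarter, S]
  push_cast
  linear_combination -R.c ^ 2 * R.x y ^ 2 * hj

theorem toCarter_ζ_inv (hj : j ^ 2 = -1) :
    ((R.toCarter j).ζ y)⁻¹ * ((R.toCarter j).ζ' y)⁻¹ = (R.S y : ℂ)⁻¹ := by
  rw [← mul_inv, toCarter_ζ_mul hj]

theorem toCarter_dt (i : Fin 4) : (R.toCarter j).dt i = R.dt i := rfl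

theorem toCarter_dφ (i : Fin 4) : (R.toCarter j).dφ i = j * R.dφ i := rfl

theorem toCarter_dx (i : Fin 4) : (R.toCarter j).dx y i = R.dx y i := rfl

theorem toCarter_dr (i : Fin 4) : (R.toCarter j).dr i = R.dr i := rfl

theorem toCarter_c : (R.toCarter j).c = j * R.c := rfl

theorem θ₀_eq (hj : j ^ 2 = -1) (i : Fin 4) : (R.toCarter j).coframe.θ 0 y i =
    (R.Q y * (R.S y : ℂ)⁻¹ * R.time y i + R.dr i) / 2 := by
  rw [Carter.θ₀_apply, toCarter_ζ_inv hj, toCarter_Q hj, toCarter_A, toCarter_dt, toCarter_dφ,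
    toCarter_dr, time]
  push_cast
  linear_combination R.Q y * (R.S y : ℂ)⁻¹ * (R.c * R.x y ^ 2 + R.A₀) * R.dφ i / 2 * hj

theorem θ₁_eq (hj : j ^ 2 = -1) (i : Fin 4) : (R.toCarter j).coframe.θ 1 y i =
    R.time y i - R.S y * (R.Q y : ℂ)⁻¹ * R.dr i := by
  rw [Carter.θ₁_apply, toCarter_ζ_mul hj, toCarter_Q hj, toCarter_A, toCarter_dt, toCarter_dφ,
    toCarter_dr, time]
  push_cast
  linear_combination (R.c * R.x y ^ 2 + R.A₀) * R.dφ i * hj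

theorem θ₂_eq (hj : j ^ 2 = -1) (i : Fin 4) : (R.toCarter j).coframe.θ 2 y i =
    (R.dx y i - R.P y * (R.S y : ℂ)⁻¹ * (j * R.axial y i)) / 2 := by
  rw [Carter.θ₂_apply, toCarter_ζ_inv hj, toCarter_P hj, toCarter_B hj, toCarter_dt, toCarter_dφ,
    toCarter_dx, toCarter_c, axial]
  push_cast
  ring

theorem θ₃_eq (hj : j ^ 2 = -1) (i : Fin 4) : (R.toCarter j).coframe.θ 3 y i =
    R.S y * (R.P y : ℂ)⁻¹ * R.dx y i + j * R.axial y i := by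
  rw [Carter.θ₃_apply, toCarter_ζ_mul hj, toCarter_P hj, toCarter_B hj, toCarter_dt, toCarter_dφ,
    toCarter_dx, toCarter_c, axial]
  push_cast
  ring

namespace IsChart

variable {V : Set Pt} (H : R.IsChart V)
include H

theorem mono {W : Set Pt} (hW : IsOpen W) (h : W ⊆ V) : R.IsChart W :=
  ⟨hW, H.smooth_r.mono h, H.smooth_x.mono h, fun i => (H.smooth_dx i).mono h,
    fun i => (H.smooth_vx i).mono h, fun y hy => H.pd_r y (h hy), fun y hy => H.pd_x y (h hy),
    fun y hy => H.dual y (h hy), fun y hy => H.S_pos y (h hy), fun y hy => H.P_pos y (h hy),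
    fun y hy => H.Q_ne y (h hy)⟩

omit H in
theorem smooth_ofReal {f : Pt → ℝ} (hf : ContDiffOn ℝ ∞ f V) :
    ContDiffOn ℝ ∞ (fun y => (f y : ℂ)) V :=
  Complex.ofRealCLM.contDiff.comp_contDiffOn hf

theorem toCarter (hj : j ^ 2 = -1) : (R.toCarter j).IsChart V := by
  have hj0 : j ≠ 0 := by
    rintro rfl
    norm_num at hj
  have hζ : ∀ y ∈ V, (R.toCarter j).ζ y * (R.toCarter j).ζ' y ≠ 0 := fun y hy => by
    rw [toCarter_ζ_mul hj]
    exact_mod_cast (H.S_pos y hy).ne'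
  have sr := smooth_ofReal H.smooth_r
  have sx := smooth_ofReal H.smooth_x
  have hpx : ∀ y ∈ V, ∀ i, pd i (fun y => (R.x y : ℂ)) y = R.dx y i := fun y hy i => by
    rw [pd_ofReal, H.pd_x y hy]
  refine ⟨H.isOpen, sr, sx, fun i => smooth_ofReal (H.smooth_dx i),
    fun i => smooth_ofReal (H.smooth_vx i), fun y hy => ?_, fun y hy => ?_, fun y hy i k => ?_,
    fun y hy => ?_, fun y hy => left_ne_zero_of_mul (hζ y hy),
    fun y hy => right_ne_zero_of_mul (hζ y hy), fun y hy => ?_, fun y hy => ?_⟩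
  · refine (hasPd_of_contDiffOn H.isOpen sr hy).congr_deriv fun i => ?_
    rw [pd_ofReal, H.pd_r y hy]
    rfl
  · exact (hasPd_of_contDiffOn H.isOpen sx hy).congr_deriv fun i => hpx y hy i
  -- `dx` is the differential of `x`, so its closedness is the symmetry of second derivatives.
  · have e : ∀ i k, pd i (fun z => (R.dx z k : ℂ)) y = pd i (pd k fun z => (R.x z : ℂ)) y :=
      fun i k => pd_congr H.isOpen hy (fun z hz => (hpx z hz k).symm) i
    exact (e i k).trans ((pd_pd_comm H.isOpen sx hy i k).trans (e k i).symm)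
  · have hd : ∀ p q : Fin 4, ∑ i, ((![R.dt, R.dφ, R.dx y, R.dr] p i : ℝ) : ℂ) *
        ((![R.vt, R.vφ, R.vx y, R.vr] q i : ℝ) : ℂ) = (1 : Matrix (Fin 4) (Fin 4) ℂ) p q := by
      intro p q
      have := congrArg Complex.ofReal (congrFun (congrFun (H.dual y hy) p) q)
      rw [Matrix.mul_apply, Complex.ofReal_sum] at this
      simp only [Complex.ofReal_mul] at this
      rw [show (∑ i, ((![R.dt, R.dφ, R.dx y, R.dr] p i : ℝ) : ℂ) *
        ((![R.vt, R.vφ, R.vx y, R.vr] q i : ℝ) : ℂ)) = _ from this]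
      simp only [Matrix.one_apply]
      split <;> simp
    ext p q
    rw [Matrix.mul_apply]
    have hpq := hd p q
    fin_cases p <;> fin_cases q <;>
      simp [RealCarter.toCarter, Matrix.transpose_apply, Fin.sum_univ_four] at hpq ⊢ <;>
      first
        | exact hpq
        | linear_combination hpq + (-1 + j * j⁻¹) * hpq
        | linear_combination j * hpq
        | linear_combination j⁻¹ * hpq
        | skip
    field_simp
    linear_combination hpq
  · rw [toCarter_P hj]
    exact_mod_cast (H.P_pos y hy).ne'
  · rw [toCarter_Q hj]
    exact_mod_cast H.Q_ne y hy

/-- The product `-2 L N` is `-(Q/S) time² + (S/Q) dr²`. Likewise `2 M K` is `(S/P) dx² - j² (P/S)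
axial²`, and `j² = -1` gives the last term its positive sign. -/
theorem isNullCoframe (hj : j ^ 2 = -1) {g : MetricField} (hg : ∀ y ∈ V, g y = R.metric y) :
    IsNullCoframe g V (R.toCarter j).coframe := by
  refine (H.toCarter hj).isNullCoframe fun y hy => ?_
  have hS : (R.S y : ℂ) ≠ 0 := by exact_mod_cast (H.S_pos y hy).ne'
  have hP : (R.P y : ℂ) ≠ 0 := by exact_mod_cast (H.P_pos y hy).ne'
  have hQ : (R.Q y : ℂ) ≠ 0 := by exact_mod_cast H.Q_ne y hy
  ext i k
  have e : ((((R.toCarter j).coframe.Θ y).transpose * eta * (R.toCarter j).coframe.Θ y) i k) =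
      -((R.toCarter j).coframe.θ 0 y i * (R.toCarter j).coframe.θ 1 y k
        + (R.toCarter j).coframe.θ 1 y i * (R.toCarter j).coframe.θ 0 y k)
      + ((R.toCarter j).coframe.θ 2 y i * (R.toCarter j).coframe.θ 3 y k
        + (R.toCarter j).coframe.θ 3 y i * (R.toCarter j).coframe.θ 2 y k) := by
    simp [Matrix.mul_apply, Fin.sum_univ_four, eta, CoframeData.Θ]
    ring
  rw [e, θ₀_eq hj, θ₀_eq hj, θ₁_eq hj, θ₁_eq hj, θ₂_eq hj, θ₂_eq hj, θ₃_eq hj, θ₃_eq hj,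
    metricM, hg y hy]
  simp only [Matrix.map_apply, metric, Matrix.of_apply]
  push_cast
  field_simp
  linear_combination 2 * R.P y ^ 2 * R.Q y * R.axial y i * R.axial y k * hj

theorem isReal (hj : j ^ 2 = -1) (hj' : conj j = -j) : (R.toCarter j).coframe.IsReal V := by
  intro y hy
  have hS : (R.S y : ℂ) ≠ 0 := by exact_mod_cast (H.S_pos y hy).ne'
  have hP : (R.P y : ℂ) ≠ 0 := by exact_mod_cast (H.P_pos y hy).ne'
  refine ⟨fun i => ?_, fun i => ?_, R.P y / (2 * R.S y),
    div_pos (H.P_pos y hy) (mul_pos two_pos (H.S_pos y hy)), fun i => ?_⟩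
  · rw [θ₀_eq hj]
    simp [Complex.conj_ofNat]
  · rw [θ₁_eq hj]
    simp
  · rw [θ₂_eq hj, θ₃_eq hj]
    simp only [map_div₀, map_sub, map_mul, map_inv₀, Complex.conj_ofReal, hj', Complex.conj_ofNat]
    push_cast
    field_simp
    ring

end IsChart

/-- The coefficient matrix of the coframe in the coordinate forms has determinant `j (b + c a)`, and
`b + c a = S`. -/
theorem det_Θ (hj : j ^ 2 = -1) (hS : R.S y ≠ 0) (hP : R.P y ≠ 0) (hQ : R.Q y ≠ 0) :
    ((R.toCarter j).coframe.Θ y).det = R.S y * j * ((R.D y).det : ℂ) := by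
  have hS' : (R.S y : ℂ) ≠ 0 := by exact_mod_cast hS
  have hP' : (R.P y : ℂ) ≠ 0 := by exact_mod_cast hP
  have hQ' : (R.Q y : ℂ) ≠ 0 := by exact_mod_cast hQ
  set a : ℂ := R.c * R.x y ^ 2 + R.A₀ with ha
  set b : ℂ := R.r y ^ 2 - R.c * R.A₀ with hb
  have hab : b + R.c * a = R.S y := by
    rw [ha, hb, S]
    push_cast
    ring
  have e : (R.toCarter j).coframe.Θ y =
      !![R.Q y * (R.S y : ℂ)⁻¹ / 2, -(R.Q y * (R.S y : ℂ)⁻¹ / 2 * a), 0, 1 / 2;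
        1, -a, 0, -(R.S y * (R.Q y : ℂ)⁻¹);
        -(R.P y * (R.S y : ℂ)⁻¹ / 2 * j * R.c), -(R.P y * (R.S y : ℂ)⁻¹ / 2 * j * b), 1 / 2, 0;
        j * R.c, j * b, R.S y * (R.P y : ℂ)⁻¹, 0] * (R.D y).map Complex.ofReal := by
    ext α i
    fin_cases α
    · rw [show (R.toCarter j).coframe.Θ y ⟨0, by simp⟩ i = (R.toCarter j).coframe.θ 0 y i from rfl,
        θ₀_eq hj]
      simp [Matrix.mul_apply, Fin.sum_univ_four, D, time, ← ha]
      ring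
    · rw [show (R.toCarter j).coframe.Θ y ⟨1, by simp⟩ i = (R.toCarter j).coframe.θ 1 y i from rfl,
        θ₁_eq hj]
      simp [Matrix.mul_apply, Fin.sum_univ_four, D, time, ← ha]
      ring
    · rw [show (R.toCarter j).coframe.Θ y ⟨2, by simp⟩ i = (R.toCarter j).coframe.θ 2 y i from rfl,
        θ₂_eq hj]
      simp [Matrix.mul_apply, Fin.sum_univ_four, D, axial, ← hb]
      ring
    · rw [show (R.toCarter j).coframe.Θ y ⟨3, by simp⟩ i = (R.toCarter j).coframe.θ 3 y i from rfl,
        θ₃_eq hj]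
      simp [Matrix.mul_apply, Fin.sum_univ_four, D, axial, ← hb]
      ring
  rw [e, Matrix.det_mul, show (R.D y).map Complex.ofReal = Complex.ofRealHom.mapMatrix (R.D y)
    from rfl, ← RingHom.map_det]
  congr 1
  simp [Matrix.det_succ_row_zero, Fin.sum_univ_succ, Fin.succAbove]
  field_simp
  linear_combination 4 * j * hab

/-- Here `det g = -(S det D)²`, so the orientation asks for `-i det Θ = o S |det D|`. As `det Θ = j
S det D`, this forces `j = i o s` with `s` the sign of `det D`. -/
theorem IsChart.isOriented {V : Set Pt} (H : R.IsChart V) {g : MetricField}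
    (hg : ∀ y ∈ V, g y = R.metric y) (o : ℤˣ) {s : ℝ} (hs : s ^ 2 = 1)
    (hδ : ∀ y ∈ V, 0 < s * (R.D y).det) (hj : j = Complex.I * ((o : ℤ) : ℂ) * s) :
    (R.toCarter j).coframe.IsOriented g o V := by
  intro y hy
  have ho : (((o : ℤ) : ℂ)) ^ 2 = 1 := by
    rcases Int.units_eq_one_or o with rfl | rfl <;> simp
  have hs' : (s : ℂ) ^ 2 = 1 := by exact_mod_cast hs
  have hj2 : j ^ 2 = -1 := by
    rw [hj, mul_pow, mul_pow, Complex.I_sq, ho, hs']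
    ring
  have hd := det_Θ hj2 (H.S_pos y hy).ne' (H.P_pos y hy).ne' (H.Q_ne y hy)
  have h1 := (H.isNullCoframe hj2 hg).det_metric hy
  rw [hd] at h1
  have h2 : (g y).det = -(R.S y * (s * (R.D y).det)) ^ 2 := by
    have : ((g y).det : ℂ) = ((-(R.S y * (s * (R.D y).det)) ^ 2 : ℝ) : ℂ) := by
      rw [h1]
      push_cast
      linear_combination (R.S y : ℂ) ^ 2 * (R.D y).det ^ 2 * hj2
        + (R.S y : ℂ) ^ 2 * (R.D y).det ^ 2 * hs'
    exact_mod_cast this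
  rw [h2, abs_neg, abs_of_nonneg (sq_nonneg _),
    Real.sqrt_sq (mul_nonneg (H.S_pos y hy).le (hδ y hy).le), hd, hj]
  push_cast
  linear_combination ((o : ℤ) : ℂ) * R.S y * s * (R.D y).det * Complex.I_sq

end RealCarter

/-! ### Spin coefficients and gradients in the Carter–Plebański family -/

namespace IsNullCoframe

variable {g : MetricField} {V : Set Pt} {c : CoframeData} (h : IsNullCoframe g V c) {x : Pt}
include h

theorem dot_eq (hx : x ∈ V) (u v : Fin 4 → ℂ) : dot (invM g x) u v =
    -(ev u (c.E 0 x) * ev v (c.E 1 x) + ev u (c.E 1 x) * ev v (c.E 0 x))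
      + (ev u (c.E 2 x) * ev v (c.E 3 x) + ev u (c.E 3 x) * ev v (c.E 2 x)) := by
  have e : ∀ i k, invM g x i k = -(c.E 0 x i * c.E 1 x k + c.E 1 x i * c.E 0 x k)
      + (c.E 2 x i * c.E 3 x k + c.E 3 x i * c.E 2 x k) := fun i k => by
    rw [h.inv_eq hx]
    simp [Matrix.mul_apply, Fin.sum_univ_four, eta, CoframeData.F]
    ring
  rw [dot_apply]
  simp only [e, ev, Fin.sum_univ_four]
  ring

theorem dot_comm (hx : x ∈ V) (u v : Fin 4 → ℂ) : dot (invM g x) u v = dot (invM g x) v u := by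
  rw [h.dot_eq hx, h.dot_eq hx]
  ring

end IsNullCoframe

namespace Carter

variable {C : Carter} {V : Set Pt} {y : Pt}

theorem E₀_eq : C.coframe.E 0 y = C.vec (fun y => C.B y * (C.Q y)⁻¹)
    (fun y => -(C.c * (C.Q y)⁻¹)) (fun _ => 0) (fun _ => 1) y := rfl

theorem E₁_eq : C.coframe.E 1 y = C.vec (fun y => C.B y * (C.ζ y)⁻¹ * (C.ζ' y)⁻¹ / 2)
    (fun y => -(C.c * (C.ζ y)⁻¹ * (C.ζ' y)⁻¹ / 2)) (fun _ => 0)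
    (fun y => -(C.Q y * (C.ζ y)⁻¹ * (C.ζ' y)⁻¹ / 2)) y := rfl

theorem E₂_eq : C.coframe.E 2 y = C.vec (fun y => C.A y * (C.P y)⁻¹) (fun y => -(C.P y)⁻¹)
    (fun _ => 1) (fun _ => 0) y := rfl

theorem E₃_eq : C.coframe.E 3 y = C.vec (fun y => -(C.A y * (C.ζ y)⁻¹ * (C.ζ' y)⁻¹ / 2))
    (fun y => (C.ζ y)⁻¹ * (C.ζ' y)⁻¹ / 2) (fun y => C.P y * (C.ζ y)⁻¹ * (C.ζ' y)⁻¹ / 2)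
    (fun _ => 0) y := rfl

theorem κ₁_eq : C.coframe.κ₁ y = C.form (fun _ => 0) (fun y => -C.ζ y)
    (fun y => -(C.ζ y * (C.P y)⁻¹)) (fun y => -(C.c * C.ζ y * (C.Q y)⁻¹)) y := rfl

theorem ν₂_eq : C.coframe.ν₂ y = C.form (fun _ => 0)
    (fun y => -(C.P y * C.Q y * (C.ζ y)⁻¹ * ((C.ζ' y)⁻¹ * (C.ζ' y)⁻¹) / 4))
    (fun y => C.Q y * (C.ζ y)⁻¹ * ((C.ζ' y)⁻¹ * (C.ζ' y)⁻¹) / 4)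
    (fun y => C.c * C.P y * (C.ζ y)⁻¹ * ((C.ζ' y)⁻¹ * (C.ζ' y)⁻¹) / 4) y := rfl

namespace IsChart

variable (H : C.IsChart V) (hy : y ∈ V)
include H hy

theorem ev_form_vec (ft fφ fx fr vt vφ vx vr : Pt → ℂ) :
    ev (C.form ft fφ fx fr y) (C.vec vt vφ vx vr y) =
      ft y * vt y + fφ y * vφ y + fx y * vx y + fr y * vr y := H.form_vec hy _ _ _ _ _ _ _ _

theorem rho_eq : C.coframe.rho y = -(C.ζ' y)⁻¹ := by
  have hz := H.ζ_ne y hy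
  have hP := H.P_ne y hy
  rw [CoframeData.rho, κ₁_eq, E₃_eq, H.ev_form_vec hy]
  field_simp
  ring

theorem tau_eq : C.coframe.tau y = C.c * (C.ζ' y)⁻¹ := by
  have hz := H.ζ_ne y hy
  have hQ := H.Q_ne y hy
  rw [CoframeData.tau, κ₁_eq, E₁_eq, H.ev_form_vec hy]
  field_simp
  ring

theorem mu_eq : C.coframe.mu y = -(C.Q y * ((C.ζ y)⁻¹ * (C.ζ' y)⁻¹) / 2 * (C.ζ' y)⁻¹) := by
  have hP := H.P_ne y hy
  rw [CoframeData.mu, ν₂_eq, E₂_eq, H.ev_form_vec hy]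
  field_simp
  ring

theorem pi_eq : C.coframe.pi y =
    -(C.c * C.P y * ((C.ζ y)⁻¹ * (C.ζ' y)⁻¹) / 2 * (C.ζ' y)⁻¹) := by
  have hQ := H.Q_ne y hy
  rw [CoframeData.pi, ν₂_eq, E₀_eq, H.ev_form_vec hy]
  field_simp
  ring

theorem ev_κ₁_L : ev (C.coframe.κ₁ y) (C.coframe.E 0 y) = 0 := by
  rw [κ₁_eq, E₀_eq, H.ev_form_vec hy]
  ring

theorem ev_κ₁_M : ev (C.coframe.κ₁ y) (C.coframe.E 2 y) = 0 := by
  rw [κ₁_eq, E₂_eq, H.ev_form_vec hy]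
  ring

/-- `κ₁` vanishes on the frame vectors `E 0` and `E 2`, so two of the four terms remain. This is
where the derivative of the Weyl tensor meets the spin coefficients. -/
theorem dot_κ₁_ν₂ {g : MetricField} (h : IsNullCoframe g V C.coframe) :
    dot (invM g y) (C.coframe.κ₁ y) (C.coframe.ν₂ y) =
      C.coframe.tau y * C.coframe.pi y - C.coframe.rho y * C.coframe.mu y := by
  rw [h.dot_eq hy, H.ev_κ₁_L hy, H.ev_κ₁_M hy, CoframeData.tau, CoframeData.pi, CoframeData.rho,
    CoframeData.mu]
  ring

theorem dot_jet {g : MetricField} (h : IsNullCoframe g V C.coframe) (fr fx hr hx : ℂ) :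
    dot (invM g y) (fun i => fr * C.dr i + fx * C.dx y i) (fun i => hr * C.dr i + hx * C.dx y i) =
      (fr * hr * C.Q y + fx * hx * C.P y) * ((C.ζ y)⁻¹ * (C.ζ' y)⁻¹) := by
  have e : ∀ p q : ℂ, (fun i => p * C.dr i + q * C.dx y i) =
      C.form (fun _ => 0) (fun _ => 0) (fun _ => q) (fun _ => p) y := fun p q => by
    ext i
    simp only [form]
    ring
  rw [h.dot_eq hy, e, e, E₀_eq, E₁_eq, E₂_eq, E₃_eq]
  simp only [H.ev_form_vec hy]
  ring

/-- The cube of `ζ'⁻¹` accounts for `3ψ`. The charge term also contains `ζ⁻¹`, whose derivatives are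
`-ζ⁻²` and `-c ζ⁻²`; their signs relative to those of `ζ'⁻¹` produce `+2φ₁₁` in `r` and `-2φ₁₁` in
`x`. -/
theorem jet_ψ : C.HasJet C.ψ y (-(3 * C.ψ y + 2 * C.φ₁₁ y) * (C.ζ' y)⁻¹)
    (C.c * (3 * C.ψ y - 2 * C.φ₁₁ y) * (C.ζ' y)⁻¹) := by
  have h' := (H.jet_iζ' hy).pow 2
  refine (((hasJet_const (C.c * C.p₁ - C.m)).mul h').add
    (((hasJet_const C.w).mul h').mul (H.jet_iζ hy))).congr ?_ ?_ <;>
  · simp only [ψ, φ₁₁]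
    push_cast
    ring

theorem jet_ψ' : C.HasJet C.ψ' y (-(3 * C.ψ' y + 2 * C.φ₁₁ y) * (C.ζ y)⁻¹)
    (-(C.c * (3 * C.ψ' y - 2 * C.φ₁₁ y) * (C.ζ y)⁻¹)) := by
  have h' := (H.jet_iζ hy).pow 2
  refine (((hasJet_const (-C.c * C.p₁ - C.m)).mul h').add
    (((hasJet_const C.w).mul h').mul (H.jet_iζ' hy))).congr ?_ ?_ <;>
  · simp only [ψ', φ₁₁]
    push_cast
    ring

end IsChart

end Carter

/-! ### Scalars of type D frames in the Carter–Plebański family -/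

theorem gradDot_eq {g : MetricField} {f h : Pt → ℂ} {x : Pt} {d d' : Fin 4 → ℂ}
    (hf : HasPd f x d) (hh : HasPd h x d') : gradDot g f h x = dot (invM g x) d d' := by
  rw [gradDot, dot_apply]
  refine Finset.sum_congr rfl fun i _ => Finset.sum_congr rfl fun k _ => ?_
  rw [hf.pd, hh.pd, Complex.real_smul]
  simp only [invM, Matrix.map_apply]
  ring

theorem conj_eq_of_sq_eq_ofReal {z : ℂ} {t : ℝ} (ht : 0 ≤ t) (h : z ^ 2 = t) : conj z = z := by
  have h1 : z ^ 2 = ((Real.sqrt t : ℝ) : ℂ) ^ 2 := by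
    rw [h, ← Complex.ofReal_pow, Real.sq_sqrt ht]
  rcases sq_eq_sq_iff_eq_or_eq_neg.mp h1 with h2 | h2 <;> rw [h2] <;> simp

namespace RealCarter

variable {R : RealCarter} {y : Pt} {j : ℂ}

theorem conj_ζ (hj : conj j = -j) : conj ((R.toCarter j).ζ y) = (R.toCarter j).ζ' y := by
  simp only [Carter.ζ, Carter.ζ', toCarter, map_add, map_mul, Complex.conj_ofReal, hj]
  ring

theorem conj_ζ' (hj : conj j = -j) : conj ((R.toCarter j).ζ' y) = (R.toCarter j).ζ y := by
  rw [← conj_ζ hj, Complex.conj_conj]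

theorem conj_ψ (hj : conj j = -j) : conj ((R.toCarter j).ψ y) = (R.toCarter j).ψ' y := by
  simp only [Carter.ψ, Carter.ψ', map_add, map_mul, map_sub, map_pow, map_inv₀, conj_ζ hj,
    conj_ζ' hj]
  simp only [toCarter, map_mul, Complex.conj_ofReal, hj]
  ring

theorem norm_ζ'_sq (hj : j ^ 2 = -1) (hj' : conj j = -j) :
    ‖(R.toCarter j).ζ' y‖ ^ 2 = R.S y := by
  have h1 : ((‖(R.toCarter j).ζ' y‖ ^ 2 : ℝ) : ℂ) = R.S y := by
    rw [← toCarter_ζ_mul hj, ← conj_ζ' hj', mul_comm, Complex.mul_conj, Complex.normSq_eq_norm_sq]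
  exact_mod_cast h1

theorem φ₁₁_eq (hj : j ^ 2 = -1) : (R.toCarter j).φ₁₁ y = ((R.w / (2 * R.S y ^ 2) : ℝ) : ℂ) := by
  rw [Carter.φ₁₁, mul_assoc, ← mul_pow, toCarter_ζ_inv hj]
  simp only [toCarter]
  push_cast
  field_simp

/-- `V` carries an oriented chart of `R`, with metric `g`. -/
structure IsAdapted (R : RealCarter) (g : MetricField) (o : ℤˣ) (V : Set Pt) (j : ℂ) : Prop where
  j_sq : j ^ 2 = -1
  conj_j : conj j = -j
  chart : R.IsChart V
  null : IsNullCoframe g V (R.toCarter j).coframe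
  oriented : (R.toCarter j).coframe.IsOriented g o V

namespace IsAdapted

variable {g : MetricField} {o : ℤˣ} {V : Set Pt} (H : R.IsAdapted g o V j)
include H

theorem typeD : HasTypeDCurvature V (R.toCarter j).coframe (R.toCarter j).ψ (R.toCarter j).ψ'
    (R.toCarter j).φ₁₁ (R.toCarter j).Λ := (H.chart.toCarter H.j_sq).hasTypeDCurvature

theorem isReal : (R.toCarter j).coframe.IsReal V := H.chart.isReal H.j_sq H.conj_j

variable {U : Set Pt} {e : Tetrad} (hU : IsOpen U) (he : IsTypeDFrameOn g o e U) {x : Pt}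
  (hx : x ∈ V) (hxU : x ∈ U)
include hU he hx hxU

theorem scalars : Psi2 g e x = (R.toCarter j).ψ x ∧ Phi11 g e x = (R.toCarter j).φ₁₁ x ∧
    ∃ A : ℝ, A ≠ 0 ∧ ∃ z : ℂ, z ≠ 0 ∧
      ((spinRho g e x = A * (R.toCarter j).coframe.rho x ∧
        spinMu g e x = (A : ℂ)⁻¹ * (R.toCarter j).coframe.mu x ∧
        spinTau g e x = z * (R.toCarter j).coframe.tau x ∧
        spinPi g e x = z⁻¹ * (R.toCarter j).coframe.pi x) ∨
      (spinRho g e x = -(A * (R.toCarter j).coframe.mu x) ∧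
        spinMu g e x = -((A : ℂ)⁻¹ * (R.toCarter j).coframe.rho x) ∧
        spinTau g e x = -(z * (R.toCarter j).coframe.pi x) ∧
        spinPi g e x = -(z⁻¹ * (R.toCarter j).coframe.tau x))) :=
  H.null.typeDFrame_scalars H.typeD H.oriented H.isReal (fun _ _ => (conj_ψ H.conj_j).symm) hU he hx
    hxU

/-- The boost factors cancel in the product, and so do the signs of the exchanged alignment; hence
the value is the same in every type D frame. -/
theorem rho_mul_mu : spinRho g e x * spinMu g e x =
    R.Q x / (2 * R.S x) * ((R.toCarter j).ζ' x)⁻¹ ^ 2 := by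
  have hS : (R.S x : ℂ) ≠ 0 := by exact_mod_cast (H.chart.S_pos x hx).ne'
  have hC := H.chart.toCarter H.j_sq
  have e1 : spinRho g e x * spinMu g e x =
      (R.toCarter j).coframe.rho x * (R.toCarter j).coframe.mu x := by
    obtain ⟨-, -, A, hA, z, hz, h | h⟩ := H.scalars hU he hx hxU
    all_goals
      have hA' : (A : ℂ) ≠ 0 := by exact_mod_cast hA
      rw [h.1, h.2.1]
      field_simp
  rw [e1, hC.rho_eq hx, hC.mu_eq hx, toCarter_ζ_inv H.j_sq, toCarter_Q H.j_sq]
  field_simp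

theorem tau_mul_pi : spinTau g e x * spinPi g e x =
    R.c ^ 2 * R.P x / (2 * R.S x) * ((R.toCarter j).ζ' x)⁻¹ ^ 2 := by
  have hS : (R.S x : ℂ) ≠ 0 := by exact_mod_cast (H.chart.S_pos x hx).ne'
  have hC := H.chart.toCarter H.j_sq
  have e1 : spinTau g e x * spinPi g e x =
      (R.toCarter j).coframe.tau x * (R.toCarter j).coframe.pi x := by
    obtain ⟨-, -, A, hA, z, hz, h | h⟩ := H.scalars hU he hx hxU
    all_goals
      rw [h.2.2.1, h.2.2.2]
      field_simp
  rw [e1, hC.tau_eq hx, hC.pi_eq hx, toCarter_ζ_inv H.j_sq, toCarter_P H.j_sq, toCarter_c]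
  field_simp
  linear_combination -(R.c ^ 2 * R.P x) * ((R.toCarter j).ζ' x)⁻¹ ^ 2 * H.j_sq

/-- With boost factor `A`, the condition `ρ = μ` reads `A² = Q/(2S)`, or `A⁻² = Q/(2S)` for the
exchanged alignment. Canonical frames thus live only where `Q > 0`. -/
theorem Q_pos (h : spinRho g e x = spinMu g e x) : 0 < R.Q x := by
  have hS := H.chart.S_pos x hx
  have hS' : (R.S x : ℂ) ≠ 0 := by exact_mod_cast hS.ne'
  have hC := H.chart.toCarter H.j_sq
  have hz := hC.ζ'_ne x hx
  obtain ⟨-, -, A, hA, z, -, h' | h'⟩ := H.scalars hU he hx hxU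
  all_goals
    have hA' : (A : ℂ) ≠ 0 := by exact_mod_cast hA
    rw [h'.1, h'.2.1, hC.rho_eq hx, hC.mu_eq hx, toCarter_ζ_inv H.j_sq, toCarter_Q H.j_sq] at h
    field_simp at h
  · have h2 : A ^ 2 * (2 * R.S x) = R.Q x := by
      have : ((A ^ 2 * (2 * R.S x) : ℝ) : ℂ) = (R.Q x : ℝ) := by
        push_cast
        linear_combination -h
      exact_mod_cast this
    rw [← h2]
    positivity
  · have h2 : A ^ 2 * R.Q x = 2 * R.S x := by
      have : ((A ^ 2 * R.Q x : ℝ) : ℂ) = ((2 * R.S x : ℝ) : ℂ) := by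
        push_cast
        linear_combination h
      exact_mod_cast this
    by_contra h0
    have : A ^ 2 * R.Q x ≤ 0 := mul_nonpos_of_nonneg_of_nonpos (sq_nonneg A) (not_lt.mp h0)
    linarith

/-- The modulus of `ρ² = ρμ`, with `‖ζ'‖² = S`. -/
theorem norm_rho_sq (h : spinRho g e x = spinMu g e x) :
    ‖spinRho g e x‖ ^ 2 = R.Q x / (2 * R.S x ^ 2) := by
  have hS := H.chart.S_pos x hx
  have hQ := H.Q_pos hU he hx hxU h
  have h1 := congrArg norm (H.rho_mul_mu hU he hx hxU)
  rw [← h, norm_mul, norm_mul, norm_pow, norm_inv, inv_pow, norm_ζ'_sq H.j_sq H.conj_j] at h1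
  rw [sq, h1, show (R.Q x / (2 * R.S x) : ℂ) = ((R.Q x / (2 * R.S x) : ℝ) : ℂ) by push_cast; rfl,
    Complex.norm_real, Real.norm_of_nonneg (by positivity)]
  field_simp

theorem norm_tau_sq (h : spinTau g e x = spinPi g e x) :
    ‖spinTau g e x‖ ^ 2 = R.c ^ 2 * R.P x / (2 * R.S x ^ 2) := by
  have hS := H.chart.S_pos x hx
  have hP := H.chart.P_pos x hx
  have h1 := congrArg norm (H.tau_mul_pi hU he hx hxU)
  rw [← h, norm_mul, norm_mul, norm_pow, norm_inv, inv_pow, norm_ζ'_sq H.j_sq H.conj_j] at h1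
  rw [sq, h1, show (R.c ^ 2 * R.P x / (2 * R.S x) : ℂ) =
    ((R.c ^ 2 * R.P x / (2 * R.S x) : ℝ) : ℂ) by push_cast; rfl,
    Complex.norm_real, Real.norm_of_nonneg (by positivity)]
  field_simp

/-- In a canonical frame `τ` is a real multiple of `ρ`. -/
theorem exists_tau_eq (h : spinRho g e x = spinMu g e x) (h' : spinTau g e x = spinPi g e x) :
    spinRho g e x ≠ 0 ∧ ∃ t : ℝ, spinTau g e x = t * spinRho g e x := by
  have hS := H.chart.S_pos x hx
  have hP := H.chart.P_pos x hx
  have hQ := H.Q_pos hU he hx hxU h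
  have hS' : (R.S x : ℂ) ≠ 0 := by exact_mod_cast hS.ne'
  have hQ' : (R.Q x : ℂ) ≠ 0 := by exact_mod_cast hQ.ne'
  have hz := (H.chart.toCarter H.j_sq).ζ'_ne x hx
  have h1 := H.rho_mul_mu hU he hx hxU
  have h2 := H.tau_mul_pi hU he hx hxU
  rw [← h] at h1
  rw [← h'] at h2
  have hρ : spinRho g e x ≠ 0 := by
    intro h0
    rw [h0, zero_mul] at h1
    have : (R.Q x / (2 * R.S x) * ((R.toCarter j).ζ' x)⁻¹ ^ 2 : ℂ) ≠ 0 :=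
      mul_ne_zero (div_ne_zero hQ' (mul_ne_zero two_ne_zero hS')) (pow_ne_zero 2 (inv_ne_zero hz))
    exact this h1.symm
  refine ⟨hρ, ?_⟩
  -- The phase `ζ'⁻²` common to `ρμ` and `τπ` cancels in the quotient, leaving a nonnegative real
  -- square.
  have h3 : (spinTau g e x / spinRho g e x) ^ 2 = ((R.c ^ 2 * R.P x / R.Q x : ℝ) : ℂ) := by
    rw [div_pow, sq, sq, h1, h2]
    push_cast
    field_simp
  obtain ⟨t, ht⟩ := Complex.conj_eq_iff_real.mp (conj_eq_of_sq_eq_ofReal (by positivity) h3)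
  exact ⟨t, by rw [← ht, div_mul_cancel₀ _ hρ]⟩

theorem phi11_eq : Phi11 g e x = ((R.w / (2 * R.S x ^ 2) : ℝ) : ℂ) :=
  (H.scalars hU he hx hxU).2.1.trans (φ₁₁_eq H.j_sq)

theorem hasPd_psi2 : HasPd (Psi2 g e) x (fun i =>
    -(3 * (R.toCarter j).ψ x + 2 * (R.toCarter j).φ₁₁ x) * ((R.toCarter j).ζ' x)⁻¹ *
      (R.toCarter j).dr i + (R.toCarter j).c * (3 * (R.toCarter j).ψ x
      - 2 * (R.toCarter j).φ₁₁ x) * ((R.toCarter j).ζ' x)⁻¹ * (R.toCarter j).dx x i) :=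
  HasPd.congr (hU.inter H.chart.isOpen) ⟨hxU, hx⟩
    (fun _ hy => (H.scalars hU he hy.2 hy.1).1) ((H.chart.toCarter H.j_sq).jet_ψ hx)

theorem hasPd_conj_psi2 : HasPd (fun y => conj (Psi2 g e y)) x (fun i =>
    -(3 * (R.toCarter j).ψ' x + 2 * (R.toCarter j).φ₁₁ x) * ((R.toCarter j).ζ x)⁻¹ *
      (R.toCarter j).dr i + -((R.toCarter j).c * (3 * (R.toCarter j).ψ' x
      - 2 * (R.toCarter j).φ₁₁ x) * ((R.toCarter j).ζ x)⁻¹) * (R.toCarter j).dx x i) :=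
  HasPd.congr (hU.inter H.chart.isOpen) ⟨hxU, hx⟩
    (fun _ hy => by rw [(H.scalars hU he hy.2 hy.1).1, conj_ψ H.conj_j])
    ((H.chart.toCarter H.j_sq).jet_ψ' hx)

/-- The weights `Q/S` and `P/S` of the inverse metric are, with the `ζ'⁻²` from `jet_ψ`, twice those
in `ρμ` and `τπ`. The minus sign is `j² = -1`, since the `x` derivative carries a factor `j c`. -/
theorem gradDot_psi2 : gradDot g (Psi2 g e) (Psi2 g e) x =
    2 * ((3 * Psi2 g e x + 2 * Phi11 g e x) ^ 2 * (spinRho g e x * spinMu g e x)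
      - (3 * Psi2 g e x - 2 * Phi11 g e x) ^ 2 * (spinTau g e x * spinPi g e x)) := by
  have hS' : (R.S x : ℂ) ≠ 0 := by exact_mod_cast (H.chart.S_pos x hx).ne'
  have h1 := H.hasPd_psi2 hU he hx hxU
  obtain ⟨e1, e2, -⟩ := H.scalars hU he hx hxU
  rw [gradDot_eq h1 h1, (H.chart.toCarter H.j_sq).dot_jet hx H.null, H.rho_mul_mu hU he hx hxU,
    H.tau_mul_pi hU he hx hxU, e1, e2, toCarter_ζ_inv H.j_sq, toCarter_P H.j_sq, toCarter_Q H.j_sq,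
    toCarter_c]
  field_simp
  linear_combination R.P x * R.c ^ 2 * (3 * (R.toCarter j).ψ x - 2 * (R.toCarter j).φ₁₁ x) ^ 2 *
    ((R.toCarter j).ζ' x)⁻¹ ^ 2 * H.j_sq

theorem gradDot_psi2_conj : gradDot g (Psi2 g e) (fun y => conj (Psi2 g e y)) x =
    ((3 * Psi2 g e x + 2 * Phi11 g e x) * (3 * conj (Psi2 g e x) + 2 * Phi11 g e x) * R.Q x
      + R.c ^ 2 * (3 * Psi2 g e x - 2 * Phi11 g e x) * (3 * conj (Psi2 g e x) - 2 * Phi11 g e x) *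
        R.P x) / R.S x ^ 2 := by
  have hS' : (R.S x : ℂ) ≠ 0 := by exact_mod_cast (H.chart.S_pos x hx).ne'
  obtain ⟨e1, e2, -⟩ := H.scalars hU he hx hxU
  have h0 := toCarter_ζ_inv (R := R) (y := x) H.j_sq
  rw [gradDot_eq (H.hasPd_psi2 hU he hx hxU) (H.hasPd_conj_psi2 hU he hx hxU),
    (H.chart.toCarter H.j_sq).dot_jet hx H.null, e1, e2, conj_ψ H.conj_j, h0, toCarter_P H.j_sq,
    toCarter_Q H.j_sq, toCarter_c, div_eq_mul_inv, ← inv_pow, ← h0]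
  linear_combination -R.P x * R.c ^ 2 * (3 * (R.toCarter j).ψ x - 2 * (R.toCarter j).φ₁₁ x) *
    (3 * (R.toCarter j).ψ' x - 2 * (R.toCarter j).φ₁₁ x) *
    (((R.toCarter j).ζ x)⁻¹ * ((R.toCarter j).ζ' x)⁻¹) ^ 2 * H.j_sq

theorem I3_add_I4 : (I3 g x : ℂ) + Complex.I * I4 g o x =
    48 * gradDot g (Psi2 g e) (Psi2 g e) x +
      576 * Psi2 g e x ^ 2 * (spinRho g e x * spinMu g e x - spinTau g e x * spinPi g e x) := by
  have hC := H.chart.toCarter H.j_sq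
  have h1 := H.hasPd_psi2 hU he hx hxU
  rw [H.null.I3_add_I4 H.typeD H.oriented hx (hC.jet_ψ hx) (hC.jet_ψ' hx), gradDot_eq h1 h1,
    H.null.dot_comm hx (R.toCarter j |>.coframe.ν₂ x), hC.dot_κ₁_ν₂ hx H.null]
  obtain ⟨e1, e2, A, hA, z, hz, h | h⟩ := H.scalars hU he hx hxU
  all_goals
    have hA' := mul_inv_cancel₀ (show (A : ℂ) ≠ 0 by exact_mod_cast hA)
    have hz' := mul_inv_cancel₀ hz
    rw [e1, h.1, h.2.1, h.2.2.1, h.2.2.2]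
    linear_combination 576 * (R.toCarter j).ψ x ^ 2 *
      ((R.toCarter j).coframe.tau x * (R.toCarter j).coframe.pi x * hz'
        - (R.toCarter j).coframe.rho x * (R.toCarter j).coframe.mu x * hA')

theorem I1_eq : (I1 g x : ℂ) = 24 * (Psi2 g e x ^ 2 + conj (Psi2 g e x) ^ 2) := by
  rw [H.null.I1_eq H.typeD hx, (H.scalars hU he hx hxU).1, conj_ψ H.conj_j]

theorem I2_eq : (I2 g o x : ℂ) = 24 * Complex.I * (conj (Psi2 g e x) ^ 2 - Psi2 g e x ^ 2) := by
  rw [H.null.I2_eq H.typeD H.oriented hx, (H.scalars hU he hx hxU).1, conj_ψ H.conj_j]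

end IsAdapted

end RealCarter

/-! ### Gradient invariants of a complex scalar -/

theorem dot_conj (g : MetricField) (x : Pt) (u v : Fin 4 → ℂ) :
    conj (dot (invM g x) u v) = dot (invM g x) (fun i => conj (u i)) fun i => conj (v i) := by
  simp [dot_apply, map_sum, invM]

theorem gradDot_ofReal (g : MetricField) (f h : Pt → ℝ) (x : Pt) :
    ((gradDot g f h x : ℝ) : ℂ) = gradDot g (fun y => (f y : ℂ)) (fun y => (h y : ℂ)) x := by
  simp only [gradDot, pd_ofReal, Complex.real_smul, smul_eq_mul, Complex.ofReal_sum,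
    Complex.ofReal_mul]

theorem wedgeNormSq_eq {g : MetricField} {f h : Pt → ℂ} {x : Pt} {d d' : Fin 4 → ℂ}
    (hf : HasPd f x d) (hh : HasPd h x d') : wedgeNormSq g f h x =
    1 / 2 * (dot (invM g x) d d * dot (invM g x) d' d'
      - dot (invM g x) d' d * dot (invM g x) d d') := by
  have e1 : ∑ a, ∑ b, ∑ c, ∑ k, ∑ p, ∑ q, kroneckerDelta2 a b c k * ((g x)⁻¹ c p : ℂ) *
      ((g x)⁻¹ k q : ℂ) * pd a f x * pd b h x * pd p f x * pd q h x =
      ∑ a, ∑ b, ∑ p, ∑ q, (invM g x a p * invM g x b q - invM g x b p * invM g x a q) *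
        (d a * d' b * d p * d' q) := by
    refine Finset.sum_congr rfl fun a _ => Finset.sum_congr rfl fun b _ => ?_
    have e2 : ∀ c k, ∑ p, ∑ q, kroneckerDelta2 a b c k * ((g x)⁻¹ c p : ℂ) *
        ((g x)⁻¹ k q : ℂ) * pd a f x * pd b h x * pd p f x * pd q h x =
        ((if a = c then if b = k then 1 else 0 else 0)
          - (if b = c then if a = k then 1 else 0 else 0)) *
        ∑ p, ∑ q, invM g x c p * invM g x k q * (d a * d' b * d p * d' q) := fun c k => by
      rw [Finset.mul_sum]
      refine Finset.sum_congr rfl fun p _ => ?_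
      rw [Finset.mul_sum]
      refine Finset.sum_congr rfl fun q _ => ?_
      have e3 : kroneckerDelta2 a b c k = (if a = c then if b = k then 1 else 0 else 0)
          - (if b = c then if a = k then 1 else 0 else 0) := by
        rw [kroneckerDelta2]
        congr 1 <;> split_ifs <;> simp_all
      rw [hf.pd, hf.pd, hh.pd, hh.pd, e3]
      simp only [invM, Matrix.map_apply]
      ring
    simp only [e2, sub_mul, Finset.sum_sub_distrib, ite_mul, zero_mul, one_mul]
    simp only [Finset.sum_ite_eq, Finset.mem_univ, if_true, ← Finset.sum_sub_distrib]
    simp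
  rw [wedgeNormSq, e1]
  simp only [dot_apply, Finset.sum_mul_sum]
  congr 1
  simp only [Fin.sum_univ_four]
  ring

section Gradient

variable {g : MetricField} {o : ℤˣ} {W : Set Pt} (hW : IsOpen W) {x : Pt} (hx : x ∈ W)
  {f : Pt → ℂ} {d : Fin 4 → ℂ} (hf : HasPd f x d)
  (hsymm : ∀ u v, dot (invM g x) u v = dot (invM g x) v u)
  (h1 : ∀ y ∈ W, (I1 g y : ℂ) = 24 * (f y ^ 2 + conj (f y) ^ 2))
  (h2 : ∀ y ∈ W, (I2 g o y : ℂ) = 24 * Complex.I * (conj (f y) ^ 2 - f y ^ 2))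

include hW hx hf h1 in
theorem hasPd_I1 : HasPd (fun y => (I1 g y : ℂ)) x
    ((48 * f x) • d + (48 * conj (f x)) • fun i => conj (d i)) := by
  have h := ((hf.mul hf).add (hf.conj.mul hf.conj)).const_mul 24
  refine HasPd.congr hW hx (fun y hy => ?_) (h.congr_deriv fun i => ?_)
  · rw [h1 y hy]
    ring
  · simp only [Pi.add_apply, Pi.smul_apply, smul_eq_mul]
    ring

include hW hx hf h2 in
theorem hasPd_I2 : HasPd (fun y => (I2 g o y : ℂ)) x
    ((48 * Complex.I * conj (f x)) • (fun i => conj (d i)) - (48 * Complex.I * f x) • d) := by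
  have h := ((hf.conj.mul hf.conj).sub (hf.mul hf)).const_mul (24 * Complex.I)
  refine HasPd.congr hW hx (fun y hy => ?_) (h.congr_deriv fun i => ?_)
  · rw [h2 y hy]
    ring
  · simp only [Pi.sub_apply, Pi.smul_apply, smul_eq_mul]
    ring

-- The squared norm of `dI₁ = 48 (f df + f̄ df̄)`. The next two results expand the other products,
-- with `dI₂ = 48 i (f̄ df̄ - f df)`, for any scalar `f` with `I₁ + i I₂ = 48 f²`.
include hW hx hf hsymm h1 in
theorem I5_eq : (I5 g x : ℂ) = 96 ^ 2 * (f x ^ 2 * gradDot g f f x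
    + conj (f x ^ 2 * gradDot g f f x)
    + 2 * (f x * conj (f x)) * gradDot g f (fun y => conj (f y)) x) / 4 := by
  have e := hasPd_I1 hW hx hf h1
  rw [I5, gradDot_ofReal, gradDot_eq e e, gradDot_eq hf hf, gradDot_eq hf hf.conj, map_mul,
    dot_conj, map_pow]
  simp only [map_add, map_smul, LinearMap.add_apply, LinearMap.smul_apply, smul_eq_mul]
  rw [hsymm (fun i => conj (d i)) d]
  ring

include hW hx hf hsymm h2 in
theorem I6_eq : (I6 g o x : ℂ) = 96 ^ 2 * (-(f x ^ 2 * gradDot g f f x)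
    - conj (f x ^ 2 * gradDot g f f x)
    + 2 * (f x * conj (f x)) * gradDot g f (fun y => conj (f y)) x) / 4 := by
  have e := hasPd_I2 hW hx hf h2
  rw [I6, gradDot_ofReal, gradDot_eq e e, gradDot_eq hf hf, gradDot_eq hf hf.conj, map_mul,
    dot_conj, map_pow]
  simp only [map_sub, map_smul, LinearMap.sub_apply, LinearMap.smul_apply, smul_eq_mul]
  rw [hsymm (fun i => conj (d i)) d]
  linear_combination 48 ^ 2 * (f x ^ 2 * dot (invM g x) d d
    + conj (f x) ^ 2 * dot (invM g x) (fun i => conj (d i)) (fun i => conj (d i))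
    - 2 * (f x * conj (f x)) * dot (invM g x) d fun i => conj (d i)) * Complex.I_sq

include hW hx hf hsymm h1 h2 in
theorem I7_eq : (I7 g o x : ℂ) = 96 ^ 2 * (f x ^ 2 * gradDot g f f x
    - conj (f x ^ 2 * gradDot g f f x)) / (4 * Complex.I) := by
  rw [I7, gradDot_ofReal, gradDot_eq (hasPd_I1 hW hx hf h1) (hasPd_I2 hW hx hf h2),
    gradDot_eq hf hf, map_mul, dot_conj, map_pow, eq_div_iff (by simp)]
  simp only [map_add, map_sub, map_smul, LinearMap.add_apply, LinearMap.smul_apply, smul_eq_mul]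
  rw [hsymm (fun i => conj (d i)) d]
  linear_combination 96 ^ 2 * (conj (f x) ^ 2 * dot (invM g x) (fun i => conj (d i))
    (fun i => conj (d i)) - f x ^ 2 * dot (invM g x) d d) * Complex.I_sq

end Gradient

/-! ### The dimensionless combinations -/

/-- Together with `I1_sq_add_I2_sq` it turns the exponents `9/4`, `5/2` and `5/4` into natural ones.
-/
theorem rpow_div_four {b : ℝ} (hb : 0 ≤ b) (n : ℕ) : (b ^ 4) ^ ((n : ℝ) / 4) = b ^ n := by
  rw [← Real.rpow_natCast b 4, ← Real.rpow_mul hb, ← Real.rpow_natCast b n]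
  congr 1
  push_cast
  ring

section Quotients

variable {g : MetricField} {o : ℤˣ} {x : Pt} {Ψ G : ℂ} {H : ℝ} (hΨ : Ψ ≠ 0)
  (h1 : (I1 g x : ℂ) = 24 * (Ψ ^ 2 + conj Ψ ^ 2))
  (h2 : (I2 g o x : ℂ) = 24 * Complex.I * (conj Ψ ^ 2 - Ψ ^ 2))
  (h5 : (I5 g x : ℂ) = 96 ^ 2 * (Ψ ^ 2 * G + conj (Ψ ^ 2 * G) + 2 * (Ψ * conj Ψ) * H) / 4)
  (h6 : (I6 g o x : ℂ) = 96 ^ 2 * (-(Ψ ^ 2 * G) - conj (Ψ ^ 2 * G) + 2 * (Ψ * conj Ψ) * H) / 4)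
  (h7 : (I7 g o x : ℂ) = 96 ^ 2 * (Ψ ^ 2 * G - conj (Ψ ^ 2 * G)) / (4 * Complex.I))

-- `I₁² + I₂² = |48 Ψ²|²`, written as a fourth power with `√48 = 4√3`.
include h1 h2 in
theorem I1_sq_add_I2_sq : I1 g x ^ 2 + I2 g o x ^ 2 = (4 * Real.sqrt 3 * ‖Ψ‖) ^ 4 := by
  have h3 : Real.sqrt 3 ^ 2 = 3 := Real.sq_sqrt (by norm_num)
  have e : ((I1 g x ^ 2 + I2 g o x ^ 2 : ℝ) : ℂ) = ((48 ^ 2 * (‖Ψ‖ ^ 2) ^ 2 : ℝ) : ℂ) := by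
    push_cast
    rw [h1, h2, ← Complex.conj_mul' Ψ]
    linear_combination 24 ^ 2 * (conj Ψ ^ 2 - Ψ ^ 2) ^ 2 * Complex.I_sq
  rw [Complex.ofReal_inj.mp e]
  linear_combination -(16 ^ 2 * ‖Ψ‖ ^ 4 * (Real.sqrt 3 ^ 2 + 3)) * h3

include hΨ h1 h2 h5 h6 h7 in
theorem Q1_eq : Q1 g o x = (conj Ψ ^ 2 * G).re / (9 * ‖Ψ‖ ^ 5) := by
  have hn : ‖Ψ‖ ≠ 0 := norm_ne_zero_iff.mpr hΨ
  have h3 : Real.sqrt 3 ^ 2 = 3 := Real.sq_sqrt (by norm_num)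
  have h30 : Real.sqrt 3 ≠ 0 := by positivity
  have e : (I1 g x ^ 2 - I2 g o x ^ 2) * (I5 g x - I6 g o x) + 4 * I1 g x * I2 g o x * I7 g o x
      = 48 ^ 2 * 96 ^ 2 * ‖Ψ‖ ^ 4 * (conj Ψ ^ 2 * G).re := by
    have : (((I1 g x ^ 2 - I2 g o x ^ 2) * (I5 g x - I6 g o x) +
        4 * I1 g x * I2 g o x * I7 g o x : ℝ) : ℂ) =
        ((48 ^ 2 * 96 ^ 2 * (‖Ψ‖ ^ 2) ^ 2 * (conj Ψ ^ 2 * G).re : ℝ) : ℂ) := by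
      push_cast
      rw [h1, h2, h5, h6, h7, ← Complex.conj_mul' Ψ, Complex.re_eq_add_conj]
      simp only [map_mul, map_pow, Complex.conj_conj]
      field_simp
      linear_combination (-(48 ^ 2) * (conj Ψ ^ 2 - Ψ ^ 2) ^ 2 *
        (Ψ ^ 2 * G + conj Ψ ^ 2 * conj G)) * Complex.I_sq
    rw [Complex.ofReal_inj.mp this]
    ring
  rw [Q1, e, I1_sq_add_I2_sq h1 h2,
    show (9 / 4 : ℝ) = ((9 : ℕ) : ℝ) / 4 by norm_num, rpow_div_four (by positivity)]
  rw [div_eq_div_iff (by positivity) (by positivity)]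
  have : Real.sqrt 3 ^ 10 = 3 ^ 5 := by rw [show (10 : ℕ) = 2 * 5 by norm_num, pow_mul, h3]
  linear_combination -(3 * 4 ^ 9 * ‖Ψ‖ ^ 9 * (conj Ψ ^ 2 * G).re) * this

-- With `u = Ψ² G`, the numerator is a constant times `4|Ψ|⁴H² - (u + ū)² + (u - ū)² = 4|Ψ|⁴(H² -
-- |G|²)`, so the phase of `Ψ` disappears.
include hΨ h1 h2 h5 h6 h7 in
theorem Q2_eq : (Q2 g o x : ℂ) = (H ^ 2 - G * conj G) / (18 ^ 2 * (‖Ψ‖ : ℂ) ^ 6) := by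
  have hn : (‖Ψ‖ : ℂ) ≠ 0 := by exact_mod_cast norm_ne_zero_iff.mpr hΨ
  have h3 : Real.sqrt 3 ^ 2 = 3 := Real.sq_sqrt (by norm_num)
  have e : (I5 g x * I6 g o x - I7 g o x ^ 2 : ℂ) =
      96 ^ 4 / 4 * ((‖Ψ‖ : ℂ) ^ 2) ^ 2 * (H ^ 2 - G * conj G) := by
    rw [h5, h6, h7, ← Complex.conj_mul' Ψ]
    simp only [map_mul, map_pow]
    field_simp
    linear_combination -(Ψ ^ 2 * G - conj Ψ ^ 2 * conj G) ^ 2 * Complex.I_sq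
  have e2 : (I1 g x ^ 2 + I2 g o x ^ 2) ^ (5 / 2 : ℝ) = 48 ^ 5 * ‖Ψ‖ ^ 10 := by
    rw [I1_sq_add_I2_sq h1 h2, show (5 / 2 : ℝ) = ((10 : ℕ) : ℝ) / 4 by norm_num,
      rpow_div_four (by positivity)]
    have : Real.sqrt 3 ^ 10 = 3 ^ 5 := by rw [show (10 : ℕ) = 2 * 5 by norm_num, pow_mul, h3]
    rw [mul_pow, mul_pow, this]
    norm_num
  rw [Q2, e2]
  push_cast
  rw [e]
  field_simp
  ring

include hΨ h1 h2 h5 h6 in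
theorem Q3_eq : Q3 g o x = H / (18 * ‖Ψ‖ ^ 3) := by
  have hn : ‖Ψ‖ ≠ 0 := norm_ne_zero_iff.mpr hΨ
  have h3 : Real.sqrt 3 ^ 2 = 3 := Real.sq_sqrt (by norm_num)
  have h30 : Real.sqrt 3 ≠ 0 := by positivity
  have e : I5 g x + I6 g o x = 96 ^ 2 * ‖Ψ‖ ^ 2 * H := by
    have : ((I5 g x + I6 g o x : ℝ) : ℂ) = ((96 ^ 2 * ‖Ψ‖ ^ 2 * H : ℝ) : ℂ) := by
      push_cast
      rw [h5, h6, ← Complex.conj_mul' Ψ]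
      ring
    exact Complex.ofReal_inj.mp this
  rw [Q3, e, I1_sq_add_I2_sq h1 h2,
    show (5 / 4 : ℝ) = ((5 : ℕ) : ℝ) / 4 by norm_num, rpow_div_four (by positivity),
    div_eq_div_iff (by positivity) (by positivity)]
  have : Real.sqrt 3 ^ 6 = 3 ^ 3 := by rw [show (6 : ℕ) = 2 * 3 by norm_num, pow_mul, h3]
  linear_combination -(6 * 4 ^ 5 * ‖Ψ‖ ^ 5 * H) * this

end Quotients

/-! ### The invariants of the Carter–Plebański family -/

namespace RealCarter.IsAdapted

variable {R : RealCarter} {j : ℂ} {g : MetricField} {o : ℤˣ} {V : Set Pt}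
  (H : R.IsAdapted g o V j) {U : Set Pt} {e : Tetrad} (hU : IsOpen U)
  (he : IsTypeDFrameOn g o e U) {x : Pt} (hx : x ∈ V) (hxU : x ∈ U)
include H hU he hx hxU

/-- The product of a gradient with its conjugate is invariant under conjugation, by symmetry of the
metric. The formulas for `Q₁`, `Q₂`, `Q₃` require it as a real number `H`. -/
theorem exists_gradDot_conj :
    ∃ t : ℝ, gradDot g (Psi2 g e) (fun y => conj (Psi2 g e y)) x = t := by
  have h1 := H.hasPd_psi2 hU he hx hxU
  have h2 : conj (gradDot g (Psi2 g e) (fun y => conj (Psi2 g e y)) x) =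
      gradDot g (Psi2 g e) (fun y => conj (Psi2 g e y)) x := by
    rw [gradDot_eq h1 h1.conj, dot_conj, H.null.dot_comm hx]
    simp only [Complex.conj_conj]
  exact Complex.conj_eq_iff_real.mp h2

theorem I1_add_I2 : (I1 g x : ℂ) + Complex.I * I2 g o x = 48 * Psi2 g e x ^ 2 := by
  rw [H.I1_eq hU he hx hxU, H.I2_eq hU he hx hxU]
  linear_combination 24 * (conj (Psi2 g e x) ^ 2 - Psi2 g e x ^ 2) * Complex.I_sq

theorem I5_eq : (I5 g x : ℂ) = 96 ^ 2 * (Psi2 g e x ^ 2 * gradDot g (Psi2 g e) (Psi2 g e) x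
    + conj (Psi2 g e x ^ 2 * gradDot g (Psi2 g e) (Psi2 g e) x)
    + 2 * (Psi2 g e x * conj (Psi2 g e x)) *
      gradDot g (Psi2 g e) (fun y => conj (Psi2 g e y)) x) / 4 :=
  BlackHoleInvariants.I5_eq (hU.inter H.chart.isOpen) ⟨hxU, hx⟩ (H.hasPd_psi2 hU he hx hxU)
    (H.null.dot_comm hx) fun _ hy => H.I1_eq hU he hy.2 hy.1

theorem I6_eq : (I6 g o x : ℂ) = 96 ^ 2 * (-(Psi2 g e x ^ 2 * gradDot g (Psi2 g e) (Psi2 g e) x)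
    - conj (Psi2 g e x ^ 2 * gradDot g (Psi2 g e) (Psi2 g e) x)
    + 2 * (Psi2 g e x * conj (Psi2 g e x)) *
      gradDot g (Psi2 g e) (fun y => conj (Psi2 g e y)) x) / 4 :=
  BlackHoleInvariants.I6_eq (hU.inter H.chart.isOpen) ⟨hxU, hx⟩ (H.hasPd_psi2 hU he hx hxU)
    (H.null.dot_comm hx) fun _ hy => H.I2_eq hU he hy.2 hy.1

theorem I7_eq : (I7 g o x : ℂ) = 96 ^ 2 * (Psi2 g e x ^ 2 * gradDot g (Psi2 g e) (Psi2 g e) x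
    - conj (Psi2 g e x ^ 2 * gradDot g (Psi2 g e) (Psi2 g e) x)) / (4 * Complex.I) :=
  BlackHoleInvariants.I7_eq (hU.inter H.chart.isOpen) ⟨hxU, hx⟩ (H.hasPd_psi2 hU he hx hxU)
    (H.null.dot_comm hx) (fun _ hy => H.I1_eq hU he hy.2 hy.1)
    fun _ hy => H.I2_eq hU he hy.2 hy.1

theorem Q1_eq : Q1 g o x =
    (conj (Psi2 g e x) ^ 2 * gradDot g (Psi2 g e) (Psi2 g e) x).re / (9 * ‖Psi2 g e x‖ ^ 5) := by
  obtain ⟨t, ht⟩ := H.exists_gradDot_conj hU he hx hxU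
  have h5 := H.I5_eq hU he hx hxU
  have h6 := H.I6_eq hU he hx hxU
  rw [ht] at h5 h6
  exact BlackHoleInvariants.Q1_eq (he.psi2 x hxU) (H.I1_eq hU he hx hxU) (H.I2_eq hU he hx hxU)
    h5 h6 (H.I7_eq hU he hx hxU)

theorem Q2_eq : (Q2 g o x : ℂ) =
    (gradDot g (Psi2 g e) (fun y => conj (Psi2 g e y)) x ^ 2
      - gradDot g (Psi2 g e) (Psi2 g e) x * conj (gradDot g (Psi2 g e) (Psi2 g e) x)) /
    (18 ^ 2 * (‖Psi2 g e x‖ : ℂ) ^ 6) := by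
  obtain ⟨t, ht⟩ := H.exists_gradDot_conj hU he hx hxU
  have h5 := H.I5_eq hU he hx hxU
  have h6 := H.I6_eq hU he hx hxU
  rw [ht] at h5 h6 ⊢
  exact BlackHoleInvariants.Q2_eq (he.psi2 x hxU) (H.I1_eq hU he hx hxU) (H.I2_eq hU he hx hxU)
    h5 h6 (H.I7_eq hU he hx hxU)

theorem Q2_eq_wedge : (Q2 g o x : ℂ) =
    -2 * wedgeNormSq g (Psi2 g e) (fun y => conj (Psi2 g e y)) x /
      (18 ^ 2 * (‖Psi2 g e x‖ : ℂ) ^ 6) := by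
  obtain ⟨d, h1⟩ : ∃ d, HasPd (Psi2 g e) x d := ⟨_, H.hasPd_psi2 hU he hx hxU⟩
  rw [H.Q2_eq hU he hx hxU, wedgeNormSq_eq h1 h1.conj, gradDot_eq h1 h1.conj, gradDot_eq h1 h1,
    dot_conj, H.null.dot_comm hx (fun i => conj (d i)) d]
  ring

theorem Q3_eq : (Q3 g o x : ℂ) = gradDot g (Psi2 g e) (fun y => conj (Psi2 g e y)) x /
    (18 * (‖Psi2 g e x‖ : ℂ) ^ 3) := by
  obtain ⟨t, ht⟩ := H.exists_gradDot_conj hU he hx hxU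
  have h5 := H.I5_eq hU he hx hxU
  have h6 := H.I6_eq hU he hx hxU
  rw [ht] at h5 h6 ⊢
  rw [BlackHoleInvariants.Q3_eq (he.psi2 x hxU) (H.I1_eq hU he hx hxU) (H.I2_eq hU he hx hxU)
    h5 h6]
  push_cast
  rfl

/-- Without charge `∇Ψ.∇Ψ = 18 Ψ² (ρμ - τπ)`, so the second term of `I3_add_I4` is `32 ∇Ψ.∇Ψ`, and
`48 + 32 = 80`. -/
theorem uncharged (hw : R.w = 0) :
    (I3 g x : ℂ) + Complex.I * I4 g o x = 80 * gradDot g (Psi2 g e) (Psi2 g e) x := by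
  have hΦ := H.phi11_eq hU he hx hxU
  rw [hw, zero_div, Complex.ofReal_zero] at hΦ
  rw [H.I3_add_I4 hU he hx hxU, H.gradDot_psi2 hU he hx hxU, hΦ]
  ring

section Canonical

variable (hρ : spinRho g e x = spinMu g e x) (hτ : spinTau g e x = spinPi g e x)
include hρ hτ

theorem canonical_gradDot : gradDot g (Psi2 g e) (Psi2 g e) x =
    8 * (spinRho g e x ^ 2 - spinTau g e x ^ 2) * Phi11 g e x ^ 2
      + 24 * (spinTau g e x ^ 2 + spinRho g e x ^ 2) * Psi2 g e x * Phi11 g e x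
      + 18 * Psi2 g e x ^ 2 * (spinRho g e x ^ 2 - spinTau g e x ^ 2) := by
  rw [H.gradDot_psi2 hU he hx hxU, ← hρ, ← hτ]
  ring

theorem canonical_gradDot_conj : gradDot g (Psi2 g e) (fun y => conj (Psi2 g e y)) x =
    8 * ((‖spinRho g e x‖ : ℂ) ^ 2 + (‖spinTau g e x‖ : ℂ) ^ 2) * Phi11 g e x ^ 2
      + (12 * ((‖spinRho g e x‖ : ℂ) ^ 2 - (‖spinTau g e x‖ : ℂ) ^ 2) * conj (Psi2 g e x)
        + conj (12 * ((‖spinRho g e x‖ : ℂ) ^ 2 - (‖spinTau g e x‖ : ℂ) ^ 2) *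
          conj (Psi2 g e x))) * Phi11 g e x
      + 18 * (Psi2 g e x * conj (Psi2 g e x)) *
        ((‖spinRho g e x‖ : ℂ) ^ 2 + (‖spinTau g e x‖ : ℂ) ^ 2) := by
  have hS : (R.S x : ℂ) ≠ 0 := by exact_mod_cast (H.chart.S_pos x hx).ne'
  rw [H.gradDot_psi2_conj hU he hx hxU]
  simp only [← Complex.ofReal_pow, H.norm_rho_sq hU he hx hxU hρ, H.norm_tau_sq hU he hx hxU hτ]
  simp only [map_mul, map_sub, Complex.conj_conj, Complex.conj_ofReal, Complex.conj_ofNat]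
  push_cast
  field_simp
  ring

theorem canonical_Q1 : (Q1 g o x : ℂ) =
    8 / 9 * ((conj (Psi2 g e x) ^ 2 * (spinRho g e x ^ 2 - spinTau g e x ^ 2)).re : ℂ) *
        Phi11 g e x ^ 2 / (‖Psi2 g e x‖ : ℂ) ^ 5
      + 8 / 3 * (((spinRho g e x ^ 2 + spinTau g e x ^ 2) * conj (Psi2 g e x)).re : ℂ) *
        Phi11 g e x / (‖Psi2 g e x‖ : ℂ) ^ 3
      + 2 * ((spinRho g e x ^ 2 - spinTau g e x ^ 2).re : ℂ) / (‖Psi2 g e x‖ : ℂ) := by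
  have hn : (‖Psi2 g e x‖ : ℂ) ≠ 0 := by exact_mod_cast norm_ne_zero_iff.mpr (he.psi2 x hxU)
  have hΨ := he.psi2 x hxU
  -- Writing the conjugate as `‖Ψ‖²/Ψ` leaves an identity of rational expressions.
  have hc : conj (Psi2 g e x) = (‖Psi2 g e x‖ : ℂ) ^ 2 / Psi2 g e x := by
    rw [eq_div_iff hΨ, Complex.conj_mul']
  rw [H.Q1_eq hU he hx hxU, H.canonical_gradDot hU he hx hxU hρ hτ, H.phi11_eq hU he hx hxU]
  push_cast
  simp only [Complex.re_eq_add_conj, map_add, map_sub, map_mul, map_pow, map_div₀,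
    Complex.conj_conj, Complex.conj_ofReal, Complex.conj_ofNat]
  rw [hc]
  field_simp
  ring

theorem canonical_Q2 : (Q2 g o x : ℂ) =
    16 / 81 * (spinRho g e x * conj (spinTau g e x) + conj (spinRho g e x) * spinTau g e x) ^ 2 *
        Phi11 g e x ^ 4 / (‖Psi2 g e x‖ : ℂ) ^ 6
      + 32 / 27 * ((Psi2 g e x * (spinRho g e x * conj (spinTau g e x)
          - conj (spinRho g e x) * spinTau g e x)).re : ℂ) *
          (spinRho g e x * conj (spinTau g e x) + conj (spinRho g e x) * spinTau g e x) *
          Phi11 g e x ^ 3 / (‖Psi2 g e x‖ : ℂ) ^ 6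
      + 8 / 9 * (((Psi2 g e x ^ 2 * (spinRho g e x * conj (spinTau g e x)
          - conj (spinRho g e x) * spinTau g e x) ^ 2).re : ℂ)
          - 4 * (‖Psi2 g e x‖ : ℂ) ^ 2 * (((spinRho g e x * conj (spinTau g e x)) ^ 2).re : ℂ)) *
          Phi11 g e x ^ 2 / (‖Psi2 g e x‖ : ℂ) ^ 6
      - 8 / 3 * (spinRho g e x * conj (spinTau g e x) + conj (spinRho g e x) * spinTau g e x) *
          ((Psi2 g e x * (spinRho g e x * conj (spinTau g e x)
          - conj (spinRho g e x) * spinTau g e x)).re : ℂ) * Phi11 g e x /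
          (‖Psi2 g e x‖ : ℂ) ^ 4
      + (spinRho g e x * conj (spinTau g e x) + conj (spinRho g e x) * spinTau g e x) ^ 2 /
        (‖Psi2 g e x‖ : ℂ) ^ 2 := by
  have hn : (‖Psi2 g e x‖ : ℂ) ≠ 0 := by exact_mod_cast norm_ne_zero_iff.mpr (he.psi2 x hxU)
  have hΨ := he.psi2 x hxU
  have hc : conj (Psi2 g e x) = (‖Psi2 g e x‖ : ℂ) ^ 2 / Psi2 g e x := by
    rw [eq_div_iff hΨ, Complex.conj_mul']
  -- With `τ = tρ`, `t` real, the difference `ρ conj τ - conj ρ τ` vanishes. Both sides become the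
  -- square of `(s/‖Ψ‖)(1 - 4Φ²/(9‖Ψ‖²))`, where `s = ρ conj τ + conj ρ τ`.
  obtain ⟨hρ0, t, ht⟩ := H.exists_tau_eq hU he hx hxU hρ hτ
  have hnρ : (‖spinRho g e x‖ : ℂ) ^ 2 = conj (spinRho g e x) * spinRho g e x :=
    (Complex.conj_mul' _).symm
  have hnτ : (‖spinTau g e x‖ : ℂ) ^ 2 = t ^ 2 * (conj (spinRho g e x) * spinRho g e x) := by
    rw [ht, ← Complex.conj_mul', map_mul, Complex.conj_ofReal]
    ring
  rw [H.Q2_eq hU he hx hxU, H.canonical_gradDot hU he hx hxU hρ hτ,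
    H.canonical_gradDot_conj hU he hx hxU hρ hτ, H.phi11_eq hU he hx hxU, hnρ, hnτ, ht]
  simp only [Complex.re_eq_add_conj, map_add, map_sub, map_mul, map_pow, map_div₀,
    Complex.conj_conj, Complex.conj_ofReal, Complex.conj_ofNat]
  rw [hc]
  field_simp
  ring

theorem canonical_Q3 : (Q3 g o x : ℂ) =
    4 / 9 * ((‖spinRho g e x‖ : ℂ) ^ 2 + (‖spinTau g e x‖ : ℂ) ^ 2) * Phi11 g e x ^ 2 /
        (‖Psi2 g e x‖ : ℂ) ^ 3
      + 4 / 3 * ((Psi2 g e x * ((‖spinRho g e x‖ : ℂ) ^ 2 - (‖spinTau g e x‖ : ℂ) ^ 2)).re : ℂ) *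
        Phi11 g e x / (‖Psi2 g e x‖ : ℂ) ^ 3
      + ((‖spinRho g e x‖ : ℂ) ^ 2 + (‖spinTau g e x‖ : ℂ) ^ 2) / (‖Psi2 g e x‖ : ℂ) := by
  have hn : (‖Psi2 g e x‖ : ℂ) ≠ 0 := by exact_mod_cast norm_ne_zero_iff.mpr (he.psi2 x hxU)
  have hΨ := he.psi2 x hxU
  have hc : conj (Psi2 g e x) = (‖Psi2 g e x‖ : ℂ) ^ 2 / Psi2 g e x := by
    rw [eq_div_iff hΨ, Complex.conj_mul']
  rw [H.Q3_eq hU he hx hxU, H.canonical_gradDot_conj hU he hx hxU hρ hτ]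
  simp only [Complex.re_eq_add_conj, map_add, map_sub, map_mul, map_pow, map_div₀,
    Complex.conj_conj, Complex.conj_ofReal, Complex.conj_ofNat]
  rw [hc]
  field_simp
  ring

end Canonical

/-- Without rotation, `τ` and `π` vanish, and `ρ` and `Ψ₂` are real. -/
theorem static (hc : R.c = 0) : spinTau g e x = 0 ∧ spinPi g e x = 0 ∧
    conj (spinRho g e x) = spinRho g e x ∧ ∀ y ∈ U ∩ V, conj (Psi2 g e y) = Psi2 g e y := by
  have hC := H.chart.toCarter H.j_sq
  have hc' : (R.toCarter j).c = 0 := by rw [toCarter_c, hc, Complex.ofReal_zero, mul_zero]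
  have hζ : ∀ y, (R.toCarter j).ζ' y = R.r y := fun y => by
    rw [Carter.ζ', hc']
    simp [toCarter]
  refine ⟨?_, ?_, ?_, fun y hy => ?_⟩
  · obtain ⟨-, -, A, hA, z, hz, h | h⟩ := H.scalars hU he hx hxU
    · rw [h.2.2.1, hC.tau_eq hx, hc']
      ring
    · rw [h.2.2.1, hC.pi_eq hx, hc']
      ring
  · obtain ⟨-, -, A, hA, z, hz, h | h⟩ := H.scalars hU he hx hxU
    · rw [h.2.2.2, hC.pi_eq hx, hc']
      ring
    · rw [h.2.2.2, hC.tau_eq hx, hc']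
      ring
  · obtain ⟨-, -, A, hA, z, hz, h | h⟩ := H.scalars hU he hx hxU
    · rw [h.1, hC.rho_eq hx, hζ]
      simp
    · rw [h.1, hC.mu_eq hx, toCarter_ζ_inv H.j_sq, toCarter_Q H.j_sq, hζ]
      simp [Complex.conj_ofNat]
  · rw [(H.scalars hU he hy.2 hy.1).1, conj_ψ H.conj_j, Carter.ψ, Carter.ψ', hc', hζ, Carter.ζ,
      hc']
    simp only [toCarter]
    ring

end RealCarter.IsAdapted

/-! ### Constant rescalings of the metric -/

section Scaling

variable {k : ℝ}

theorem pd_const_mul (k : ℝ) (f : Pt → ℝ) (i : Fin 4) (x : Pt) :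
    pd i (fun y => k * f y) x = k * pd i f x := deriv_const_mul_field k

/-- For a singular matrix both inverses are zero by convention, so the scaling results need no
hypothesis on the metric. -/
theorem inv_smul_matrix (hk : k ≠ 0) (A : Matrix (Fin 4) (Fin 4) ℝ) :
    (k • A)⁻¹ = k⁻¹ • A⁻¹ := by
  by_cases hA : IsUnit A.det
  · refine Matrix.inv_eq_right_inv ?_
    rw [Matrix.smul_mul, Matrix.mul_smul, smul_smul, mul_inv_cancel₀ hk, one_smul,
      Matrix.mul_nonsing_inv _ hA]
  · rw [Matrix.nonsing_inv_apply_not_isUnit _ hA, Matrix.nonsing_inv_apply_not_isUnit, smul_zero]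
    rw [Matrix.det_smul]
    simpa [hk] using hA

/-- The factors of the inverse metric and of the derivatives of the metric cancel, so the connection
and `R^i_{jkl}` do not change. -/
theorem christoffel_smul (hk : k ≠ 0) (g : MetricField) :
    christoffel (fun y => k • g y) = christoffel g := by
  ext i a b x
  simp only [christoffel, inv_smul_matrix hk, Matrix.smul_apply, smul_eq_mul, pd_const_mul]
  congr 1
  exact Finset.sum_congr rfl fun l _ => by field_simp

theorem riemannUp_smul (hk : k ≠ 0) (g : MetricField) :
    riemannUp (fun y => k • g y) = riemannUp g := by
  ext i a b c x
  simp only [riemannUp, christoffel_smul hk]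

theorem ricci_smul (hk : k ≠ 0) (g : MetricField) : ricci (fun y => k • g y) = ricci g := by
  ext x a b
  simp only [ricci, riemannUp_smul hk]

theorem riemann_smul (hk : k ≠ 0) (g : MetricField) (x : Pt) (a b c d : Fin 4) :
    riemann (fun y => k • g y) x a b c d = k * riemann g x a b c d := by
  simp only [riemann, riemannUp_smul hk, Matrix.smul_apply, smul_eq_mul, Finset.mul_sum, mul_assoc]

theorem scalarCurv_smul (hk : k ≠ 0) (g : MetricField) (x : Pt) :
    scalarCurv (fun y => k • g y) x = k⁻¹ * scalarCurv g x := by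
  simp only [scalarCurv, ricci_smul hk, inv_smul_matrix hk, Matrix.smul_apply, smul_eq_mul,
    Finset.mul_sum, mul_assoc]

theorem weyl_smul (hk : k ≠ 0) (g : MetricField) (x : Pt) (a b c d : Fin 4) :
    weyl (fun y => k • g y) x a b c d = k * weyl g x a b c d := by
  simp only [weyl, riemann_smul hk, ricci_smul hk, scalarCurv_smul hk, Matrix.smul_apply,
    smul_eq_mul]
  field_simp

theorem volForm_smul (hk : 0 < k) (g : MetricField) (o : ℤˣ) (x : Pt) (a b c d : Fin 4) :
    volForm (fun y => k • g y) o x a b c d = k ^ 2 * volForm g o x a b c d := by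
  rw [volForm, volForm, Matrix.det_smul, Fintype.card_fin, abs_mul, abs_of_pos (by positivity),
    show k ^ 4 = (k ^ 2) ^ 2 by ring, Real.sqrt_mul (by positivity),
    Real.sqrt_sq (by positivity)]
  ring

theorem weylDual_smul (hk : 0 < k) (g : MetricField) (o : ℤˣ) (x : Pt) (a b c d : Fin 4) :
    weylDual (fun y => k • g y) o x a b c d = k * weylDual g o x a b c d := by
  simp only [weylDual, volForm_smul hk, inv_smul_matrix hk.ne', weyl_smul hk.ne',
    Matrix.smul_apply, smul_eq_mul, Finset.mul_sum]
  have := hk.ne'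
  exact Finset.sum_congr rfl fun e _ => Finset.sum_congr rfl fun f _ =>
    Finset.sum_congr rfl fun p _ => Finset.sum_congr rfl fun q _ => by field_simp

theorem contract4_smul (hk : k ≠ 0) (g : MetricField) {S S' T T' : Tensor4} (x : Pt)
    (hS : ∀ a b c d, S' x a b c d = k * S x a b c d)
    (hT : ∀ a b c d, T' x a b c d = k * T x a b c d) :
    contract4 (fun y => k • g y) S' T' x = k⁻¹ ^ 2 * contract4 g S T x := by
  simp only [contract4, inv_smul_matrix hk, Matrix.smul_apply, smul_eq_mul, hS, hT,
    Finset.mul_sum, Finset.sum_mul]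
  refine Finset.sum_congr rfl fun _ _ => Finset.sum_congr rfl fun _ _ =>
    Finset.sum_congr rfl fun _ _ => Finset.sum_congr rfl fun _ _ => Finset.sum_congr rfl fun _ _ =>
    Finset.sum_congr rfl fun _ _ => Finset.sum_congr rfl fun _ _ =>
    Finset.sum_congr rfl fun _ _ => ?_
  field_simp

theorem gradDot_smul (hk : k ≠ 0) (g : MetricField) (f h : Pt → ℝ) (x : Pt) (s : ℝ) :
    gradDot (fun y => k • g y) (fun y => s * f y) (fun y => s * h y) x =
      k⁻¹ * s ^ 2 * gradDot g f h x := by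
  simp only [gradDot, inv_smul_matrix hk, Matrix.smul_apply, smul_eq_mul, pd_const_mul,
    Finset.mul_sum]
  exact Finset.sum_congr rfl fun _ _ => Finset.sum_congr rfl fun _ _ => by ring

/-- `Q₂` is dimensionless. -/
theorem Q2_smul (hk : 0 < k) (g : MetricField) (o : ℤˣ) (x : Pt) :
    Q2 (fun y => k • g y) o x = Q2 g o x := by
  have h1 : I1 (fun y => k • g y) = fun y => k⁻¹ ^ 2 * I1 g y := by
    ext y
    exact contract4_smul hk.ne' g y (weyl_smul hk.ne' g y) (weyl_smul hk.ne' g y)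
  have h2 : I2 (fun y => k • g y) o = fun y => k⁻¹ ^ 2 * I2 g o y := by
    ext y
    exact contract4_smul hk.ne' g y (weylDual_smul hk g o y) (weyl_smul hk.ne' g y)
  -- `I₁` and `I₂` scale by `k⁻²`, hence `I₅`, `I₆`, `I₇` by `k⁻⁵`; numerator and denominator of
  -- `Q₂` both scale by `k⁻¹⁰`.
  have e : (k⁻¹ ^ 2 * I1 g x) ^ 2 + (k⁻¹ ^ 2 * I2 g o x) ^ 2 =
      k⁻¹ ^ 4 * (I1 g x ^ 2 + I2 g o x ^ 2) := by ring
  have e' : (k⁻¹ ^ 4) ^ (5 / 2 : ℝ) = k⁻¹ ^ 10 := by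
    rw [show (5 / 2 : ℝ) = ((10 : ℕ) : ℝ) / 4 by norm_num, rpow_div_four (by positivity)]
  simp only [Q2, I5, I6, I7, h1, h2, gradDot_smul hk.ne']
  rw [e, Real.mul_rpow (by positivity) (by positivity), e']
  field_simp

end Scaling

/-! ### The black holes as members of the Carter–Plebański family -/

theorem pd_apply (i k : Fin 4) (y : Pt) : pd i (fun z : Pt => z k) y = if i = k then 1 else 0 := by
  unfold pd
  split
  · next h => subst h; simp
  · next h => simp [Function.update_of_ne (Ne.symm h)]

theorem contDiff_coord (k : Fin 4) : ContDiff ℝ ∞ (fun z : Pt => z k) := contDiff_apply ℝ ℝ k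

/-- The Kerr–NUT–(anti-)de Sitter chart. -/
def nutCarter (a l m Λ : ℝ) : RealCarter where
  c := 1
  p₀ := (a ^ 2 - l ^ 2) * (1 - Λ * l ^ 2)
  p₁ := l + Λ / 3 * (l * (a ^ 2 - l ^ 2) - 3 * l ^ 3)
  ε := 1 - Λ / 3 * (a ^ 2 + 6 * l ^ 2)
  Λ := Λ
  m := m
  w := 0
  A₀ := 0
  r := fun y => y 3
  x := fun y => y 2
  dt := ![1, 0, 0, 0]
  dφ := ![0, 1, 0, 0]
  dx := fun _ => ![0, 0, 1, 0]
  dr := ![0, 0, 0, 1]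
  vt := ![1, 0, 0, 0]
  vφ := ![0, 1, 0, 0]
  vx := fun _ => ![0, 0, 1, 0]
  vr := ![0, 0, 0, 1]

/-- The constants of `nutCarter` are the coefficients of this quartic in `p`; the same `p₀` and `ε`
also have to fit the quartic `nutQ`, and they do. -/
theorem nutCarter_P (a l m Λ : ℝ) (y : Pt) : (nutCarter a l m Λ).P y = nutP a l Λ (y 2) := by
  simp only [RealCarter.P, nutCarter, nutP]
  ring

theorem nutCarter_Q (a l m Λ : ℝ) (y : Pt) : (nutCarter a l m Λ).Q y = nutQ a l m Λ (y 3) := by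
  simp only [RealCarter.Q, nutCarter, nutQ]
  ring

theorem nutCarter_S (a l m Λ : ℝ) (y : Pt) : (nutCarter a l m Λ).S y = y 2 ^ 2 + y 3 ^ 2 := by
  simp only [RealCarter.S, nutCarter]
  ring

theorem nutCarter_isChart (a l m Λ : ℝ) :
    (nutCarter a l m Λ).IsChart (BlackHole.kerrNUTAdS a l m Λ).domain := by
  have hS : ∀ y ∈ (BlackHole.kerrNUTAdS a l m Λ).domain, 0 < (nutCarter a l m Λ).S y :=
    fun y hy => by
      rw [nutCarter_S]
      exact lt_of_le_of_ne (by positivity) hy.1.symm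
  refine ⟨?_, (contDiff_coord 3).contDiffOn, (contDiff_coord 2).contDiffOn,
    fun i => contDiffOn_const, fun i => contDiffOn_const, fun y _ i => ?_, fun y _ i => ?_,
    fun y _ => ?_, hS, fun y hy => ?_, fun y hy => ?_⟩
  · have h1 : IsOpen {x : Pt | x 2 ^ 2 + x 3 ^ 2 ≠ 0} := isOpen_ne_fun (by fun_prop) (by fun_prop)
    have h2 : IsOpen {x : Pt | 0 < nutP a l Λ (x 2)} :=
      isOpen_lt continuous_const (by unfold nutP; fun_prop)
    have h3 : IsOpen {x : Pt | nutQ a l m Λ (x 3) ≠ 0} :=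
      isOpen_ne_fun (by unfold nutQ; fun_prop) continuous_const
    exact h1.inter (h2.inter h3)
  · refine (pd_apply i 3 y).trans ?_
    fin_cases i <;> rfl
  · refine (pd_apply i 2 y).trans ?_
    fin_cases i <;> rfl
  · ext p q
    fin_cases p <;> fin_cases q <;>
      simp [RealCarter.D, nutCarter, Matrix.mul_apply, Fin.sum_univ_four]
  · rw [nutCarter_P]
    exact hy.2.1
  · rw [nutCarter_Q]
    exact hy.2.2

theorem nutCarter_metric {a l m Λ : ℝ} {y : Pt} (hy : y ∈ (BlackHole.kerrNUTAdS a l m Λ).domain) :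
    nutMetric a l m Λ y = (nutCarter a l m Λ).metric y := by
  obtain ⟨h1, h2, h3⟩ := hy
  have h2' := h2.ne'
  ext i k
  simp only [RealCarter.metric, Matrix.of_apply, nutCarter_P, nutCarter_Q, nutCarter_S,
    RealCarter.time, RealCarter.axial, nutMetric]
  simp only [nutCarter]
  fin_cases i <;> fin_cases k <;> simp <;> field_simp <;> ring

/-- The charts in Boyer–Lindquist coordinates. -/
def boyerLindquist (c Λ m w A₀ : ℝ) : RealCarter where
  c := c
  p₀ := 1
  p₁ := 0
  ε := 1
  Λ := Λ
  m := m
  w := w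
  A₀ := A₀
  r := fun y => y 1
  x := fun y => -Real.cos (y 2)
  dt := ![1, 0, 0, 0]
  dφ := ![0, 0, 0, 1]
  dx := fun y => ![0, 0, Real.sin (y 2), 0]
  dr := ![0, 1, 0, 0]
  vt := ![1, 0, 0, 0]
  vφ := ![0, 0, 0, 1]
  vx := fun y => ![0, 0, (Real.sin (y 2))⁻¹, 0]
  vr := ![0, 1, 0, 0]

theorem boyerLindquist_isChart {c Λ m w A₀ : ℝ} {V : Set Pt} (hV : IsOpen V)
    (hs : ∀ y ∈ V, Real.sin (y 2) ≠ 0) (hS : ∀ y ∈ V, 0 < (boyerLindquist c Λ m w A₀).S y)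
    (hP : ∀ y ∈ V, 0 < (boyerLindquist c Λ m w A₀).P y)
    (hQ : ∀ y ∈ V, (boyerLindquist c Λ m w A₀).Q y ≠ 0) :
    (boyerLindquist c Λ m w A₀).IsChart V := by
  have hsin : ContDiff ℝ ∞ (fun y : Pt => Real.sin (y 2)) := Real.contDiff_sin.comp (contDiff_coord 2)
  have hcos : ContDiff ℝ ∞ (fun y : Pt => Real.cos (y 2)) := Real.contDiff_cos.comp (contDiff_coord 2)
  refine ⟨hV, (contDiff_coord 1).contDiffOn, hcos.neg.contDiffOn, fun i => ?_, fun i => ?_,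
    fun y _ i => ?_, fun y _ i => ?_, fun y hy => ?_, hS, hP, hQ⟩
  · fin_cases i
    · exact contDiffOn_const
    · exact contDiffOn_const
    · exact hsin.contDiffOn
    · exact contDiffOn_const
  · fin_cases i
    · exact contDiffOn_const
    · exact contDiffOn_const
    · exact hsin.contDiffOn.inv hs
    · exact contDiffOn_const
  · refine (pd_apply i 1 y).trans ?_
    fin_cases i <;> rfl
  · have h2 : pd 2 (fun z : Pt => -Real.cos (z 2)) y = Real.sin (y 2) := by
      have : HasDerivAt (fun s : ℝ => -Real.cos s) (Real.sin (y 2)) (y 2) := by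
        exact (Real.hasDerivAt_cos (y 2)).fun_neg.congr_deriv (neg_neg _)
      unfold pd
      simpa using this.deriv
    have h0 : ∀ k : Fin 4, k ≠ 2 → pd k (fun z : Pt => -Real.cos (z 2)) y = 0 := fun k hk => by
      unfold pd
      simp [Function.update_of_ne (Ne.symm hk)]
    fin_cases i
    · exact h0 0 (by decide)
    · exact h0 1 (by decide)
    · exact h2
    · exact h0 3 (by decide)
  · have := hs y hy
    ext p q
    fin_cases p <;> fin_cases q <;>
      simp [RealCarter.D, boyerLindquist, Matrix.mul_apply, Fin.sum_univ_four, this]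

/-- The Kerr–Newman chart. -/
def knCarter (M a q : ℝ) : RealCarter := boyerLindquist (-a) 0 M (q ^ 2) a

theorem knCarter_P (M a q : ℝ) (y : Pt) : (knCarter M a q).P y = Real.sin (y 2) ^ 2 := by
  simp only [RealCarter.P, knCarter, boyerLindquist]
  linear_combination -Real.sin_sq_add_cos_sq (y 2)

theorem knCarter_Q (M a q : ℝ) (y : Pt) : (knCarter M a q).Q y = knQ M a q (y 1) := by
  simp only [RealCarter.Q, knCarter, boyerLindquist, knQ]
  ring

theorem knCarter_S (M a q : ℝ) (y : Pt) :
    (knCarter M a q).S y = y 1 ^ 2 + a ^ 2 * Real.cos (y 2) ^ 2 := by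
  simp only [RealCarter.S, knCarter, boyerLindquist]
  ring

theorem knCarter_isChart (M a q : ℝ) :
    (knCarter M a q).IsChart (BlackHole.kerrNewman M a q).domain := by
  refine boyerLindquist_isChart ?_ (fun y hy => hy.2.1) (fun y hy => ?_) (fun y hy => ?_)
    fun y hy => ?_
  · have h1 : IsOpen {x : Pt | x 1 ^ 2 + a ^ 2 * Real.cos (x 2) ^ 2 ≠ 0} :=
      isOpen_ne_fun (by fun_prop) (by fun_prop)
    have h2 : IsOpen {x : Pt | Real.sin (x 2) ≠ 0} := isOpen_ne_fun (by fun_prop) (by fun_prop)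
    have h3 : IsOpen {x : Pt | knQ M a q (x 1) ≠ 0} :=
      isOpen_ne_fun (by unfold knQ; fun_prop) continuous_const
    exact h1.inter (h2.inter h3)
  · exact (lt_of_le_of_ne (by positivity) hy.1.symm).trans_eq (knCarter_S M a q y).symm
  · have : Real.sin (y 2) ≠ 0 := hy.2.1
    exact (by positivity : 0 < Real.sin (y 2) ^ 2).trans_eq (knCarter_P M a q y).symm
  · exact (knCarter_Q M a q y).trans_ne hy.2.2

/-- With `c = -a`, `A₀ = a` and `x = -cos θ` the two one-forms are `dt - a sin²θ dφ` and `(r² + a²)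
dφ - a dt`, while `dx²/P = dθ²`. -/
theorem knCarter_metric {M a q : ℝ} {y : Pt} (hy : y ∈ (BlackHole.kerrNewman M a q).domain) :
    knMetric M a q y = (knCarter M a q).metric y := by
  obtain ⟨h1, h2, h3⟩ := hy
  have hc : Real.cos (y 2) ^ 2 = 1 - Real.sin (y 2) ^ 2 := Real.cos_sq' _
  ext i k
  simp only [RealCarter.metric, Matrix.of_apply, knCarter_P, knCarter_Q, knCarter_S,
    RealCarter.time, RealCarter.axial, knMetric]
  simp only [knCarter, boyerLindquist, neg_sq]
  rw [hc] at h1 ⊢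
  fin_cases i <;> fin_cases k <;> simp <;> field_simp <;> ring

/-- The Reissner–Nordström–(anti-)de Sitter chart. -/
def rnCarter (M q Λ : ℝ) : RealCarter := boyerLindquist 0 Λ M (q ^ 2) 0

theorem rnCarter_P (M q Λ : ℝ) (y : Pt) : (rnCarter M q Λ).P y = Real.sin (y 2) ^ 2 := by
  simp only [RealCarter.P, rnCarter, boyerLindquist]
  linear_combination -Real.sin_sq_add_cos_sq (y 2)

theorem rnCarter_Q (M q Λ : ℝ) {y : Pt} (hy : y 1 ≠ 0) :
    (rnCarter M q Λ).Q y = y 1 ^ 2 * rnF M q Λ (y 1) := by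
  simp only [RealCarter.Q, rnCarter, boyerLindquist, rnF]
  field_simp
  ring

theorem rnCarter_S (M q Λ : ℝ) (y : Pt) : (rnCarter M q Λ).S y = y 1 ^ 2 := by
  simp only [RealCarter.S, rnCarter, boyerLindquist]
  ring

theorem rnCarter_isChart (M q Λ : ℝ) :
    (rnCarter M q Λ).IsChart (BlackHole.reissnerNordstromAdS M q Λ).domain := by
  refine boyerLindquist_isChart ?_ (fun y hy => hy.2.1) (fun y hy => ?_) (fun y hy => ?_)
    fun y hy => ?_
  -- Openness is checked with the polynomial `Q`, continuous also at `r = 0`; off `r = 0` it equals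
  -- `r² f`, so the conditions `Q ≠ 0` and `f ≠ 0` agree there.
  · have hQ : Continuous (rnCarter M q Λ).Q := by
      have : (rnCarter M q Λ).Q =
          fun y => q ^ 2 - 2 * M * y 1 + y 1 ^ 2 - Λ / 3 * y 1 ^ 4 := by
        funext y
        simp only [RealCarter.Q, rnCarter, boyerLindquist]
        ring
      rw [this]
      fun_prop
    have h1 : IsOpen {x : Pt | x 1 ≠ 0} := isOpen_ne_fun (by fun_prop) (by fun_prop)
    have h2 : IsOpen {x : Pt | Real.sin (x 2) ≠ 0} := isOpen_ne_fun (by fun_prop) (by fun_prop)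
    have h3 : IsOpen {x : Pt | (rnCarter M q Λ).Q x ≠ 0} :=
      isOpen_ne_fun hQ continuous_const
    convert h1.inter (h2.inter h3) using 1
    ext y
    simp only [BlackHole.domain, Set.mem_ofPred_eq, Set.mem_inter_iff]
    refine and_congr_right fun hy => and_congr_right fun _ => ?_
    rw [rnCarter_Q M q Λ hy]
    simp [hy]
  · have : y 1 ≠ 0 := hy.1
    exact (by positivity : 0 < y 1 ^ 2).trans_eq (rnCarter_S M q Λ y).symm
  · have : Real.sin (y 2) ≠ 0 := hy.2.1
    exact (by positivity : 0 < Real.sin (y 2) ^ 2).trans_eq (rnCarter_P M q Λ y).symm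
  · exact (rnCarter_Q M q Λ hy.1).trans_ne (mul_ne_zero (pow_ne_zero 2 hy.1) hy.2.2)

theorem rnCarter_metric {M q Λ : ℝ} {y : Pt}
    (hy : y ∈ (BlackHole.reissnerNordstromAdS M q Λ).domain) :
    rnMetric M q Λ y = (rnCarter M q Λ).metric y := by
  obtain ⟨h1, h2, h3⟩ := hy
  ext i k
  simp only [RealCarter.metric, Matrix.of_apply, rnCarter_P, rnCarter_Q M q Λ h1, rnCarter_S,
    RealCarter.time, RealCarter.axial, rnMetric]
  simp only [rnCarter, boyerLindquist]
  fin_cases i <;> fin_cases k <;> simp <;> field_simp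

/-- The chart of a black hole in the Carter–Plebański family. -/
def BlackHole.carter : BlackHole → RealCarter
  | kerrNUTAdS a l m Λ => nutCarter a l m Λ
  | kerrNewman M a q => knCarter M a q
  | reissnerNordstromAdS M q Λ => rnCarter M q Λ

namespace BlackHole

variable (B : BlackHole)

theorem isChart : B.carter.IsChart B.domain :=
  match B with
  | kerrNUTAdS a l m Λ => nutCarter_isChart a l m Λ
  | kerrNewman M a q => knCarter_isChart M a q
  | reissnerNordstromAdS M q Λ => rnCarter_isChart M q Λ

theorem metric_eq : ∀ y ∈ B.domain, B.metric y = B.carter.metric y :=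
  match B with
  | kerrNUTAdS _ _ _ _ => fun _ hy => nutCarter_metric hy
  | kerrNewman _ _ _ => fun _ hy => knCarter_metric hy
  | reissnerNordstromAdS _ _ _ => fun _ hy => rnCarter_metric hy

theorem carter_w_eq_zero (h : B.charge = 0) : B.carter.w = 0 := by
  cases B
  · rfl
  · exact (pow_eq_zero_iff two_ne_zero).mpr h
  · exact (pow_eq_zero_iff two_ne_zero).mpr h

theorem carter_Q_pos {y : Pt} (hy : y ∈ B.domain) (h : 0 < B.horizonFn y) : 0 < B.carter.Q y := by
  cases B with
  | kerrNUTAdS a l m Λ => exact h.trans_eq (nutCarter_Q a l m Λ y).symm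
  | kerrNewman M a q => exact h.trans_eq (knCarter_Q M a q y).symm
  | reissnerNordstromAdS M q Λ =>
    have h1 : y 1 ≠ 0 := hy.1
    exact (mul_pos (by positivity) h).trans_eq (rnCarter_Q M q Λ h1).symm

end BlackHole

/-! ### Local choice of the imaginary unit by orientation. -/

namespace RealCarter

variable (R : RealCarter)

/-- The sign of the chart `(t, φ, x, r)` relative to the coordinates. -/
def sgn (y : Pt) : ℝ := Real.sign (R.D y).det

/-- The imaginary unit `± i` for which the complex chart is oriented. -/
def phase (o : ℤˣ) (y : Pt) : ℂ := Complex.I * ((o : ℤ) : ℂ) * R.sgn y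

/-- The part of `V` on which the chart has the same sign as at `x`. -/
def sheet (V : Set Pt) (x : Pt) : Set Pt := {y ∈ V | 0 < R.sgn x * (R.D y).det}

variable {R}

/-- On a sheet `det D` keeps its sign. In Boyer–Lindquist coordinates `det D = -sin θ` takes both
signs on the domain, so a single `j` does not serve the whole of it. -/
theorem phase_eq {V : Set Pt} {x y : Pt} (o : ℤˣ) (hy : y ∈ R.sheet V x) :
    R.phase o y = R.phase o x := by
  have h := hy.2
  suffices R.sgn y = R.sgn x by rw [phase, phase, this]
  unfold sgn at h ⊢
  rcases Real.sign_apply_eq (R.D x).det with h1 | h1 | h1 <;> rw [h1] at h ⊢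
  · exact Real.sign_of_neg (by linarith)
  · linarith
  · exact Real.sign_of_pos (by linarith)

namespace IsChart

variable {V : Set Pt} (H : R.IsChart V) {x : Pt}
include H

theorem det_ne_zero (hx : x ∈ V) : (R.D x).det ≠ 0 := by
  intro h0
  have := congrArg Matrix.det (H.dual x hx)
  rw [Matrix.det_mul, h0, zero_mul, Matrix.det_one] at this
  exact zero_ne_one this

theorem mem_sheet (hx : x ∈ V) : x ∈ R.sheet V x := by
  refine ⟨hx, ?_⟩
  rcases (H.det_ne_zero hx).lt_or_gt with h | h
  · rw [sgn, Real.sign_of_neg h]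
    linarith
  · rw [sgn, Real.sign_of_pos h]
    linarith

theorem isOpen_sheet : IsOpen (R.sheet V x) := by
  have hc : ContinuousOn (fun y => R.sgn x * (R.D y).det) V := by
    refine continuousOn_const.mul ?_
    have : ContinuousOn R.D V := by
      refine continuousOn_pi.mpr fun p => continuousOn_pi.mpr fun i => ?_
      fin_cases p
      · exact continuousOn_const
      · exact continuousOn_const
      · exact (H.smooth_dx i).continuousOn
      · exact continuousOn_const
    exact (Continuous.matrix_det continuous_id).comp_continuousOn this
  exact hc.isOpen_inter_preimage H.isOpen isOpen_Ioi

/-- Near each point, the complex chart is oriented for one of the two imaginary units. -/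
theorem isAdapted {g : MetricField} (hg : ∀ y ∈ V, g y = R.metric y) (o : ℤˣ) (hx : x ∈ V) :
    R.IsAdapted g o (R.sheet V x) (R.phase o x) := by
  have hs : R.sgn x ^ 2 = 1 := by
    rcases (H.det_ne_zero hx).lt_or_gt with h | h
    · rw [sgn, Real.sign_of_neg h]
      norm_num
    · rw [sgn, Real.sign_of_pos h]
      norm_num
  have ho : (((o : ℤ) : ℂ)) ^ 2 = 1 := by
    rcases Int.units_eq_one_or o with rfl | rfl <;> simp
  have hs' : (R.sgn x : ℂ) ^ 2 = 1 := by exact_mod_cast hs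
  have hj : R.phase o x ^ 2 = -1 := by
    rw [phase, mul_pow, mul_pow, Complex.I_sq, ho, hs']
    ring
  have hW := H.mono H.isOpen_sheet (Set.sep_subset V _ : R.sheet V x ⊆ V)
  have hgW : ∀ y ∈ R.sheet V x, g y = R.metric y := fun y hy => hg y hy.1
  exact ⟨hj, by simp [phase], hW, hW.isNullCoframe hj hgW,
    hW.isOriented hgW o hs (fun y hy => hy.2) rfl⟩

end IsChart

end RealCarter

/-! ### Existence of type D frames -/

namespace CoframeData.Aligned

variable {g : MetricField} {V : Set Pt} {c : CoframeData} (h : IsNullCoframe g V c) {x : Pt}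
  {e : Tetrad} (ha : c.Aligned e x) (hx : x ∈ V)
include h ha hx

theorem metricC_ll : metricC g x (e.lC x) (e.lC x) = 0 := by
  rw [h.metricC_eq hx]
  simp only [ha.l]
  ring

theorem metricC_nn : metricC g x (e.nC x) (e.nC x) = 0 := by
  rw [h.metricC_eq hx]
  simp only [ha.n]
  ring

theorem metricC_ln : metricC g x (e.lC x) (e.nC x) = -1 := by
  rw [h.metricC_eq hx]
  simp only [ha.l, ha.n]
  linear_combination -ha.ln

theorem metricC_lm : metricC g x (e.lC x) (e.m x) = 0 := by
  rw [h.metricC_eq hx]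
  simp only [ha.l, ha.m]
  ring

theorem metricC_nm : metricC g x (e.nC x) (e.m x) = 0 := by
  rw [h.metricC_eq hx]
  simp only [ha.n, ha.m]
  ring

theorem metricC_mm : metricC g x (e.m x) (e.m x) = 0 := by
  rw [h.metricC_eq hx]
  simp only [ha.m]
  ring

theorem metricC_mmbar : metricC g x (e.m x) (e.mbar x) = 1 := by
  rw [h.metricC_eq hx]
  simp only [ha.m, ha.mbar]
  linear_combination ha.mm

omit h in
theorem volC {o : ℤˣ} (ho : c.IsOriented g o V) :
    volC g o x (e.lC x) (e.nC x) (e.m x) (e.mbar x) = -Complex.I := by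
  rw [IsNullCoframe.volC_eq ho hx]
  simp only [ev2_sd₁, ev2_sd₂, ev2_sd₃, ev2_asd₁, ev2_asd₂, ev2_asd₃, ha.l, ha.n, ha.m, ha.mbar]
  linear_combination -Complex.I * c.cmp x (e.m x) 2 * c.cmp x (e.mbar x) 3 * ha.ln
    - Complex.I * ha.mm

variable {ψ ψ' φ : Pt → ℂ} {Λ : ℂ} (hc : HasTypeDCurvature V c ψ ψ' φ Λ)
include hc

theorem psi0 : Psi0 g e x = 0 := by
  rw [Psi0, h.weylC_eq hc hx]
  simp only [ev2_sd₁, ev2_sd₂, ev2_sd₃, ev2_asd₁, ev2_asd₂, ev2_asd₃, ha.l, ha.m]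
  ring

theorem psi1 : Psi1 g e x = 0 := by
  rw [Psi1, h.weylC_eq hc hx]
  simp only [ev2_sd₁, ev2_sd₂, ev2_sd₃, ev2_asd₁, ev2_asd₂, ev2_asd₃, ha.l, ha.n, ha.m]
  ring

theorem psi3 : Psi3 g e x = 0 := by
  rw [Psi3, h.weylC_eq hc hx]
  simp only [ev2_sd₁, ev2_sd₂, ev2_sd₃, ev2_asd₁, ev2_asd₂, ev2_asd₃, ha.l, ha.n, ha.mbar]
  ring

theorem psi4 : Psi4 g e x = 0 := by
  rw [Psi4, h.weylC_eq hc hx]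
  simp only [ev2_sd₁, ev2_sd₂, ev2_sd₃, ev2_asd₁, ev2_asd₂, ev2_asd₃, ha.n, ha.mbar]
  ring

end CoframeData.Aligned

namespace IsNullCoframe

variable {g : MetricField} {V : Set Pt} {c : CoframeData} (h : IsNullCoframe g V c) {x : Pt}
include h

theorem cmp_E (hx : x ∈ V) (α β : Fin 4) :
    c.cmp x (c.E β x) α = (1 : Matrix (Fin 4) (Fin 4) ℂ) α β :=
  congrFun (congrFun (h.dual x hx) α) β

theorem ext_cmp (hx : x ∈ V) {u v : Fin 4 → ℂ} (huv : ∀ α, c.cmp x u α = c.cmp x v α) : u = v := by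
  ext i
  rw [h.cmp_frame hx u i, h.cmp_frame hx v i]
  simp only [huv]

end IsNullCoframe

theorem CoframeData.cmp_smul (c : CoframeData) (x : Pt) (z : ℂ) (u : Fin 4 → ℂ) (α : Fin 4) :
    c.cmp x (fun i => z * u i) α = z * c.cmp x u α := by
  simp only [cmp, ev, Finset.mul_sum]
  exact Finset.sum_congr rfl fun i _ => by ring

/-! ### The explicit principal null tetrad and its canonical normalization. -/

namespace RealCarter

variable (R : RealCarter)

/-- The boost parameter of the frame. -/
def boost (y : Pt) : ℝ := Real.sqrt (|R.Q y| / (2 * R.S y))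

/-- The spin parameter of the frame. -/
def spin (y : Pt) : ℝ := Real.sqrt (R.P y / (2 * R.S y))

/-- The null tetrad along the principal null directions, canonical where `Q > 0`. -/
def frame (o : ℤˣ) : Tetrad where
  l := fun y i => R.boost y * ((R.toCarter (R.phase o y)).coframe.E 0 y i).re
  n := fun y i => (R.boost y)⁻¹ * ((R.toCarter (R.phase o y)).coframe.E 1 y i).re
  m := fun y i => Complex.I * R.spin y * (R.toCarter (R.phase o y)).coframe.E 2 y i

variable {R}

namespace IsChart

variable {V : Set Pt} (H : R.IsChart V) {y : Pt}
include H

theorem boost_pos (hy : y ∈ V) : 0 < R.boost y := by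
  have := H.S_pos y hy
  have := abs_pos.mpr (H.Q_ne y hy)
  unfold boost
  positivity

theorem spin_pos (hy : y ∈ V) : 0 < R.spin y := by
  have := H.S_pos y hy
  have := H.P_pos y hy
  unfold spin
  positivity

theorem spin_sq (hy : y ∈ V) : R.spin y ^ 2 = R.P y / (2 * R.S y) :=
  Real.sq_sqrt (div_nonneg (H.P_pos y hy).le (mul_pos two_pos (H.S_pos y hy)).le)

theorem smooth_S : ContDiffOn ℝ ∞ R.S V := by
  have := H.smooth_r
  have := H.smooth_x
  unfold S
  fun_prop

/-- The absolute value is smooth off the zeros of `Q`; it lets one frame serve on both sides of a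
horizon, canonical only where `Q > 0`. -/
theorem smooth_boost : ContDiffOn ℝ ∞ R.boost V := by
  have hr := H.smooth_r
  have hS := H.smooth_S
  have hQ : ContDiffOn ℝ ∞ R.Q V := by
    unfold Q
    fun_prop
  have hQ' : ContDiffOn ℝ ∞ (fun y => |R.Q y|) V := fun y hy =>
    (contDiffAt_abs (H.Q_ne y hy)).comp_contDiffWithinAt y (hQ y hy)
  refine ContDiffOn.sqrt (hQ'.div (contDiffOn_const.mul hS) fun y hy =>
    (mul_pos two_pos (H.S_pos y hy)).ne') fun y hy => ?_
  exact (div_pos (abs_pos.mpr (H.Q_ne y hy)) (mul_pos two_pos (H.S_pos y hy))).ne'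

theorem smooth_spin : ContDiffOn ℝ ∞ R.spin V := by
  have hx := H.smooth_x
  have hS := H.smooth_S
  have hP : ContDiffOn ℝ ∞ R.P V := by
    unfold P
    fun_prop
  refine ContDiffOn.sqrt (hP.div (contDiffOn_const.mul hS) fun y hy =>
    (mul_pos two_pos (H.S_pos y hy)).ne') fun y hy => ?_
  exact (div_pos (H.P_pos y hy) (mul_pos two_pos (H.S_pos y hy))).ne'

end IsChart

namespace IsAdapted

variable {g : MetricField} {o : ℤˣ} {V : Set Pt} {j : ℂ} (H : R.IsAdapted g o V j) {y : Pt}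
include H

theorem conj_cmp₂ (hy : y ∈ V) (u : Fin 4 → ℂ) : conj ((R.toCarter j).coframe.cmp y u 2) =
    R.spin y ^ 2 * (R.toCarter j).coframe.cmp y (fun i => conj (u i)) 3 := by
  have hS : (R.S y : ℂ) ≠ 0 := by exact_mod_cast (H.chart.S_pos y hy).ne'
  have hP : (R.P y : ℂ) ≠ 0 := by exact_mod_cast (H.chart.P_pos y hy).ne'
  rw [← Complex.ofReal_pow, H.chart.spin_sq hy, CoframeData.cmp, ev_conj, CoframeData.cmp, ev, ev,
    Finset.mul_sum]
  refine Finset.sum_congr rfl fun i _ => ?_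
  rw [θ₂_eq H.j_sq, θ₃_eq H.j_sq]
  simp only [map_div₀, map_sub, map_mul, map_inv₀, Complex.conj_ofReal, H.conj_j,
    Complex.conj_ofNat]
  push_cast
  field_simp
  ring

theorem conj_cmp₃ (hy : y ∈ V) (u : Fin 4 → ℂ) :
    R.spin y ^ 2 * conj ((R.toCarter j).coframe.cmp y u 3) =
      (R.toCarter j).coframe.cmp y (fun i => conj (u i)) 2 := by
  have h1 := congrArg conj (H.conj_cmp₂ hy fun i => conj (u i))
  simp only [Complex.conj_conj, map_mul, map_pow, Complex.conj_ofReal] at h1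
  exact h1.symm

/-- `L` and `N` are real and conjugation only exchanges the directions of `M` and `K`, so the
vectors dual to `L` and `N` are real. Taking real parts in `frame` therefore loses nothing. -/
theorem conj_E (hy : y ∈ V) {α : Fin 4} (hα : α = 0 ∨ α = 1) :
    (fun i => conj ((R.toCarter j).coframe.E α y i)) = (R.toCarter j).coframe.E α y := by
  have hs : (R.spin y : ℂ) ^ 2 ≠ 0 := by exact_mod_cast pow_ne_zero 2 (H.chart.spin_pos hy).ne'
  refine H.null.ext_cmp hy fun β => ?_
  have e := H.null.cmp_E hy
  have h0 := H.isReal.conj_cmp₀ hy ((R.toCarter j).coframe.E α y)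
  have h1 := H.isReal.conj_cmp₁ hy ((R.toCarter j).coframe.E α y)
  have h2 := H.conj_cmp₃ hy ((R.toCarter j).coframe.E α y)
  have h3 := H.conj_cmp₂ hy ((R.toCarter j).coframe.E α y)
  rw [e] at h0 h1 h2 h3 ⊢
  rcases hα with rfl | rfl <;> fin_cases β <;> simp at h0 h1 h2 h3 ⊢
  all_goals first
    | exact h0.symm
    | exact h1.symm
    | exact h2.symm
    | exact (h3.resolve_left (by exact_mod_cast (H.chart.spin_pos hy).ne'))

theorem ofReal_re_E (hy : y ∈ V) {α : Fin 4} (hα : α = 0 ∨ α = 1) (i : Fin 4) :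
    (((R.toCarter j).coframe.E α y i).re : ℂ) = (R.toCarter j).coframe.E α y i :=
  Complex.conj_eq_iff_re.mp (congrFun (H.conj_E hy hα) i)

section

variable (hj : ∀ z ∈ V, R.phase o z = j)
include hj

theorem frame_lC (hy : y ∈ V) :
    (R.frame o).lC y = fun i => (R.boost y : ℂ) * (R.toCarter j).coframe.E 0 y i := by
  ext i
  rw [Tetrad.lC, frame, Complex.ofReal_mul, hj y hy, H.ofReal_re_E hy (.inl rfl)]

theorem frame_nC (hy : y ∈ V) :
    (R.frame o).nC y = fun i => (R.boost y : ℂ)⁻¹ * (R.toCarter j).coframe.E 1 y i := by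
  ext i
  rw [Tetrad.nC, frame, Complex.ofReal_mul, hj y hy, H.ofReal_re_E hy (.inr rfl),
    Complex.ofReal_inv]

omit H in
theorem frame_m (hy : y ∈ V) : (R.frame o).m y =
    fun i => Complex.I * R.spin y * (R.toCarter j).coframe.E 2 y i := by
  ext i
  simp only [frame, hj y hy]

/-- Conjugation takes `E 2` to `spin⁻² E 3`, so `m = i spin E 2` has conjugate `-i spin⁻¹ E 3`. This
scaling gives `m · m̄ = 1`. -/
theorem frame_cmp_mbar (hy : y ∈ V) (α : Fin 4) : (R.toCarter j).coframe.cmp y ((R.frame o).mbar y) α =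
    -Complex.I * (R.spin y : ℂ)⁻¹ * (1 : Matrix (Fin 4) (Fin 4) ℂ) α 3 := by
  have hs : (R.spin y : ℂ) ≠ 0 := by exact_mod_cast (H.chart.spin_pos hy).ne'
  set c := (R.toCarter j).coframe
  have e : ∀ β, c.cmp y ((R.frame o).m y) β =
      Complex.I * R.spin y * (1 : Matrix (Fin 4) (Fin 4) ℂ) β 2 := fun β => by
    rw [frame_m hj hy, CoframeData.cmp_smul, H.null.cmp_E hy]
  have h0 := H.isReal.conj_cmp₀ hy ((R.frame o).m y)
  have h1 := H.isReal.conj_cmp₁ hy ((R.frame o).m y)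
  have h2 := H.conj_cmp₃ hy ((R.frame o).m y)
  have h3 := H.conj_cmp₂ hy ((R.frame o).m y)
  rw [show (fun i => conj ((R.frame o).m y i)) = (R.frame o).mbar y from rfl, e] at h0 h1 h2 h3
  fin_cases α <;> simp at h0 h1 h2 h3 ⊢
  · exact h0.symm
  · exact h1.symm
  · exact h2.symm
  · apply mul_left_cancel₀ (pow_ne_zero 2 hs)
    rw [← h3]
    field_simp
    exact congrArg Neg.neg (Matrix.one_apply_eq 3).symm

theorem frame_aligned (hy : y ∈ V) : (R.toCarter j).coframe.Aligned (R.frame o) y := by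
  have hs : (R.spin y : ℂ) ≠ 0 := by exact_mod_cast (H.chart.spin_pos hy).ne'
  have hb : (R.boost y : ℂ) ≠ 0 := by exact_mod_cast (H.chart.boost_pos hy).ne'
  have em := H.frame_cmp_mbar hj hy
  refine ⟨?_, ?_, ?_, ?_, ?_, ?_⟩
  all_goals simp only [em, H.frame_lC hj hy, H.frame_nC hj hy, frame_m hj hy, CoframeData.cmp_smul,
    H.null.cmp_E hy]
  · simp
  · simp
  · simp
  · simp
  · simp [hb]
  · simp only [Matrix.one_apply_eq]
    field_simp
    linear_combination -Complex.I_sq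

theorem frame_smooth : ContDiffOn ℝ ∞ (R.frame o).l V ∧ ContDiffOn ℝ ∞ (R.frame o).n V ∧
    ContDiffOn ℝ ∞ (R.frame o).m V := by
  have hb := H.chart.smooth_boost
  have hE : ∀ α i, ContDiffOn ℝ ∞ (fun y => ((R.toCarter j).coframe.E α y i).re) V := fun α i =>
    Complex.reCLM.contDiff.comp_contDiffOn (H.null.smooth_E α i)
  refine ⟨contDiffOn_pi.mpr fun i => ?_, contDiffOn_pi.mpr fun i => ?_, contDiffOn_pi.mpr fun i => ?_⟩
  · refine (hb.mul (hE 0 i)).congr fun y hy => ?_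
    simp only [frame, hj y hy]
  · refine ((hb.inv fun y hy => (H.chart.boost_pos hy).ne').mul (hE 1 i)).congr fun y hy => ?_
    simp only [frame, hj y hy, Pi.inv_apply]
  · refine (((contDiffOn_const (c := Complex.I)).mul (IsChart.smooth_ofReal H.chart.smooth_spin)).mul
      (H.null.smooth_E 2 i)).congr fun y hy => ?_
    simp only [frame, hj y hy]

/-- `ρ = μ` amounts to `boost² = Q/(2S)`. For `c ≠ 0`, `τ = π` asks that the factor of `m` have
square `-P/(2S)`, which explains the `i` in `frame`. -/
theorem frame_canonical (hy : y ∈ V) (hQ : 0 < R.Q y) :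
    spinRho g (R.frame o) y = spinMu g (R.frame o) y ∧
      spinTau g (R.frame o) y = spinPi g (R.frame o) y := by
  have hC := H.chart.toCarter H.j_sq
  have hs : (R.spin y : ℂ) ≠ 0 := by exact_mod_cast (H.chart.spin_pos hy).ne'
  have hb : (R.boost y : ℂ) ≠ 0 := by exact_mod_cast (H.chart.boost_pos hy).ne'
  have hS := H.chart.S_pos y hy
  have hS' : (R.S y : ℂ) ≠ 0 := by exact_mod_cast hS.ne'
  have hb2 : (R.boost y : ℂ) ^ 2 = R.Q y / (2 * R.S y) := by
    have : R.boost y ^ 2 = R.Q y / (2 * R.S y) := by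
      rw [boost, abs_of_pos hQ]
      exact Real.sq_sqrt (by positivity)
    exact_mod_cast this
  have hs2 : (R.spin y : ℂ) ^ 2 = R.P y / (2 * R.S y) := by exact_mod_cast H.chart.spin_sq hy
  obtain ⟨sl, sn, -⟩ := H.frame_smooth hj
  obtain ⟨h1, h2, h3, h4⟩ := H.null.spin_of_aligned H.chart.isOpen subset_rfl sl sn
    (fun z hz => H.frame_aligned hj hz) hy
  rw [h1, h2, h3, h4, H.frame_cmp_mbar hj hy, H.frame_lC hj hy, H.frame_nC hj hy, frame_m hj hy,
    CoframeData.cmp_smul, CoframeData.cmp_smul, CoframeData.cmp_smul, H.null.cmp_E hy,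
    H.null.cmp_E hy, H.null.cmp_E hy, hC.rho_eq hy, hC.mu_eq hy, hC.tau_eq hy, hC.pi_eq hy,
    toCarter_ζ_inv H.j_sq, toCarter_P H.j_sq, toCarter_Q H.j_sq]
  simp only [Matrix.one_apply_eq]
  constructor
  · apply mul_left_cancel₀ hb
    have e : (R.boost y : ℂ) * (R.boost y : ℂ)⁻¹ = 1 := mul_inv_cancel₀ hb
    linear_combination -((R.toCarter j).ζ' y)⁻¹ * hb2
      + (R.Q y * (R.S y : ℂ)⁻¹ / 2 * ((R.toCarter j).ζ' y)⁻¹) * e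
  · apply mul_left_cancel₀ hs
    have e : (R.spin y : ℂ) * (R.spin y : ℂ)⁻¹ = 1 := mul_inv_cancel₀ hs
    linear_combination Complex.I * (R.toCarter j).c * ((R.toCarter j).ζ' y)⁻¹ * hs2
      - Complex.I * ((R.toCarter j).c * R.P y * (R.S y : ℂ)⁻¹ / 2 * ((R.toCarter j).ζ' y)⁻¹) * e

end

/-- Since `ψ'` is the conjugate of `ψ`, both halves of the Weyl tensor vanish with `ψ`. -/
theorem ψ_ne_zero (hy : y ∈ V) (hw : weyl g y ≠ 0) : (R.toCarter j).ψ y ≠ 0 := by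
  intro h0
  refine hw ?_
  ext a b k l
  have h1 := H.null.weyl_eq H.typeD hy a b k l
  rw [← conj_ψ H.conj_j, h0, map_zero, zero_smul, zero_smul, add_zero] at h1
  exact Complex.ofReal_eq_zero.mp h1

end IsAdapted

end RealCarter

namespace BlackHole

variable (B : BlackHole) (o : ℤˣ)

theorem isAdapted {x : Pt} (hx : x ∈ B.domain) :
    B.carter.IsAdapted B.metric o (B.carter.sheet B.domain x) (B.carter.phase o x) :=
  B.isChart.isAdapted B.metric_eq o hx

theorem mem_sheet {x : Pt} (hx : x ∈ B.domain) : x ∈ B.carter.sheet B.domain x :=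
  B.isChart.mem_sheet hx

/-- Smoothness is local, and the pointwise phase in `frame` is constant on each sheet. -/
theorem frame_smooth : ContDiffOn ℝ ∞ (B.carter.frame o).l B.domain ∧
    ContDiffOn ℝ ∞ (B.carter.frame o).n B.domain ∧
    ContDiffOn ℝ ∞ (B.carter.frame o).m B.domain := by
  have h := fun x (hx : x ∈ B.domain) =>
    (B.isAdapted o hx).frame_smooth fun _ hz => RealCarter.phase_eq o hz
  refine ⟨?_, ?_, ?_⟩ <;> refine contDiffOn_of_locally_contDiffOn fun x hx =>
    ⟨_, B.isChart.isOpen_sheet, B.mem_sheet hx, ?_⟩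
  · exact (h x hx).1.mono Set.inter_subset_right
  · exact (h x hx).2.1.mono Set.inter_subset_right
  · exact (h x hx).2.2.mono Set.inter_subset_right

theorem isTypeDFrameOn : IsTypeDFrameOn B.metric o (B.carter.frame o) B.regular := by
  have hsub : B.regular ⊆ B.domain := Set.sep_subset _ _
  obtain ⟨sl, sn, sm⟩ := B.frame_smooth o
  have H := fun x (hx : x ∈ B.regular) => B.isAdapted o (hsub hx)
  have ms := fun x (hx : x ∈ B.regular) => B.mem_sheet (hsub hx)
  have al := fun x (hx : x ∈ B.regular) =>
    (H x hx).frame_aligned (fun _ hz => RealCarter.phase_eq o hz) (ms x hx)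
  exact
    { nullTetrad :=
        { smooth_l := sl.mono hsub
          smooth_n := sn.mono hsub
          smooth_m := sm.mono hsub
          ll := fun x hx => (al x hx).metricC_ll (H x hx).null (ms x hx)
          nn := fun x hx => (al x hx).metricC_nn (H x hx).null (ms x hx)
          ln := fun x hx => (al x hx).metricC_ln (H x hx).null (ms x hx)
          lm := fun x hx => (al x hx).metricC_lm (H x hx).null (ms x hx)
          nm := fun x hx => (al x hx).metricC_nm (H x hx).null (ms x hx)
          mm := fun x hx => (al x hx).metricC_mm (H x hx).null (ms x hx)
          mmbar := fun x hx => (al x hx).metricC_mmbar (H x hx).null (ms x hx)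
          oriented := fun x hx => (al x hx).volC (ms x hx) (H x hx).oriented }
      psi0 := fun x hx => (al x hx).psi0 (H x hx).null (ms x hx) (H x hx).typeD
      psi1 := fun x hx => (al x hx).psi1 (H x hx).null (ms x hx) (H x hx).typeD
      psi2 := fun x hx => by
        rw [(H x hx).null.psi2_of_aligned (H x hx).typeD (ms x hx) (.inl (al x hx))]
        exact (H x hx).ψ_ne_zero (ms x hx) hx.2
      psi3 := fun x hx => (al x hx).psi3 (H x hx).null (ms x hx) (H x hx).typeD
      psi4 := fun x hx => (al x hx).psi4 (H x hx).null (ms x hx) (H x hx).typeD }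

theorem isCanonicalFrameOn : IsCanonicalFrameOn B.metric o (B.carter.frame o)
    {x ∈ B.regular | 0 < B.horizonFn x} := by
  have h := B.isTypeDFrameOn o
  have t := h.nullTetrad
  have hsub : {x ∈ B.regular | 0 < B.horizonFn x} ⊆ B.regular := Set.sep_subset _ _
  have hc := fun x (hx : x ∈ {x ∈ B.regular | 0 < B.horizonFn x}) =>
    (B.isAdapted o hx.1.1).frame_canonical (fun _ hz => RealCarter.phase_eq o hz)
      (B.mem_sheet hx.1.1) (B.carter_Q_pos hx.1.1 hx.2)
  exact
    { typeD :=
        { nullTetrad :=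
            ⟨t.smooth_l.mono hsub, t.smooth_n.mono hsub, t.smooth_m.mono hsub,
              fun x hx => t.ll x hx.1, fun x hx => t.nn x hx.1, fun x hx => t.ln x hx.1,
              fun x hx => t.lm x hx.1, fun x hx => t.nm x hx.1, fun x hx => t.mm x hx.1,
              fun x hx => t.mmbar x hx.1, fun x hx => t.oriented x hx.1⟩
          psi0 := fun x hx => h.psi0 x hx.1
          psi1 := fun x hx => h.psi1 x hx.1
          psi2 := fun x hx => h.psi2 x hx.1
          psi3 := fun x hx => h.psi3 x hx.1
          psi4 := fun x hx => h.psi4 x hx.1 }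
      rho_eq_mu := fun x hx => (hc x hx).1
      tau_eq_pi := fun x hx => (hc x hx).2 }

end BlackHole

/-! ### Canonical frames of the vacuum and the static black holes -/

namespace RealCarter.IsAdapted

variable {R : RealCarter} {g : MetricField} {o : ℤˣ} {V : Set Pt} {j : ℂ} (H : R.IsAdapted g o V j)
  {U : Set Pt} {e : Tetrad} (hU : IsOpen U) (he : IsTypeDFrameOn g o e U) {x : Pt}
  (hx : x ∈ V) (hxU : x ∈ U) (hρ : spinRho g e x = spinMu g e x)
  (hτ : spinTau g e x = spinPi g e x)
include H hU he hx hxU hρ hτ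

/-- The general canonical formulas at `Φ₁₁ = 0`, which `w = 0` forces. -/
theorem canonical_vacuum (hw : R.w = 0) :
    gradDot g (Psi2 g e) (Psi2 g e) x =
      18 * Psi2 g e x ^ 2 * (spinRho g e x ^ 2 - spinTau g e x ^ 2) ∧
    gradDot g (Psi2 g e) (fun y => conj (Psi2 g e y)) x =
      18 * (Psi2 g e x * conj (Psi2 g e x)) *
        ((‖spinRho g e x‖ : ℂ) ^ 2 + (‖spinTau g e x‖ : ℂ) ^ 2) ∧
    (Q1 g o x : ℂ) = ((spinRho g e x ^ 2 - spinTau g e x ^ 2)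
      + conj (spinRho g e x ^ 2 - spinTau g e x ^ 2)) / (‖Psi2 g e x‖ : ℂ) ∧
    (Q2 g o x : ℂ) = (spinRho g e x * conj (spinTau g e x)
      + conj (spinRho g e x) * spinTau g e x) ^ 2 / (‖Psi2 g e x‖ : ℂ) ^ 2 ∧
    Q3 g o x = (‖spinRho g e x‖ ^ 2 + ‖spinTau g e x‖ ^ 2) / ‖Psi2 g e x‖ := by
  have hΦ := H.phi11_eq hU he hx hxU
  rw [hw, zero_div, Complex.ofReal_zero] at hΦ
  refine ⟨?_, ?_, ?_, ?_, ?_⟩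
  · rw [H.canonical_gradDot hU he hx hxU hρ hτ, hΦ]
    ring
  · rw [H.canonical_gradDot_conj hU he hx hxU hρ hτ, hΦ]
    ring
  · rw [H.canonical_Q1 hU he hx hxU hρ hτ, hΦ, Complex.add_conj]
    push_cast
    ring
  · rw [H.canonical_Q2 hU he hx hxU hρ hτ, hΦ]
    ring
  · have h := H.canonical_Q3 hU he hx hxU hρ hτ
    rw [hΦ] at h
    have h' : (Q3 g o x : ℂ) =
        (((‖spinRho g e x‖ ^ 2 + ‖spinTau g e x‖ ^ 2) / ‖Psi2 g e x‖ : ℝ) : ℂ) := by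
      rw [h]
      push_cast
      ring
    exact_mod_cast h'

theorem canonical_static (hc : R.c = 0) :
    spinTau g e x = 0 ∧ spinPi g e x = 0 ∧ conj (spinRho g e x) = spinRho g e x ∧
    conj (Psi2 g e x) = Psi2 g e x ∧ Q2 g o x = 0 ∧ Q1 g o x = 2 * Q3 g o x ∧
    (Q1 g o x : ℂ) = 8 * spinRho g e x ^ 2 * Phi11 g e x ^ 2 / (9 * (‖Psi2 g e x‖ : ℂ) ^ 3)
      + 8 * spinRho g e x ^ 2 * Phi11 g e x * Psi2 g e x / (3 * (‖Psi2 g e x‖ : ℂ) ^ 3)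
      + 2 * spinRho g e x ^ 2 / (‖Psi2 g e x‖ : ℂ) ∧
    (Q1 g o x : ℂ) = gradDot g (Psi2 g e) (Psi2 g e) x / (9 * (‖Psi2 g e x‖ : ℂ) ^ 3) := by
  have hn : (‖Psi2 g e x‖ : ℂ) ≠ 0 := by exact_mod_cast norm_ne_zero_iff.mpr (he.psi2 x hxU)
  obtain ⟨hτ0, hπ0, hρr, hΨ⟩ := H.static hU he hx hxU hc
  have hΨx := hΨ x ⟨hxU, hx⟩
  have hd := H.hasPd_psi2 hU he hx hxU
  -- `Ψ₂` is real on a neighbourhood and not merely at `x`, so its conjugate has the same gradient.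
  -- This makes the numerator of `Q₂` vanish and gives `Q₁ = 2 Q₃`.
  have hG : gradDot g (Psi2 g e) (fun y => conj (Psi2 g e y)) x =
      gradDot g (Psi2 g e) (Psi2 g e) x := by
    rw [gradDot_eq hd hd, gradDot_eq hd (hd.congr (hU.inter H.chart.isOpen) ⟨hxU, hx⟩ hΨ)]
  obtain ⟨t, ht⟩ := H.exists_gradDot_conj hU he hx hxU
  have hn2 : Psi2 g e x ^ 2 = (‖Psi2 g e x‖ : ℂ) ^ 2 := by
    rw [← Complex.mul_conj', hΨx, sq]
  have hQ1 : (Q1 g o x : ℂ) = gradDot g (Psi2 g e) (Psi2 g e) x / (9 * (‖Psi2 g e x‖ : ℂ) ^ 3) := by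
    have h2 : conj (Psi2 g e x) ^ 2 * gradDot g (Psi2 g e) (Psi2 g e) x =
        ((‖Psi2 g e x‖ ^ 2 * t : ℝ) : ℂ) := by
      rw [hΨx, hn2, ← hG, ht]
      push_cast
      rfl
    rw [H.Q1_eq hU he hx hxU, h2, Complex.ofReal_re, ← hG, ht]
    push_cast
    field_simp
  have hQ3 := H.Q3_eq hU he hx hxU
  refine ⟨hτ0, hπ0, hρr, hΨx, ?_, ?_, ?_, hQ1⟩
  · have h := H.Q2_eq hU he hx hxU
    rw [hG, ← hG, ht, Complex.conj_ofReal] at h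
    have h' : (Q2 g o x : ℂ) = 0 := by
      rw [h]
      ring
    exact_mod_cast h'
  · have h' : (Q1 g o x : ℂ) = ((2 * Q3 g o x : ℝ) : ℂ) := by
      rw [Complex.ofReal_mul, hQ3, hQ1, hG]
      push_cast
      field_simp
      ring
    exact_mod_cast h'
  · rw [hQ1, H.canonical_gradDot hU he hx hxU hρ hτ, hτ0, hn2]
    field_simp
    ring

end RealCarter.IsAdapted

end BlackHoleInvariants

end

theorem mainTheorem2 (o : ℤˣ) :
    -- Frames adapted to the type D structure exist; canonical ones exist where `Q > 0`.
    (∀ B : BlackHole, ∃ e : Tetrad,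
      IsTypeDFrameOn B.metric o e B.regular ∧
      IsCanonicalFrameOn B.metric o e {x ∈ B.regular | 0 < B.horizonFn x}) ∧
    -- All the black holes, in every frame adapted to the type D structure.
    (∀ (B : BlackHole) (U : Set Pt) (e : Tetrad), IsOpen U → U ⊆ B.domain →
      IsTypeDFrameOn B.metric o e U → ∀ x ∈ U,
      let g := B.metric
      let Ψ : ℂ := Psi2 g e x
      let Ψf : Pt → ℂ := Psi2 g e
      let Ψbf : Pt → ℂ := fun y => conj (Psi2 g e y)
      (I1 g x : ℂ) + Complex.I * I2 g o x = 48 * Ψ ^ 2 ∧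
      (I3 g x : ℂ) + Complex.I * I4 g o x =
        48 * gradDot g Ψf Ψf x +
          576 * Ψ ^ 2 * (spinRho g e x * spinMu g e x - spinTau g e x * spinPi g e x) ∧
      (B.charge = 0 →
        (96 * Ψ) ^ 2 * gradDot g Ψf Ψf x =
          12 * 48 * Ψ ^ 2 * ((I3 g x : ℂ) + Complex.I * I4 g o x) / 5 ∧
        I3 g x = (80 * gradDot g Ψf Ψf x).re ∧
        I4 g o x = (80 * gradDot g Ψf Ψf x).im) ∧
      (I5 g x : ℂ) = 96 ^ 2 * (Ψ ^ 2 * gradDot g Ψf Ψf x + conj (Ψ ^ 2 * gradDot g Ψf Ψf x)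
        + 2 * (Ψ * conj Ψ) * gradDot g Ψf Ψbf x) / 4 ∧
      (I6 g o x : ℂ) = 96 ^ 2 * (-(Ψ ^ 2 * gradDot g Ψf Ψf x) - conj (Ψ ^ 2 * gradDot g Ψf Ψf x)
        + 2 * (Ψ * conj Ψ) * gradDot g Ψf Ψbf x) / 4 ∧
      (I7 g o x : ℂ) = 96 ^ 2 * (Ψ ^ 2 * gradDot g Ψf Ψf x - conj (Ψ ^ 2 * gradDot g Ψf Ψf x))
        / (4 * Complex.I) ∧
      Q1 g o x = (conj Ψ ^ 2 * gradDot g Ψf Ψf x).re / (9 * ‖Ψ‖ ^ 5) ∧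
      (Q2 g o x : ℂ) = -2 * wedgeNormSq g Ψf Ψbf x / (18 ^ 2 * (‖Ψ‖ : ℂ) ^ 6) ∧
      (Q3 g o x : ℂ) = gradDot g Ψf Ψbf x / (18 * (‖Ψ‖ : ℂ) ^ 3) ∧
      -- `Q₂` is dimensionless: it is unchanged when all lengths are rescaled by `c`.
      (∀ c : ℝ, 0 < c → Q2 (fun y => c ^ 2 • g y) o x = Q2 g o x)) ∧
    -- Kerr–NUT–(anti-)de Sitter, canonical frame.
    (∀ (a l m Λ : ℝ) (U : Set Pt) (e : Tetrad), IsOpen U →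
      U ⊆ (BlackHole.kerrNUTAdS a l m Λ).domain →
      IsCanonicalFrameOn (nutMetric a l m Λ) o e U → ∀ x ∈ U,
      let g := nutMetric a l m Λ
      let Ψ : ℂ := Psi2 g e x
      let Ψf : Pt → ℂ := Psi2 g e
      let Ψbf : Pt → ℂ := fun y => conj (Psi2 g e y)
      let ρ : ℂ := spinRho g e x
      let τ : ℂ := spinTau g e x
      gradDot g Ψf Ψf x = 18 * Ψ ^ 2 * (ρ ^ 2 - τ ^ 2) ∧
      gradDot g Ψf Ψbf x = 18 * (Ψ * conj Ψ) * ((‖ρ‖ : ℂ) ^ 2 + (‖τ‖ : ℂ) ^ 2) ∧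
      (Q1 g o x : ℂ) = ((ρ ^ 2 - τ ^ 2) + conj (ρ ^ 2 - τ ^ 2)) / (‖Ψ‖ : ℂ) ∧
      (Q2 g o x : ℂ) = (ρ * conj τ + conj ρ * τ) ^ 2 / (‖Ψ‖ : ℂ) ^ 2 ∧
      Q3 g o x = (‖ρ‖ ^ 2 + ‖τ‖ ^ 2) / ‖Ψ‖) ∧
    -- Kerr–Newman, canonical frame.
    (∀ (M a q : ℝ) (U : Set Pt) (e : Tetrad), IsOpen U →
      U ⊆ (BlackHole.kerrNewman M a q).domain →
      IsCanonicalFrameOn (knMetric M a q) o e U → ∀ x ∈ U,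
      let g := knMetric M a q
      let Ψ : ℂ := Psi2 g e x
      let Ψf : Pt → ℂ := Psi2 g e
      let Ψbf : Pt → ℂ := fun y => conj (Psi2 g e y)
      let Φ : ℂ := Phi11 g e x
      let ρ : ℂ := spinRho g e x
      let τ : ℂ := spinTau g e x
      gradDot g Ψf Ψf x =
        8 * (ρ ^ 2 - τ ^ 2) * Φ ^ 2 + 24 * (τ ^ 2 + ρ ^ 2) * Ψ * Φ + 18 * Ψ ^ 2 * (ρ ^ 2 - τ ^ 2) ∧
      gradDot g Ψf Ψbf x =
        8 * ((‖ρ‖ : ℂ) ^ 2 + (‖τ‖ : ℂ) ^ 2) * Φ ^ 2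
        + (12 * ((‖ρ‖ : ℂ) ^ 2 - (‖τ‖ : ℂ) ^ 2) * conj Ψ
            + conj (12 * ((‖ρ‖ : ℂ) ^ 2 - (‖τ‖ : ℂ) ^ 2) * conj Ψ)) * Φ
        + 18 * (Ψ * conj Ψ) * ((‖ρ‖ : ℂ) ^ 2 + (‖τ‖ : ℂ) ^ 2) ∧
      (Q1 g o x : ℂ) =
        8 / 9 * ((conj Ψ ^ 2 * (ρ ^ 2 - τ ^ 2)).re : ℂ) * Φ ^ 2 / (‖Ψ‖ : ℂ) ^ 5
        + 8 / 3 * (((ρ ^ 2 + τ ^ 2) * conj Ψ).re : ℂ) * Φ / (‖Ψ‖ : ℂ) ^ 3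
        + 2 * ((ρ ^ 2 - τ ^ 2).re : ℂ) / (‖Ψ‖ : ℂ) ∧
      (Q2 g o x : ℂ) =
        16 / 81 * (ρ * conj τ + conj ρ * τ) ^ 2 * Φ ^ 4 / (‖Ψ‖ : ℂ) ^ 6
        + 32 / 27 * ((Ψ * (ρ * conj τ - conj ρ * τ)).re : ℂ) * (ρ * conj τ + conj ρ * τ) * Φ ^ 3
            / (‖Ψ‖ : ℂ) ^ 6
        + 8 / 9 * (((Ψ ^ 2 * (ρ * conj τ - conj ρ * τ) ^ 2).re : ℂ)
            - 4 * (‖Ψ‖ : ℂ) ^ 2 * (((ρ * conj τ) ^ 2).re : ℂ)) * Φ ^ 2 / (‖Ψ‖ : ℂ) ^ 6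
        - 8 / 3 * (ρ * conj τ + conj ρ * τ) * ((Ψ * (ρ * conj τ - conj ρ * τ)).re : ℂ) * Φ
            / (‖Ψ‖ : ℂ) ^ 4
        + (ρ * conj τ + conj ρ * τ) ^ 2 / (‖Ψ‖ : ℂ) ^ 2 ∧
      (Q3 g o x : ℂ) =
        4 / 9 * ((‖ρ‖ : ℂ) ^ 2 + (‖τ‖ : ℂ) ^ 2) * Φ ^ 2 / (‖Ψ‖ : ℂ) ^ 3
        + 4 / 3 * ((Ψ * ((‖ρ‖ : ℂ) ^ 2 - (‖τ‖ : ℂ) ^ 2)).re : ℂ) * Φ / (‖Ψ‖ : ℂ) ^ 3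
        + ((‖ρ‖ : ℂ) ^ 2 + (‖τ‖ : ℂ) ^ 2) / (‖Ψ‖ : ℂ)) ∧
    -- Reissner–Nordström–(anti-)de Sitter, canonical frame.
    (∀ (M q Λ : ℝ) (U : Set Pt) (e : Tetrad), IsOpen U →
      U ⊆ (BlackHole.reissnerNordstromAdS M q Λ).domain →
      IsCanonicalFrameOn (rnMetric M q Λ) o e U → ∀ x ∈ U,
      let g := rnMetric M q Λ
      let Ψ : ℂ := Psi2 g e x
      let Ψf : Pt → ℂ := Psi2 g e
      let Φ : ℂ := Phi11 g e x
      let ρ : ℂ := spinRho g e x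
      spinTau g e x = 0 ∧ spinPi g e x = 0 ∧ conj ρ = ρ ∧ conj Ψ = Ψ ∧
      Q2 g o x = 0 ∧
      Q1 g o x = 2 * Q3 g o x ∧
      (Q1 g o x : ℂ) =
        8 * ρ ^ 2 * Φ ^ 2 / (9 * (‖Ψ‖ : ℂ) ^ 3) + 8 * ρ ^ 2 * Φ * Ψ / (3 * (‖Ψ‖ : ℂ) ^ 3)
        + 2 * ρ ^ 2 / (‖Ψ‖ : ℂ) ∧
      (Q1 g o x : ℂ) = gradDot g Ψf Ψf x / (9 * (‖Ψ‖ : ℂ) ^ 3)) := by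
  refine ⟨fun B => ⟨B.carter.frame o, B.isTypeDFrameOn o, B.isCanonicalFrameOn o⟩, ?_, ?_, ?_, ?_⟩
  · intro B U e hU hUB he x hx
    -- All the claims are local at `x`, so they may be proved on the sheet of `x`, where a single
    -- imaginary unit orients the chart.
    have H := B.isAdapted o (hUB hx)
    have hs := B.mem_sheet (hUB hx)
    refine ⟨H.I1_add_I2 hU he hs hx, H.I3_add_I4 hU he hs hx, fun hq => ?_, H.I5_eq hU he hs hx,
      H.I6_eq hU he hs hx, H.I7_eq hU he hs hx, H.Q1_eq hU he hs hx, H.Q2_eq_wedge hU he hs hx,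
      H.Q3_eq hU he hs hx, fun c hc => Q2_smul (pow_pos hc 2) _ _ _⟩
    have h := H.uncharged hU he hs hx (B.carter_w_eq_zero hq)
    refine ⟨?_, ?_, ?_⟩
    · rw [h]
      ring
    · rw [← h]
      simp
    · rw [← h]
      simp
  · intro a l m Λ U e hU hUB he x hx
    have H := (BlackHole.kerrNUTAdS a l m Λ).isAdapted o (hUB hx)
    have hs := (BlackHole.kerrNUTAdS a l m Λ).mem_sheet (hUB hx)
    -- The final `rfl` is `w = 0`: this family carries no charge.
    exact H.canonical_vacuum hU he.typeD hs hx (he.rho_eq_mu x hx) (he.tau_eq_pi x hx) rfl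
  · intro M a q U e hU hUB he x hx
    have H := (BlackHole.kerrNewman M a q).isAdapted o (hUB hx)
    have hs := (BlackHole.kerrNewman M a q).mem_sheet (hUB hx)
    have hρ := he.rho_eq_mu x hx
    have hτ := he.tau_eq_pi x hx
    exact ⟨H.canonical_gradDot hU he.typeD hs hx hρ hτ, H.canonical_gradDot_conj hU he.typeD hs hx hρ hτ,
      H.canonical_Q1 hU he.typeD hs hx hρ hτ, H.canonical_Q2 hU he.typeD hs hx hρ hτ,
      H.canonical_Q3 hU he.typeD hs hx hρ hτ⟩
  · intro M q Λ U e hU hUB he x hx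
    have H := (BlackHole.reissnerNordstromAdS M q Λ).isAdapted o (hUB hx)
    have hs := (BlackHole.reissnerNordstromAdS M q Λ).mem_sheet (hUB hx)
    -- The final `rfl` is `c = 0`: there is no rotation.
    exact H.canonical_static hU he.typeD hs hx (he.rho_eq_mu x hx) (he.tau_eq_pi x hx) rfl
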